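/- **Conventions.** For a local ring $(S,\mathfrak n,\Bbbk)$ of embedding dimension $n=\dim_{\Bbbk}\mathfrak n/\mathfrak n^2$ put $$v(S)=\inf\Big\{i\ \Big|\ \dim_{\Bbbk}(\mathfrak n^i/\mathfrak n^{i+1})<\tbinom{n-1+i}{i}\Big\}.$$ For an ideal $J$ of $S$ put $c_S(S/J)=\lambda_S(S)-\lambda_S(S/J)$, where $\lambda_S$ is length. For ideals, $I:_SL=\{x\in S\mid xL\subseteq I\}$. For a finitely generated $S$-module $M$ with minimal number of generators $\mu(M)$, $\operatorname{Fitt}^1_S(M)$ is the ideal generated by the entries of $\phi$, for a presentation $S^b\xrightarrow{\phi}S^{\mu(M)}\to M\to0$ (it does not depend on the choice of $\phi$). The socle of an $S$-module is the submodule annihilated by $\mathfrak n$. If $S$ is graded, $\operatorname{maxgendeg}(K)$ is the least $\tau$ such that the homogeneous ideal $K\ne 0$ is generated by its homogeneous elements of degree at most $\tau$. A graded ring $S=\bigoplus_{i\ge0}[S]_i$ is standard-graded over the field $[S]_0$ if it is generated as an $[S]_0$-algebra by $[S]_1$, a finitely generated $[S]_0$-module. Let $S$ be an Artinian Gorenstein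 local ring with maximal ideal $\mathfrak n$, $J$ an ideal of $S$, and $R=S/J$. We say that one of the following *splitting theorems applies to $R$* if its hypotheses are satisfied, that is: * *Theorem I applies to $R$* if $J=0:_SK$ for an ideal $K$ of $S$ with $\operatorname{Fitt}^1_S(K)=\mathfrak n$ and $(\mathfrak nK:_S\mathfrak n)\neq(K:_S\mathfrak n)$. * *Theorem II applies to $R$* if there are a commutative Noetherian ring $P$ and ideals $A,B$ of $P$ such that $A\subseteq B^2$, $P/A$ and $P/B$ are Artinian Gorenstein local rings, $B$ is generated by a regular $P$-sequence of length at least two, $S=P/A$, and $J=(A:_PB)/A$ (so that $R=P/(A:_PB)$). * *Theorem III applies to $R$* if there are a field $\Bbbk$, an integer $s\ge0$, the standard-graded polynomial ring $P=\Bbbk[X_1,X_2,X_3,Y_1,\dots,Y_s]$, an ideal $B'$ of $P$ generated by five linearly independent quadratic forms in $X_1,X_2,X_3$, the ideal $B=B'+(Y_1,\dots,Y_s)$ with $[\operatorname{socle}(P/B)]_1=0$, and a homogeneous ideal $A\subseteq([P]_1)^5$ of $P$ with $P/A$ Artinian Gorenstein local, such that $S=P/A$ and $J=(A:_PB)/A$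 (so that $R=P/(A:_PB)$). **Theorem.** There is an absolute constant $N$ with the following property. Let $(S,\mathfrak n,\Bbbk)$ be an equicharacteristic Artinian Gorenstein local ring of embedding dimension at least two, let $J$ be a proper non-zero ideal of $S$, and let $R=S/J$. Assume that either * $1\le c_S(R)\le4$, or * $c_S(R)=5$ and $S$ is a standard-graded algebra over a field $[S]_0$. If $v(S)\ge N$ and, in case $c_S(R)=5$, $J$ is homogeneous (for some such grading of $S$), then one of Theorems I, II, III applies to $R$. Moreover, the following statements hold, where $k$ denotes the minimal number of generators of $\mathfrak n/(0:_SJ)$; in (f)–(i), $S$ is standard-graded over a field $[S]_0$ and $J$ is homogeneous. * (a) If $k=0$, then Theorem I applies to $R$. * (b) If $k=1$, then Theorem II applies to $R$, provided $2c_S(R)\le v(S)$. * (c) If $2\le k=c_S(R)-1$, then Theorem I applies to $R$, provided $3\le v(S)$. * (d) If $k=2$, $c_S(R)=4$, and $\mathfrak n^3\subseteq\mathfrak n(0:_SJ)$, then Theorem II applies to $R$, provided $5\le v(S)$. * (e) If $k=2$, $c_S(R)=4$, and $\mathfrak n^3\not\subseteq\mathfrak n(0:_SJ)$, then Theorem I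 applies to $R$, provided $4\le v(S)$. * (f) If $k=2$ and $c_S(R)=5$, then Theorem I applies to $R$, provided $4\le v(S)$. * (g) If $k=3$, $c_S(R)=5$, and $3\le\operatorname{maxgendeg}(0:_SJ)$, then Theorem I applies to $R$, provided $3\le v(S)$. * (h) If $k=3$, $c_S(R)=5$, and $2\le\dim_{\Bbbk}\operatorname{socle}(S/(0:_SJ))$, then Theorem I applies to $R$, provided $3\le v(S)$. * (i) If $k=3$, $c_S(R)=5$, $\operatorname{maxgendeg}(0:_SJ)\le2$, and $\dim_{\Bbbk}\operatorname{socle}(S/(0:_SJ))=1$, then Theorem III applies to $R$, provided $5\le v(S)$. -/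

import Mathlib

open IsLocalRing

universe u v

noncomputable section

/-! ## Invariants of local rings and of quotients -/

/-- `S` is an Artinian Gorenstein local ring: an Artinian local ring that is injective as a module
over itself (for Artinian local rings this says that `S` has finite injective dimension over
itself, since a nonzero finitely generated module of finite injective dimension over a local ring
has injective dimension equal to the depth of the ring, here `0`). -/
structure IsArtinianGorensteinLocal (S : Type u) [CommRing S] : Prop where
  isLocalRing : IsLocalRing S
  isArtinianRing : IsArtinianRing S
  injective : Module.Injective S S

/-- A local ring is equicharacteristic if it has the same characteristic as its residue field. -/
def IsEquicharacteristic (S : Type u) [CommRing S] [IsLocalRing S] : Prop :=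
  ringChar S = ringChar (ResidueField S)

/-- The embedding dimension `dim (𝔫 / 𝔫 ^ 2)`. -/
def embeddingDim (S : Type u) [CommRing S] [IsLocalRing S] : ℕ :=
  Module.finrank (ResidueField S) (CotangentSpace S)

/-- The dimension of `𝔫 ^ i / 𝔫 ^ (i + 1) = 𝔫 ^ i / 𝔫 • 𝔫 ^ i` over the residue field `S ⧸ 𝔫`. -/
def hilbertFn (S : Type u) [CommRing S] [IsLocalRing S] (i : ℕ) : ℕ :=
  Module.finrank (S ⧸ maximalIdeal S)
    (↥(maximalIdeal S ^ i) ⧸ (maximalIdeal S • ⊤ : Submodule S ↥(maximalIdeal S ^ i)))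

/-- `v(S) = inf {i | dim (𝔫 ^ i / 𝔫 ^ (i + 1)) < binom (n - 1 + i) i}`, where `n` is the embedding
dimension of `S`; the infimum is taken in `ℕ ∪ {∞}`. -/
def vInv (S : Type u) [CommRing S] [IsLocalRing S] : ℕ∞ :=
  ⨅ (i : ℕ) (_ : hilbertFn S i < Nat.choose (embeddingDim S + i - 1) i), (i : ℕ∞)

/-- `c_S(S / J) = λ_S(S) - λ_S(S / J)`. -/
def colength {S : Type u} [CommRing S] (J : Ideal S) : ℕ∞ :=
  Module.length S S - Module.length S (S ⧸ J)

/-- The ideal `0 :_S J`. -/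
def annIdeal {S : Type u} [CommRing S] (J : Ideal S) : Ideal S :=
  (⊥ : Ideal S).colon (J : Set S)

/-- The minimal number of generators of a finitely generated module. -/
def minGenerators (S : Type u) [CommRing S] (M : Type v) [AddCommGroup M] [Module S M] : ℕ :=
  (⊤ : Submodule S M).spanFinrank

/-- The minimal number of generators of the `S`-module `𝔫 / K`, for an ideal `K ⊆ 𝔫`. -/
def minGeneratorsMaxMod {S : Type u} [CommRing S] [IsLocalRing S] (K : Ideal S) : ℕ :=
  minGenerators S (↥(maximalIdeal S) ⧸ K.submoduleOf (maximalIdeal S))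

/-- For a finitely generated module `M` over a local ring `S`, the ideal `Fitt¹_S(M)` generated by
the entries of a presentation matrix `φ` with `S ^ b → S ^ μ(M) → M → 0` exact. As the columns of
`φ` generate the module of relations on the chosen minimal generating family `g`, this is the
ideal generated by all coefficients of all relations on `g`; it is independent of `g`, and here
all the minimal generating families are used together. -/
def fittOne (S : Type u) [CommRing S] (M : Type v) [AddCommGroup M] [Module S M] : Ideal S :=
  Ideal.span {a : S | ∃ g : Fin (minGenerators S M) → M, Submodule.span S (Set.range g) = ⊤ ∧
    ∃ r : Fin (minGenerators S M) → S, ∑ j, r j • g j = 0 ∧ ∃ i, a = r i}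

/-- The dimension over the residue field of `socle(S / K) = {m ∈ S / K | 𝔫 m = 0}`. -/
def socleDim {S : Type u} [CommRing S] [IsLocalRing S] (K : Ideal S) : ℕ :=
  Module.finrank (S ⧸ maximalIdeal S)
    ↥(Submodule.torsionBySet S (S ⧸ K) (maximalIdeal S : Set S))

/-! ## Standard-graded rings -/

/-- The graded ring `S = ⨁ 𝒜 i` is a standard-graded algebra over the field `𝒜 0`: it is generated
as an `𝒜 0`-algebra by `𝒜 1`, and `𝒜 1` is finitely generated as an `𝒜 0`-module. -/
structure IsStandardGradedOverField {S : Type u} [CommRing S] (𝒜 : ℕ → AddSubgroup S)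
    [GradedRing 𝒜] : Prop where
  isField : IsField ↥(𝒜 0)
  generated : Algebra.adjoin ↥(𝒜 0) (𝒜 1 : Set S) = ⊤
  finite : ∃ F : Finset S, (F : Set S) ⊆ 𝒜 1 ∧
    (𝒜 1 : Set S) ⊆ Submodule.span ↥(𝒜 0) (F : Set S)

/-- The maximal generator degree of an ideal `K` of a graded ring: the infimum of all `τ` such that
`K` is generated by its homogeneous elements of degree at most `τ` (it is `-∞ = ⊥` for `K = 0`). -/
def maxGenDeg {S : Type u} [CommRing S] (𝒜 : ℕ → AddSubgroup S) (K : Ideal S) : WithBot ℕ∞ :=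
  sInf {τ : WithBot ℕ∞ |
    Ideal.span {x : S | x ∈ K ∧ ∃ j : ℕ, (((j : ℕ∞) : WithBot ℕ∞) ≤ τ) ∧ x ∈ 𝒜 j} = K}

/-! ## The splitting theorems

Each splitting theorem is about a ring `R` with a presentation of a certain kind; it applies to
`R` when there is such a presentation of `R` that satisfies its hypotheses. Below `R = S / J`. -/

/-- Hypotheses of the first splitting theorem, which is about `S / (0 :_S K)`. -/
structure FirstSplittingHyp (S : Type u) [CommRing S] [IsLocalRing S] (K : Ideal S) : Prop where
  gorenstein : IsArtinianGorensteinLocal S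
  fitt : fittOne S ↥K = maximalIdeal S
  colon_ne : (maximalIdeal S * K).colon (maximalIdeal S : Set S)
    ≠ K.colon (maximalIdeal S : Set S)

/-- The first splitting theorem applies to `S / J`, written as `S / (0 :_S K)`. -/
def FirstSplittingApplies {S : Type u} [CommRing S] [IsLocalRing S] (J : Ideal S) : Prop :=
  ∃ K : Ideal S, annIdeal K = J ∧ FirstSplittingHyp S K

/-- Hypotheses of the second splitting theorem, which is about `P / (A :_P B)`. -/
structure SecondSplittingHyp (P : Type u) [CommRing P] (A B : Ideal P) : Prop where
  noetherian : IsNoetherianRing P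
  le_sq : A ≤ B ^ 2
  gorenstein_A : IsArtinianGorensteinLocal (P ⧸ A)
  gorenstein_B : IsArtinianGorensteinLocal (P ⧸ B)
  regular : ∃ rs : List P, RingTheory.Sequence.IsRegular P rs ∧ 2 ≤ rs.length ∧
    Ideal.ofList rs = B

/-- The second splitting theorem applies to `S / J`: with `S = P / A` (through `π`), the ideal
`A :_P B` is the preimage of `J`, so that `S / J = P / (A :_P B)`. -/
def SecondSplittingApplies {S : Type u} [CommRing S] (J : Ideal S) : Prop :=
  ∃ (P : Type u) (_ : CommRing P) (A B : Ideal P) (π : P →+* S),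
    Function.Surjective π ∧ RingHom.ker π = A ∧ SecondSplittingHyp P A B ∧
    J.comap π = A.colon (B : Set P)

/-- The ideal `B'` of `P = 𝕜[X₁, X₂, X₃, Y₁, …, Y_s]` generated by five given polynomials in
`X₁, X₂, X₃`. -/
def idealB' {𝕜 : Type u} [Field 𝕜] (s : ℕ) (Q : Fin 5 → MvPolynomial (Fin 3) 𝕜) :
    Ideal (MvPolynomial (Fin 3 ⊕ Fin s) 𝕜) :=
  Ideal.span (Set.range fun i => MvPolynomial.rename Sum.inl (Q i))

/-- The ideal `B'' = (Y₁, …, Y_s)` of `P = 𝕜[X₁, X₂, X₃, Y₁, …, Y_s]`. -/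
def idealB'' (𝕜 : Type u) [Field 𝕜] (s : ℕ) : Ideal (MvPolynomial (Fin 3 ⊕ Fin s) 𝕜) :=
  Ideal.span (Set.range fun j : Fin s => MvPolynomial.X (Sum.inr j))

/-- The ideal generated by all the variables, that is, by `[P]_1`. -/
def varIdeal (𝕜 : Type u) [Field 𝕜] (σ : Type) : Ideal (MvPolynomial σ 𝕜) :=
  Ideal.span (Set.range MvPolynomial.X)

/-- Hypotheses of the third splitting theorem, which is about `P / (A :_P B)` with
`P = 𝕜[X₁, X₂, X₃, Y₁, …, Y_s]` and `B = B' + B''`. -/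
structure ThirdSplittingHyp (𝕜 : Type u) [Field 𝕜] (s : ℕ)
    (Q : Fin 5 → MvPolynomial (Fin 3) 𝕜) (A : Ideal (MvPolynomial (Fin 3 ⊕ Fin s) 𝕜)) : Prop where
  quadratic : ∀ i, (Q i).IsHomogeneous 2
  linearIndependent : LinearIndependent 𝕜 Q
  homogeneous : ∀ p ∈ A, ∀ i : ℕ, MvPolynomial.homogeneousComponent i p ∈ A
  le_pow : A ≤ varIdeal 𝕜 (Fin 3 ⊕ Fin s) ^ 5
  gorenstein : IsArtinianGorensteinLocal (MvPolynomial (Fin 3 ⊕ Fin s) 𝕜 ⧸ A)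
  /-- `[socle(P / B)]_1 = 0`: a linear form that the variables multiply into `B` lies in `B`. -/
  socle : ∀ l : MvPolynomial (Fin 3 ⊕ Fin s) 𝕜, l.IsHomogeneous 1 →
    (∀ p ∈ varIdeal 𝕜 (Fin 3 ⊕ Fin s), p * l ∈ idealB' s Q ⊔ idealB'' 𝕜 s) →
    l ∈ idealB' s Q ⊔ idealB'' 𝕜 s

/-- The third splitting theorem applies to `S / J`: with `S = P / A` (through `π`), the ideal
`A :_P B` is the preimage of `J`, so that `S / J = P / (A :_P B)`. -/
def ThirdSplittingApplies {S : Type u} [CommRing S] (J : Ideal S) : Prop :=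
  ∃ (𝕜 : Type u) (_ : Field 𝕜) (s : ℕ) (Q : Fin 5 → MvPolynomial (Fin 3) 𝕜)
    (A : Ideal (MvPolynomial (Fin 3 ⊕ Fin s) 𝕜)) (π : MvPolynomial (Fin 3 ⊕ Fin s) 𝕜 →+* S),
    Function.Surjective π ∧ RingHom.ker π = A ∧ ThirdSplittingHyp 𝕜 s Q A ∧
    J.comap π = A.colon ((idealB' s Q ⊔ idealB'' 𝕜 s : Ideal _) : Set _)

end

/-!
The splitting theorems are found by a study of the ideal `K = 0 :_S J` in place of `J`. As `S` is
Gorenstein, `J = 0 :_S K` (`annIdeal_annIdeal`), and the colength `c` of `J` is the length of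
`S / K` (`colength_eq_length_quotient_annIdeal`), which is at most five. So there are few
possibilities for the Hilbert function of `S / K`, and each of them is treated separately.

The ring `S` contains a coefficient field `κ`, by equicharacteristic (`exists_coefficientField`)
or by the grading. Hence `S` is a quotient of a polynomial ring over `κ` in the elements of a
minimal system of generators of its maximal ideal `𝔫`, and the relations have order at least
`v(S)` (`ker_aeval_le_pow`). In particular, forms of degree less than `v(S)` in the generators do
not vanish, and this remains true for forms in some of the generators modulo the others
(`IsAdaptedSystem.eq_zero_of_isHomogeneous`). In low degrees one can compute in `S` as in a
polynomial ring, and the generators of `𝔫` can be chosen so that the superfluous ones modulo `K`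
lie in `K`.

*The first splitting theorem.* It is enough to find an element `m` such that `m 𝔫 ⊆ K` and such
that `m y` and `m y'` are part of a minimal generating family of `K` for some `y` and `y'` in `𝔫`
(`firstSplittingApplies_of_independent`): the Koszul relations `y' (m y) - y (m y') = 0`, for
varying `y`, show that all elements of `𝔫` belong to the first Fitting ideal, and `m` belongs to
only one of the two colon ideals. If `K = 𝔫`, then `m = 1` has this property. If `𝔫 / K` needs at
least two generators, every `m ∈ 𝔫` outside of `K + 𝔫 ^ 2` with `m 𝔫 ⊆ K` has it, since linear
forms have no zero divisors (`firstSplittingApplies_of_socle`). This settles the Hilbert function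
`(1, k)`. For `(1, k, 1)` such an `m` exists unless multiplication is a nondegenerate pairing on
`𝔫 / (K + 𝔫 ^ 2)`, in which case `𝔫 ^ 3 ⊆ 𝔫 K` (`pow_three_le_of_nondegenerate`) and the socle of
`S / K` is one-dimensional (`socleDim_le_one`). For `(1, 2, 1, 1)`, the same argument modulo
`𝔫 ^ 3` yields an element `m`, provided that `K` is homogeneous. For `(1, 2, 2)`, a quadratic form
`m` without common factor with the only quadratic form in `K` is suitable
(`firstSplittingApplies_of_one_two_two`).

*The second splitting theorem.* If `K` is generated by some of the generators of `𝔫` and by a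
regular sequence of forms in the others, then `P` is the polynomial ring, `B` is the preimage of
`K`, and `A ⊆ B ^ 2` because the relations have large order (`secondSplittingApplies_of_regular`).
This applies to the Hilbert function `(1, 1, …, 1)`, with a power of one generator, and to
`(1, 2, 1)` if `𝔫 ^ 3 ⊆ 𝔫 K`. In the latter case the pairing is nondegenerate
(`mem_sup_sq_of_mul_mem`), and a diagonalization of it, or the fact that it is alternating, gives
two explicit quadratic forms (`secondSplittingApplies_of_one_two_one`).

*The third splitting theorem.* For the Hilbert function `(1, 3, 1)` with a nondegenerate pairing,
the ternary quadratic forms in `K` are the kernel of a nonzero functional on a space of dimension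
six, and together with linear forms they generate `K` (`thirdSplittingApplies_of_one_three_one`).
-/

/-! ### Coefficient fields -/

/-- A field of characteristic `p` is formally smooth over its prime field. To lift `f : K → B / I`
with `I ^ 2 = 0`, consider the preimage `B'` in `B` of the image of `f`. A maximal subring `L` of
`B'` that contains all `p`-th powers of elements of `B'` and meets `I` only in zero is a field, and
it maps onto the image of `f`: otherwise a further element can be adjoined, as the root of a purely
inseparable polynomial. -/
theorem formallySmooth_zmod_of_charP (p : ℕ) [Fact p.Prime] (K : Type u) [Field K]
    [Algebra (ZMod p) K] : Algebra.FormallySmooth (ZMod p) K := by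
  have hp : p.Prime := Fact.out
  rw [Algebra.FormallySmooth.iff_comp_surjective]
  intro B _ _ I hI f
  rcases subsingleton_or_nontrivial B with hB | hB
  · let g : K →ₐ[ZMod p] B :=
      { toFun := fun _ => 0
        map_one' := Subsingleton.elim _ _
        map_mul' := fun _ _ => Subsingleton.elim _ _
        map_zero' := Subsingleton.elim _ _
        map_add' := fun _ _ => Subsingleton.elim _ _
        commutes' := fun _ => Subsingleton.elim _ _ }
    refine ⟨g, ?_⟩
    ext x
    obtain ⟨y, hy⟩ := Ideal.Quotient.mk_surjective (f x)
    rw [← hy]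
    exact congrArg _ (Subsingleton.elim (g x) y)
  have hIne : I ≠ ⊤ := by
    rintro rfl
    rw [Ideal.top_pow] at hI
    exact top_ne_bot hI
  have : Nontrivial (B ⧸ I) := Ideal.Quotient.nontrivial_iff.2 hIne
  have : CharP B p := charP_of_injective_algebraMap (algebraMap (ZMod p) B).injective p
  have hfinj : Function.Injective f := f.toRingHom.injective
  have hpow : ∀ x ∈ I, x ^ p = 0 := by
    intro x hx
    have h2 : x ^ 2 = 0 := by
      have := Ideal.pow_mem_pow hx 2
      rwa [hI, Ideal.mem_bot] at this
    exact pow_eq_zero_of_le hp.two_le h2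
  have hpow' : ∀ x y : B, x - y ∈ I → x ^ p = y ^ p := by
    intro x y hxy
    have := hpow _ hxy
    rwa [sub_pow_expChar, sub_eq_zero] at this
  let B' : Subring B := f.toRingHom.range.comap (Ideal.Quotient.mk I)
  have hB' : ∀ b, b ∈ B' ↔ ∃ k, f k = Ideal.Quotient.mk I b := fun b => Iff.rfl
  have hlift : ∀ k, ∃ b, Ideal.Quotient.mk I b = f k := fun k => Ideal.Quotient.mk_surjective _
  let T : Set (Subring B) := {L | L ≤ B' ∧ (∀ b ∈ B', b ^ p ∈ L) ∧ ∀ x ∈ L, x ∈ I → x = 0}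
  obtain ⟨L, hL⟩ : ∃ L, Maximal (· ∈ T) L := by
    -- the subring of `p`-th powers is in `T`
    have h0 : B'.map (frobenius B p) ∈ T := by
      refine ⟨?_, fun b hb => ⟨b, hb, rfl⟩, ?_⟩
      · rintro _ ⟨b, hb, rfl⟩
        exact pow_mem hb p
      · rintro _ ⟨b, hb, rfl⟩ hx
        obtain ⟨k, hk⟩ := (hB' b).1 hb
        have h1 : f k ^ p = 0 := by
          rw [hk, ← map_pow]
          exact Ideal.Quotient.eq_zero_iff_mem.2 hx
        rw [← map_pow, map_eq_zero_iff f hfinj] at h1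
        have h2 := pow_eq_zero_iff hp.ne_zero |>.1 h1
        rw [h2, map_zero] at hk
        exact hpow _ (Ideal.Quotient.eq_zero_iff_mem.1 hk.symm)
    obtain ⟨L, -, hL⟩ := zorn_le_nonempty₀ T (fun c hc hchain y hy => by
      refine ⟨sSup c, ⟨sSup_le fun L hL => (hc hL).1, fun b hb => ?_, fun x hx hxI => ?_⟩,
        fun L hL => le_sSup hL⟩
      · exact le_sSup hy ((hc hy).2.1 b hb)
      · obtain ⟨L, hL, hxL⟩ := (Subring.mem_sSup_of_directedOn ⟨y, hy⟩ hchain.directedOn).1 hx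
        exact (hc hL).2.2 x hxL hxI) _ h0
    exact ⟨L, hL⟩
  obtain ⟨hLB, hLp, hLI⟩ := hL.prop
  have hfield : IsField L := by
    refine ⟨⟨0, 1, zero_ne_one⟩, mul_comm, ?_⟩
    rintro ⟨x, hx⟩ hx0
    have hxI : x ∉ I := fun h => hx0 (Subtype.ext (hLI x hx h))
    obtain ⟨k, hk⟩ := (hB' x).1 (hLB hx)
    have hk0 : k ≠ 0 := by
      rintro rfl
      rw [map_zero] at hk
      exact hxI (Ideal.Quotient.eq_zero_iff_mem.1 hk.symm)
    obtain ⟨b, hb⟩ := hlift k⁻¹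
    have h1 : x * b - 1 ∈ I := by
      rw [← Ideal.Quotient.eq_zero_iff_mem, map_sub, map_mul, ← hk, hb, ← map_mul,
        mul_inv_cancel₀ hk0, map_one, map_one, sub_self]
    have h2 := hpow' _ _ h1
    rw [one_pow, mul_pow] at h2
    -- As `b` inverts `x` modulo `I`, its `p`-th power inverts that of `x`.
    refine ⟨⟨x ^ (p - 1) * b ^ p, mul_mem (pow_mem hx _) (hLp b ((hB' b).2 ⟨_, hb.symm⟩))⟩, ?_⟩
    apply Subtype.ext
    change x * (x ^ (p - 1) * b ^ p) = 1
    rw [← mul_assoc, mul_pow_sub_one hp.ne_zero, h2]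
  have hsurj : ∀ k, ∃ l ∈ L, Ideal.Quotient.mk I l = f k := by
    by_contra! hcon
    obtain ⟨k, hk⟩ := hcon
    obtain ⟨a, ha⟩ := hlift k
    have haB : a ∈ B' := (hB' a).2 ⟨k, ha.symm⟩
    let : Field L := hfield.toField
    let q : Polynomial L := Polynomial.X ^ p - Polynomial.C ⟨a ^ p, hLp a haB⟩
    have hq : Irreducible q := by
      apply X_pow_sub_C_irreducible_of_prime hp
      rintro ⟨b, hb⟩ h
      have h : b ^ p = a ^ p := congrArg Subtype.val h
      obtain ⟨k', hk'⟩ := (hB' b).1 (hLB hb)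
      have h1 : (f (k' - k)) ^ p = 0 := by
        rw [map_sub, hk', ← ha, ← map_sub, ← map_pow, sub_pow_expChar, h, sub_self, map_zero]
      rw [← map_pow, map_eq_zero_iff f hfinj, pow_eq_zero_iff hp.ne_zero, sub_eq_zero] at h1
      exact hk b hb (by rw [← hk', h1])
    let ev : Polynomial L →+* B := Polynomial.eval₂RingHom L.subtype a
    have hev : ev q = 0 := by
      simp [ev, q]
    -- `L[a]` is isomorphic to the field `L[X] / (q)`, and so it meets `I` only in zero
    have hmem : ev.range ∈ T := by
      refine ⟨?_, fun b hb => ⟨Polynomial.C ⟨b ^ p, hLp b hb⟩, by simp [ev]⟩, ?_⟩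
      · rintro _ ⟨g, rfl⟩
        induction g using Polynomial.induction_on' with
        | add g h hg hh => rw [map_add]; exact add_mem hg hh
        | monomial n c =>
          have : ev (Polynomial.monomial n c) = c * a ^ n := by simp [ev]
          rw [this]
          exact mul_mem (hLB c.2) (pow_mem haB n)
      · rintro _ ⟨g, rfl⟩ hgI
        by_cases hdvd : q ∣ g
        · obtain ⟨h, rfl⟩ := hdvd
          rw [map_mul, hev, zero_mul]
        · obtain ⟨r, s, hrs⟩ := (hq.coprime_iff_not_dvd).2 hdvd
          have := congrArg ev hrs
          rw [map_add, map_mul, hev, mul_zero, zero_add, map_mul, map_one] at this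
          exact absurd (Ideal.eq_top_of_isUnit_mem I (this ▸ I.mul_mem_left _ hgI) isUnit_one) hIne
    have hle : L ≤ ev.range := fun l hl => ⟨Polynomial.C ⟨l, hl⟩, by simp [ev]⟩
    exact hk a (hL.le_of_ge hmem hle ⟨Polynomial.X, by simp [ev]⟩) ha
  choose g hgL hg using hsurj
  have huniq : ∀ x ∈ L, ∀ y ∈ L, Ideal.Quotient.mk I x = Ideal.Quotient.mk I y → x = y := by
    intro x hx y hy hxy
    rw [← sub_eq_zero]
    exact hLI _ (sub_mem hx hy) (Ideal.Quotient.eq.1 hxy)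
  refine ⟨{ toFun := g
            map_one' := ?_
            map_mul' := ?_
            map_zero' := ?_
            map_add' := ?_
            commutes' := ?_ }, ?_⟩
  · exact huniq _ (hgL _) _ (one_mem L) (by rw [hg, map_one, map_one])
  · exact fun x y => huniq _ (hgL _) _ (mul_mem (hgL _) (hgL _)) (by simp [hg])
  · exact huniq _ (hgL _) _ (zero_mem L) (by rw [hg, map_zero, map_zero])
  · exact fun x y => huniq _ (hgL _) _ (add_mem (hgL _) (hgL _)) (by simp [hg])
  · intro r
    obtain ⟨n, rfl⟩ : ∃ n : ℕ, (n : ZMod p) = r := ⟨r.val, ZMod.natCast_zmod_val r⟩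
    refine huniq _ (hgL _) _ ?_ ?_
    · rw [map_natCast]; exact natCast_mem L n
    · rw [hg]; simp
  · ext x
    exact hg x

/-- A field of characteristic zero is formally smooth over `ℚ`. -/
theorem formallySmooth_rat (K : Type u) [Field K] [Algebra ℚ K] :
    Algebra.FormallySmooth ℚ K := by
  obtain ⟨s, hs⟩ := exists_isTranscendenceBasis ℚ K
  have := hs.isAlgebraic_field
  have : Algebra.IsSeparable (IntermediateField.adjoin ℚ (Set.range ((↑) : s → K))) K :=
    inferInstance
  exact .of_algebraicIndependent_of_isSeparable hs.1

/-- **Coefficient fields.** An equicharacteristic Artinian local ring contains a field that maps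
isomorphically onto the residue field: the residue field is formally smooth over its prime field,
over which the ring is an algebra, and the maximal ideal is nilpotent. -/
theorem exists_coefficientField (S : Type u) [CommRing S] [IsLocalRing S] [IsArtinianRing S]
    (h : IsEquicharacteristic S) :
    ∃ σ : ResidueField S →+* S, ∀ x, residue S (σ x) = x := by
  have hnil : IsNilpotent (maximalIdeal S) := by
    rw [← jacobson_eq_maximalIdeal ⊥ bot_ne_top]
    exact IsArtinianRing.isNilpotent_jacobson_bot
  have key : ∀ (k : Type) [Field k] [Algebra k S] (_ : Algebra.FormallySmooth k (ResidueField S)),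
      ∃ σ : ResidueField S →+* S, ∀ x, residue S (σ x) = x := by
    intro k _ _ hsm
    obtain ⟨σ, hσ⟩ := @Algebra.FormallySmooth.exists_lift k (ResidueField S) _ _ _ S _ _ hsm
      (maximalIdeal S) hnil (AlgHom.id k _)
    exact ⟨σ.toRingHom, fun x => DFunLike.congr_fun hσ x⟩
  obtain ⟨p, hp⟩ := CharP.exists (ResidueField S)
  have hSp : CharP S p := by
    have h1 := (ringChar.eq_iff (R := ResidueField S) (p := p)).2 hp
    exact (ringChar.eq_iff).1 (h.trans h1)
  rcases CharP.char_is_prime_or_zero (ResidueField S) p with hpp | rfl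
  · have : Fact p.Prime := ⟨hpp⟩
    let : Algebra (ZMod p) S := ZMod.algebra S p
    exact key (ZMod p) (formallySmooth_zmod_of_charP p (ResidueField S))
  · have : CharZero (ResidueField S) := CharP.charP_to_charZero _
    have hu : ∀ n : ℤ, n ≠ 0 → IsUnit (n : S) := by
      intro n hn
      apply (residue_ne_zero_iff_isUnit _).1
      rw [map_intCast]
      exact_mod_cast hn
    let φ : ℚ →+* S := IsLocalization.lift (M := nonZeroDivisors ℤ) (g := Int.castRingHom S)
      (fun y => hu _ (nonZeroDivisors.ne_zero y.2))
    let : Algebra ℚ S := φ.toAlgebra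
    exact key ℚ (@formallySmooth_rat (ResidueField S) _ (ResidueField.algebra S))

/-! ### Minimal generators and the first splitting theorem -/

section MinimalGenerators

theorem exists_minimal_generators {S : Type u} [CommRing S] {M : Type v} [AddCommGroup M]
    [Module S M] [Module.Finite S M] :
    ∃ g : Fin (minGenerators S M) → M, Submodule.span S (Set.range g) = ⊤ := by
  obtain ⟨s, hs, hs'⟩ :=
    (Module.Finite.fg_top (R := S) (M := M)).exists_span_finset_card_eq_spanFinrank
  let e : s ≃ Fin (minGenerators S M) := s.equivFinOfCardEq hs
  refine ⟨fun i => e.symm i, Eq.trans (congrArg _ ?_) hs'⟩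
  ext x
  constructor
  · rintro ⟨i, rfl⟩
    exact (e.symm i).2
  · intro hx
    exact ⟨e ⟨x, hx⟩, by simp⟩

theorem span_update_eq_top {S : Type u} [CommRing S] {M : Type v} [AddCommGroup M] [Module S M]
    {ι : Type*} [Fintype ι] [DecidableEq ι] {g : ι → M}
    (hg : Submodule.span S (Set.range g) = ⊤) {r : ι → S} {i : ι} (hi : IsUnit (r i)) :
    Submodule.span S (Set.range (Function.update g i (∑ j, r j • g j))) = ⊤ := by
  obtain ⟨b, hb⟩ := hi.exists_left_inv
  set w := ∑ j, r j • g j with hw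
  rw [← top_le_iff, ← hg, Submodule.span_le]
  have hne : ∀ j, j ≠ i → g j ∈ Submodule.span S (Set.range (Function.update g i w)) :=
    fun j hj => Submodule.subset_span ⟨j, by simp [hj]⟩
  have hwm : w ∈ Submodule.span S (Set.range (Function.update g i w)) :=
    Submodule.subset_span ⟨i, by simp⟩
  rintro _ ⟨j, rfl⟩
  by_cases hj : j = i
  · have : g i = b • w - b • ∑ j ∈ Finset.univ.erase i, r j • g j := by
      rw [hw, ← Finset.add_sum_erase _ _ (Finset.mem_univ i), smul_add, smul_smul, hb, one_smul,
        add_sub_cancel_right]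
    rw [hj, this]
    refine sub_mem (Submodule.smul_mem _ _ hwm)
      (Submodule.smul_mem _ _ (Submodule.sum_mem _ fun j hj => ?_))
    exact Submodule.smul_mem _ _ (hne j (by simpa using hj))
  · exact hne j hj

variable {S : Type u} [CommRing S] [IsLocalRing S]

/-- Nakayama's lemma for ideals of a Noetherian local ring. -/
theorem le_of_le_sup_maximalIdeal_mul [IsNoetherianRing S] {N N' : Ideal S}
    (h : N' ≤ N ⊔ maximalIdeal S * N') : N' ≤ N :=
  Submodule.le_of_le_smul_of_le_jacobson_bot (IsNoetherian.noetherian N')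
    (IsLocalRing.maximalIdeal_le_jacobson _) h

variable {M : Type v} [AddCommGroup M] [Module S M] [Module.Finite S M]

/-- A minimal generating family of a finitely generated module `M` over a local ring is linearly
independent modulo `𝔫 M`. -/
theorem mem_maximalIdeal_of_sum_mem {g : Fin (minGenerators S M) → M}
    (hg : Submodule.span S (Set.range g) = ⊤) {r : Fin (minGenerators S M) → S}
    (hr : ∑ j, r j • g j ∈ (maximalIdeal S • ⊤ : Submodule S M)) (i : Fin (minGenerators S M)) :
    r i ∈ maximalIdeal S := by
  classical
  by_contra hi
  obtain ⟨b, hb⟩ := (not_not.1 hi : IsUnit (r i)).exists_left_inv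
  set N := Submodule.span S (g '' {i}ᶜ) with hN
  have h1 : g i ∈ N ⊔ (maximalIdeal S • ⊤ : Submodule S M) := by
    have : g i = b • ∑ j, r j • g j - b • ∑ j ∈ Finset.univ.erase i, r j • g j := by
      rw [← Finset.add_sum_erase _ _ (Finset.mem_univ i), smul_add, smul_smul, hb, one_smul,
        add_sub_cancel_right]
    rw [this]
    refine sub_mem (Submodule.mem_sup_right (Submodule.smul_mem _ _ hr))
      (Submodule.mem_sup_left (Submodule.smul_mem _ _ (Submodule.sum_mem _ fun j hj => ?_)))
    exact Submodule.smul_mem _ _ (Submodule.subset_span ⟨j, by simpa using hj, rfl⟩)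
  have h2 : (⊤ : Submodule S M) ≤ N := by
    apply Submodule.le_of_le_smul_of_le_jacobson_bot (I := maximalIdeal S) Module.Finite.fg_top
      (IsLocalRing.maximalIdeal_le_jacobson _)
    rw [← hg, Submodule.span_le, hg]
    rintro _ ⟨j, rfl⟩
    by_cases hj : j = i
    · rw [hj]; exact h1
    · exact Submodule.mem_sup_left (Submodule.subset_span ⟨j, hj, rfl⟩)
  have h3 : minGenerators S M ≤ (g '' {i}ᶜ).ncard := by
    have h5 := Submodule.spanFinrank_span_le_ncard_of_finite (R := S) (Set.toFinite (g '' {i}ᶜ))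
    rwa [← hN, top_le_iff.1 h2] at h5
  have h4 : (g '' {i}ᶜ).ncard ≤ minGenerators S M - 1 := by
    refine (Set.ncard_image_le (Set.toFinite _)).trans ?_
    rw [Set.ncard_compl, Set.ncard_singleton, Nat.card_eq_fintype_card, Fintype.card_fin]
  have := i.2
  omega

/-- Two elements that are linearly independent modulo `𝔫 M` are part of a minimal generating
family. -/
theorem exists_minimal_generators_extending {w w' : M}
    (h : ∀ a b : S, a • w + b • w' ∈ (maximalIdeal S • ⊤ : Submodule S M) →
      a ∈ maximalIdeal S ∧ b ∈ maximalIdeal S) :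
    ∃ g : Fin (minGenerators S M) → M, Submodule.span S (Set.range g) = ⊤ ∧
      ∃ i j, i ≠ j ∧ g i = w ∧ g j = w' := by
  classical
  have hone : (1 : S) ∉ maximalIdeal S := fun h => h isUnit_one
  obtain ⟨g, hg⟩ := exists_minimal_generators (S := S) (M := M)
  have hmem : ∀ {g : Fin (minGenerators S M) → M}, Submodule.span S (Set.range g) = ⊤ →
      ∀ x, ∃ r : Fin (minGenerators S M) → S, ∑ j, r j • g j = x := by
    intro g hg x
    exact (Submodule.mem_span_range_iff_exists_fun S).1 (hg ▸ Submodule.mem_top)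
  obtain ⟨r, rfl⟩ := hmem hg w
  obtain ⟨i, hi⟩ : ∃ i, r i ∉ maximalIdeal S := by
    by_contra! hcon
    refine hone (h 1 0 ?_).1
    rw [one_smul, zero_smul, add_zero]
    exact Submodule.sum_mem _ fun j _ => Submodule.smul_mem_smul (hcon j) trivial
  set w := ∑ j, r j • g j with hw
  have hg' := span_update_eq_top hg (not_not.1 hi : IsUnit (r i))
  rw [← hw] at hg'
  set g' := Function.update g i w with hg'_def
  have hgi : g' i = w := by simp [hg'_def]
  obtain ⟨r', rfl⟩ := hmem hg' w'
  obtain ⟨j, hj, hj'⟩ : ∃ j, j ≠ i ∧ r' j ∉ maximalIdeal S := by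
    by_contra! hcon
    refine hone (h (-r' i) 1 ?_).2
    rw [one_smul, ← Finset.add_sum_erase _ _ (Finset.mem_univ i), hgi, neg_smul,
      neg_add_cancel_left]
    exact Submodule.sum_mem _ fun j hj => Submodule.smul_mem_smul (hcon j (by simpa using hj))
      trivial
  refine ⟨_, span_update_eq_top hg' (not_not.1 hj' : IsUnit (r' j)), i, j, hj.symm, ?_, ?_⟩
  · rw [Function.update_of_ne hj.symm, hgi]
  · simp

end MinimalGenerators

theorem annIdeal_def {S : Type u} [CommRing S] (J : Ideal S) (x : S) :
    x ∈ annIdeal J ↔ ∀ y ∈ J, x * y = 0 := by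
  simp [annIdeal, Submodule.mem_annihilator]

section Socle

variable {S : Type u} [CommRing S] [IsLocalRing S] [IsArtinianRing S]

theorem isNilpotent_maximalIdeal : IsNilpotent (maximalIdeal S) := by
  rw [← jacobson_eq_maximalIdeal ⊥ bot_ne_top]
  exact IsArtinianRing.isNilpotent_jacobson_bot

/-- The socle of an Artinian local ring is nonzero. -/
theorem exists_socle_element : ∃ e : S, e ≠ 0 ∧ ∀ x ∈ maximalIdeal S, x * e = 0 := by
  classical
  have hex : ∃ n, maximalIdeal S ^ n = ⊥ := isNilpotent_maximalIdeal
  have h0 : Nat.find hex ≠ 0 := by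
    intro h
    have := Nat.find_spec hex
    rw [h, pow_zero, Ideal.one_eq_top] at this
    exact top_ne_bot this
  obtain ⟨n, hn⟩ := Nat.exists_eq_succ_of_ne_zero h0
  have h1 : maximalIdeal S ^ n ≠ ⊥ := Nat.find_min hex (by omega)
  obtain ⟨e, he, he0⟩ := Submodule.exists_mem_ne_zero_of_ne_bot h1
  refine ⟨e, he0, fun x hx => ?_⟩
  have h2 := Nat.find_spec hex
  rw [hn, Nat.succ_eq_add_one, pow_succ'] at h2
  rw [← Ideal.mem_bot, ← h2]
  exact Ideal.mul_mem_mul hx he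

end Socle

section DoubleAnnihilator

variable {S : Type u} [CommRing S]

/-- The double annihilator property of an Artinian Gorenstein local ring: if `x ∉ J`, then the
composite of the surjection of `S x + J / J` onto the residue field and the inclusion of the
latter in the socle extends to a map `S / J → S` by injectivity; it is multiplication by an
element that annihilates `J`, but not `x`. -/
theorem annIdeal_annIdeal (hS : IsArtinianGorensteinLocal S) (J : Ideal S) :
    annIdeal (annIdeal J) = J := by
  have := hS.isLocalRing
  have := hS.isArtinianRing
  have := hS.injective
  apply le_antisymm
  · intro x hx
    by_contra hxJ
    obtain ⟨e, he0, he⟩ := exists_socle_element (S := S)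
    let L : Ideal S := J.colon {x}
    have hL : ∀ s, s ∈ L ↔ s * x ∈ J := fun s => Submodule.mem_colon_singleton
    have hLn : L ≤ maximalIdeal S := by
      apply le_maximalIdeal
      intro h
      exact hxJ (by simpa using (hL 1).1 (h ▸ Submodule.mem_top))
    let i : (S ⧸ L) →ₗ[S] (S ⧸ J) := L.mapQ J (LinearMap.toSpanSingleton S S x)
      (fun s hs => by simpa using (hL s).1 hs)
    have hi : Function.Injective i := by
      rw [injective_iff_map_eq_zero]
      intro s
      obtain ⟨s, rfl⟩ := Submodule.Quotient.mk_surjective L s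
      intro hs
      rw [Submodule.mapQ_apply, Submodule.Quotient.mk_eq_zero] at hs
      rw [Submodule.Quotient.mk_eq_zero]
      exact (hL s).2 (by simpa using hs)
    let g : (S ⧸ L) →ₗ[S] S := L.liftQ (LinearMap.toSpanSingleton S S e)
      (fun s hs => by simpa using he s (hLn hs))
    obtain ⟨h, hh⟩ := Module.Injective.out i hi g
    have hmk : ∀ y, h (Submodule.Quotient.mk y) = y * h (Submodule.Quotient.mk 1) := by
      intro y
      rw [← smul_eq_mul, ← map_smul, ← Submodule.Quotient.mk_smul, smul_eq_mul, mul_one]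
    have h1 : h (Submodule.Quotient.mk 1) ∈ annIdeal J := by
      rw [annIdeal_def]
      intro y hy
      rw [mul_comm, ← hmk, (Submodule.Quotient.mk_eq_zero J).2 hy, map_zero]
    have h2 := (annIdeal_def _ _).1 hx _ h1
    have h3 := hh (Submodule.Quotient.mk 1)
    rw [Submodule.mapQ_apply, LinearMap.toSpanSingleton_apply, one_smul, hmk, h2,
      Submodule.liftQ_apply, LinearMap.toSpanSingleton_apply, one_smul] at h3
    exact he0 h3.symm
  · intro x hx
    rw [annIdeal_def]
    intro y hy
    rw [mul_comm]
    exact (annIdeal_def _ _).1 hy x hx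

theorem annIdeal_antitone {J L : Ideal S} (h : J ≤ L) : annIdeal L ≤ annIdeal J :=
  fun _ hx => (annIdeal_def _ _).2 fun y hy => (annIdeal_def _ _).1 hx y (h hy)

/-- `J ↦ 0 :_S J` is an anti-automorphism of the lattice of ideals, and so the length of `J` is
that of `S / (0 :_S J)`. -/
theorem colength_eq_length_quotient_annIdeal (hS : IsArtinianGorensteinLocal S) (J : Ideal S) :
    colength J = Module.length S (S ⧸ annIdeal J) := by
  have := hS.isArtinianRing
  let e : Ideal S ≃o (Ideal S)ᵒᵈ :=
    { toFun := fun J => OrderDual.toDual (annIdeal J)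
      invFun := fun J => annIdeal (OrderDual.ofDual J)
      left_inv := fun J => annIdeal_annIdeal hS J
      right_inv := fun J => congrArg OrderDual.toDual (annIdeal_annIdeal hS (OrderDual.ofDual J))
      map_rel_iff' := by
        intro J L
        refine ⟨fun h => ?_, fun h => annIdeal_antitone h⟩
        have := annIdeal_antitone (show annIdeal L ≤ annIdeal J from h)
        rwa [annIdeal_annIdeal hS, annIdeal_annIdeal hS] at this }
  have h1 : Module.length S S = Module.length S J + Module.length S (S ⧸ J) :=
    Module.length_eq_add_of_exact J.subtype J.mkQ J.subtype_injective J.mkQ_surjective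
      (LinearMap.exact_subtype_mkQ J)
  have h2 : Module.length S (S ⧸ J) ≠ ⊤ := Module.length_ne_top
  rw [colength, h1, (ENat.addLECancellable_of_ne_top h2).add_tsub_cancel_right,
    Module.length_submodule, Module.length_quotient, ← Order.height_orderIso e]
  rfl

theorem IsArtinianGorensteinLocal.of_ringEquiv {T : Type u} [CommRing T] (e : S ≃+* T)
    (hS : IsArtinianGorensteinLocal S) : IsArtinianGorensteinLocal T := by
  have := hS.isLocalRing
  have := hS.isArtinianRing
  have := hS.injective
  exact ⟨e.isLocalRing, e.surjective.isArtinianRing, Module.Injective.of_ringEquiv e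
    e.toSemilinearEquiv⟩

end DoubleAnnihilator

section FirstSplitting

variable {S : Type u} [CommRing S] [IsLocalRing S]

theorem fittOne_le_maximalIdeal (M : Type v) [AddCommGroup M] [Module S M] [Module.Finite S M] :
    fittOne S M ≤ maximalIdeal S := by
  rw [fittOne, Ideal.span_le]
  rintro a ⟨g, hg, r, hr, i, rfl⟩
  exact mem_maximalIdeal_of_sum_mem hg (by rw [hr]; exact zero_mem _) i

/-- The coefficients of a relation between two elements of `M` that are linearly independent modulo
`𝔫 M` belong to the Fitting ideal, as the two elements are part of a minimal generating family. -/
theorem mem_fittOne_of_relation {M : Type v} [AddCommGroup M] [Module S M] [Module.Finite S M]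
    {w w' : M} (h : ∀ a b : S, a • w + b • w' ∈ (maximalIdeal S • ⊤ : Submodule S M) →
      a ∈ maximalIdeal S ∧ b ∈ maximalIdeal S) {a b : S} (hab : a • w + b • w' = 0) :
    a ∈ fittOne S M := by
  classical
  obtain ⟨g, hg, i, j, hij, rfl, rfl⟩ := exists_minimal_generators_extending h
  refine Ideal.subset_span ⟨g, hg, Function.update (Function.update 0 i a) j b, ?_, i, ?_⟩
  · rw [← hab, ← Finset.add_sum_erase _ _ (Finset.mem_univ i),
      ← Finset.add_sum_erase _ _ (show j ∈ Finset.univ.erase i by simp [hij.symm]),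
      Finset.sum_eq_zero]
    · simp [hij]
    · intro l hl
      simp only [Finset.mem_erase, Finset.mem_univ, and_true] at hl
      simp [hl.1, hl.2]
  · simp [hij]

/-- A criterion for the first splitting theorem. If `m 𝔫 ⊆ K` and multiplication by `m` induces a
map `𝔫 / 𝔫 ^ 2 → K / 𝔫 K` of rank at least two, then the Koszul relations
`y' (m y) - y (m y') = 0` show that every element of `𝔫` is a coefficient of a relation on a minimal
generating family of `K`, and `m` shows that the two colon ideals differ. -/
theorem firstSplittingApplies_of_independent (hS : IsArtinianGorensteinLocal S) {J : Ideal S}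
    {m y y' : S} (hm : ∀ x ∈ maximalIdeal S, m * x ∈ annIdeal J)
    (hy : y ∈ maximalIdeal S) (hy' : y' ∈ maximalIdeal S)
    (hind : ∀ a b : S, a * (m * y) + b * (m * y') ∈ maximalIdeal S * annIdeal J →
      a ∈ maximalIdeal S ∧ b ∈ maximalIdeal S) :
    FirstSplittingApplies J := by
  have := hS.isArtinianRing
  set n := maximalIdeal S with hn
  set K := annIdeal J with hK
  refine ⟨K, annIdeal_annIdeal hS J, hS, le_antisymm (fittOne_le_maximalIdeal _) ?_, ?_⟩
  · have key : ∀ p q, p ∈ n → q ∈ n → (∀ a b : S, a * (m * p) + b * (m * q) ∈ n * K →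
        a ∈ n ∧ b ∈ n) → p ∈ fittOne S K := by
      intro p q hp hq h
      apply mem_fittOne_of_relation (w := (⟨m * q, hm q hq⟩ : K)) (w' := ⟨m * p, hm p hp⟩)
        (b := -q) (h := ?_) (hab := ?_)
      · intro a b hab
        rw [Submodule.mem_smul_top_iff] at hab
        exact (h b a (by rw [add_comm]; exact hab)).symm
      · apply Subtype.ext
        change p * (m * q) + -q * (m * p) = 0
        ring
    have hyF : y ∈ fittOne S K := key y y' hy hy' hind
    intro x hx
    by_cases h : ∀ a b : S, a * (m * x) + b * (m * y') ∈ n * K → a ∈ n ∧ b ∈ n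
    · exact key x y' hx hy' h
    -- Here `m x` is a multiple of `m y'` modulo `𝔫 K`, and `x + y` can take the place of `x`.
    have hxy : x + y ∈ fittOne S K := by
      apply key _ _ (add_mem hx hy) hy'
      push Not at h
      obtain ⟨a, b, hab, h⟩ := h
      have ha : a ∉ n := by
        intro ha
        refine h ha (hind 0 b ?_).2
        have h1 : a * (m * x) ∈ n * K := Ideal.mul_mem_mul ha (hm x hx)
        simpa using sub_mem hab h1
      intro s t hst
      have h1 : (s * a) * (m * y) + (t * a - s * b) * (m * y') ∈ n * K := by
        have := sub_mem (Ideal.mul_mem_left _ a hst) (Ideal.mul_mem_left _ s hab)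
        convert! this using 1
        ring
      obtain ⟨h2, h3⟩ := hind _ _ h1
      have hs : s ∈ n := ((maximalIdeal.isMaximal S).isPrime.mem_or_mem h2).resolve_right ha
      have h4 : t * a ∈ n := by simpa using add_mem h3 (n.mul_mem_right b hs)
      exact ⟨hs, ((maximalIdeal.isMaximal S).isPrime.mem_or_mem h4).resolve_right ha⟩
    simpa using sub_mem hxy hyF
  · intro h
    have h1 : m ∈ K.colon (n : Set S) := Submodule.mem_colon.2 fun x hx => hm x hx
    rw [← h] at h1
    have h2 : m * y ∈ n * K := Submodule.mem_colon.1 h1 y hy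
    exact (hind 1 0 (by simpa using h2)).1 isUnit_one

end FirstSplitting

/-! ### Coordinates -/

section Coordinates

open MvPolynomial

/-- A field `κ` over which the local ring `S` is an algebra is a coefficient field if it maps onto
(and therefore isomorphically onto) the residue field of `S`. -/
def IsCoefficientField (κ : Type*) (S : Type u) [Field κ] [CommRing S] [IsLocalRing S]
    [Algebra κ S] : Prop :=
  ∀ s : S, ∃ a : κ, s - algebraMap κ S a ∈ maximalIdeal S

theorem aeval_mem_pow_of_mem {S : Type u} [CommRing S] [IsLocalRing S] {κ : Type*} [Field κ]
    [Algebra κ S] {σ : Type*} {x : σ → S} (hx : ∀ i, x i ∈ maximalIdeal S) {d : ℕ}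
    {p : MvPolynomial σ κ} (hp : p ∈ idealOfVars σ κ ^ d) :
    aeval x p ∈ maximalIdeal S ^ d := by
  have h1 : (idealOfVars σ κ).map (aeval x).toRingHom ≤ maximalIdeal S := by
    rw [Ideal.map_span, Ideal.span_le]
    rintro _ ⟨_, ⟨i, rfl⟩, rfl⟩
    simpa using hx i
  have h2 := Ideal.mem_map_of_mem (aeval x).toRingHom hp
  rw [Ideal.map_pow] at h2
  exact Ideal.pow_right_mono h1 d h2

variable {S : Type u} [CommRing S] [IsLocalRing S] {κ : Type*} [Field κ] [Algebra κ S]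

theorem map_idealOfVars_pow {σ : Type*} {x : σ → S}
    (hx : Ideal.span (Set.range x) = maximalIdeal S) (d : ℕ) :
    (idealOfVars σ κ ^ d).map (aeval (R := κ) x).toRingHom = maximalIdeal S ^ d := by
  rw [Ideal.map_pow, Ideal.map_span, ← hx, ← Set.range_comp]
  congr 3
  ext i
  simp

theorem mem_of_algebraMap_mem {a : κ} (ha : algebraMap κ S a ∈ maximalIdeal S) : a = 0 := by
  by_contra h
  exact ha ((IsUnit.mk0 a h).map (algebraMap κ S))

/-- Every element of `𝔫 ^ d` is congruent modulo `𝔫 ^ (d + 1)` to the value of a polynomial of order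
at least `d` in the generators of `𝔫`. -/
theorem exists_aeval_sub_mem (hκ : IsCoefficientField κ S)
    {σ : Type*} {x : σ → S} (hx : Ideal.span (Set.range x) = maximalIdeal S) {d : ℕ} {s : S}
    (hs : s ∈ maximalIdeal S ^ d) :
    ∃ p ∈ idealOfVars σ κ ^ d, s - aeval x p ∈ maximalIdeal S ^ (d + 1) := by
  have hxm : ∀ i, x i ∈ maximalIdeal S := fun i => hx ▸ Ideal.subset_span ⟨i, rfl⟩
  rw [← map_idealOfVars_pow (κ := κ) hx, Ideal.map, Ideal.span] at hs
  induction hs using Submodule.span_induction with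
  | mem s hs =>
    obtain ⟨p, hp, rfl⟩ := hs
    exact ⟨p, hp, by simp⟩
  | zero => exact ⟨0, zero_mem _, by simp⟩
  | add s t _ _ hs ht =>
    obtain ⟨p, hp, hp'⟩ := hs
    obtain ⟨q, hq, hq'⟩ := ht
    refine ⟨p + q, add_mem hp hq, ?_⟩
    rw [map_add, add_sub_add_comm]
    exact add_mem hp' hq'
  | smul c s _ hs =>
    obtain ⟨p, hp, hp'⟩ := hs
    obtain ⟨a, ha⟩ := hκ c
    refine ⟨C a * p, Ideal.mul_mem_left _ _ hp, ?_⟩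
    have : c • s - aeval x (C a * p)
        = c * (s - aeval x p) + (c - algebraMap κ S a) * aeval x p := by
      rw [map_mul, aeval_C, smul_eq_mul]
      ring
    rw [this]
    refine add_mem (Ideal.mul_mem_left _ _ hp') ?_
    rw [pow_succ']
    exact Ideal.mul_mem_mul ha (aeval_mem_pow_of_mem hxm hp)

theorem aeval_surjective [IsArtinianRing S]
    (hκ : IsCoefficientField κ S)
    {σ : Type*} {x : σ → S} (hx : Ideal.span (Set.range x) = maximalIdeal S) :
    Function.Surjective (aeval (R := κ) x) := by
  have key : ∀ (s : S) d, ∃ p : MvPolynomial σ κ, s - aeval x p ∈ maximalIdeal S ^ d := by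
    intro s d
    induction d with
    | zero => exact ⟨0, by simp⟩
    | succ d ih =>
      obtain ⟨p, hp⟩ := ih
      obtain ⟨q, -, hq⟩ := exists_aeval_sub_mem hκ hx hp
      exact ⟨p + q, by rw [map_add, ← sub_sub]; exact hq⟩
  intro s
  obtain ⟨d, hd⟩ := isNilpotent_maximalIdeal (S := S)
  obtain ⟨p, hp⟩ := key s d
  rw [hd] at hp
  exact ⟨p, (sub_eq_zero.1 hp).symm⟩

/-- If `𝔫 ^ d / 𝔫 ^ (d + 1)` has the dimension of the space of forms of degree `d`, then no nonzero
form of degree `d` in a minimal system of generators of `𝔫` lies in `𝔫 ^ (d + 1)`. -/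
theorem eq_zero_of_isHomogeneous_of_aeval_mem [IsNoetherianRing S] {σ : Type*} [Fintype σ]
    {x : σ → S} (hx : Ideal.span (Set.range x) = maximalIdeal S) {d : ℕ}
    (hd : (Fintype.card σ + d - 1).choose d ≤ hilbertFn S d) {F : MvPolynomial σ κ}
    (hF : F.IsHomogeneous d) (hFx : aeval x F ∈ maximalIdeal S ^ (d + 1)) : F = 0 := by
  classical
  -- The monomials of degree `d` generate `𝔫 ^ d`, and by hypothesis they are a minimal generating
  -- family.
  set A : Finset (σ →₀ ℕ) := Finset.finsuppAntidiag Finset.univ d with hA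
  have hmemA : ∀ e, e ∈ A ↔ e.degree = d := by
    intro e
    rw [hA, Finset.mem_finsuppAntidiag, Finsupp.degree_eq_sum]
    simp
  have hcard : A.card = (Fintype.card σ + d - 1).choose d :=
    Finset.card_finsuppAntidiag_nat_eq_choose _
  set w : (σ →₀ ℕ) → S := fun e => ∏ i, x i ^ e i with hw
  have hspan : Ideal.span (w '' A) = maximalIdeal S ^ d := by
    rw [← map_idealOfVars_pow (κ := κ) hx, pow_idealOfVars_eq_span, Ideal.map_span,
      Set.image_image]
    congr 1
    ext s
    simp only [Set.mem_image, Finset.mem_coe, hmemA, Set.mem_preimage, Set.mem_singleton_iff]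
    refine exists_congr fun e => and_congr_right fun _ => ?_
    simp [hw, aeval_monomial, Finsupp.prod_fintype]
  have hwmem : ∀ e ∈ A, w e ∈ maximalIdeal S ^ d := fun e he =>
    hspan ▸ Ideal.subset_span ⟨e, he, rfl⟩
  let M := ↥(maximalIdeal S ^ d)
  have hmin : minGenerators S M = hilbertFn S d := by
    rw [minGenerators, Submodule.spanFinrank_top,
      IsLocalRing.spanFinrank_eq_finrank_quotient _ (IsNoetherian.noetherian _)]
    rfl
  let w' : A → M := fun e => ⟨w e, hwmem e e.2⟩
  have hw' : Submodule.span S (Set.range w') = ⊤ := by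
    apply Submodule.map_injective_of_injective (maximalIdeal S ^ d).subtype_injective
    rw [Submodule.map_span, Submodule.map_top, Submodule.range_subtype]
    refine Eq.trans (congrArg _ ?_) hspan
    ext s
    simp only [Set.mem_image, Set.mem_range, exists_exists_eq_and, Finset.mem_coe, w']
    exact ⟨fun ⟨a, ha⟩ => ⟨a, a.2, ha⟩, fun ⟨a, h, ha⟩ => ⟨⟨a, h⟩, ha⟩⟩
  have hle : minGenerators S M ≤ A.card := by
    have h1 := Submodule.spanFinrank_span_le_ncard_of_finite (R := S) (Set.finite_range w')
    rw [hw'] at h1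
    refine h1.trans ?_
    rw [← Set.image_univ]
    refine (Set.ncard_image_le (Set.toFinite _)).trans ?_
    rw [Set.ncard_univ, Nat.card_eq_fintype_card, Fintype.card_coe]
  have heq : A.card = minGenerators S M := le_antisymm (by rw [hcard, hmin]; exact hd) hle
  let e : Fin (minGenerators S M) ≃ A := (A.equivFinOfCardEq heq).symm
  have hval : aeval x F = ∑ i, algebraMap κ S (F.coeff (e i)) * w (e i) := by
    rw [aeval_def, eval₂_eq', e.sum_comp (fun a : A => algebraMap κ S (F.coeff a) * w a),
      Finset.sum_coe_sort A (fun a => algebraMap κ S (F.coeff a) * w a)]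
    apply Finset.sum_subset
    · intro a ha
      rw [hmemA]
      by_contra h
      exact mem_support_iff.1 ha (hF.coeff_eq_zero h)
    · intro a _ ha
      rw [notMem_support_iff.1 ha, map_zero, zero_mul]
  have hgen : Submodule.span S (Set.range (w' ∘ e)) = ⊤ := by
    rw [e.surjective.range_comp, hw']
  have hcoeff := mem_maximalIdeal_of_sum_mem (r := fun i => algebraMap κ S (F.coeff (e i))) hgen (by
    rw [Submodule.mem_smul_top_iff, smul_eq_mul, ← pow_succ']
    have h1 : ((∑ i, algebraMap κ S (F.coeff (e i)) • (w' ∘ e) i : M) : S) = aeval x F := by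
      rw [hval, AddSubmonoidClass.coe_finsetSum]
      rfl
    rw [h1]
    exact hFx)
  ext a
  rw [coeff_zero]
  by_cases ha : a.degree = d
  · have := mem_of_algebraMap_mem (hcoeff (e.symm ⟨a, (hmemA a).2 ha⟩))
    simpa using this
  · exact hF.coeff_eq_zero ha

theorem choose_le_hilbertFn {t : ℕ} (ht : (t : ℕ∞) ≤ vInv S) {d : ℕ} (hd : d < t) :
    (embeddingDim S + d - 1).choose d ≤ hilbertFn S d := by
  by_contra! h
  have h1 : vInv S ≤ (d : ℕ∞) := iInf₂_le d h
  exact absurd (ht.trans h1) (by simpa using hd)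

theorem homogeneousComponent_eq_zero_of_mem_pow {σ : Type*} {i d : ℕ} (hid : i < d)
    {p : MvPolynomial σ κ} (hp : p ∈ idealOfVars σ κ ^ d) : homogeneousComponent i p = 0 := by
  classical
  ext a
  rw [coeff_homogeneousComponent, coeff_zero]
  split_ifs with h
  · exact (mem_pow_idealOfVars_iff' d p).1 hp a (h ▸ hid)
  · rfl

theorem sub_homogeneousComponent_mem_pow {σ : Type*} {d : ℕ}
    {p : MvPolynomial σ κ} (hp : p ∈ idealOfVars σ κ ^ d) :
    p - homogeneousComponent d p ∈ idealOfVars σ κ ^ (d + 1) := by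
  classical
  rw [mem_pow_idealOfVars_iff']
  intro a ha
  rw [coeff_sub, coeff_homogeneousComponent]
  split_ifs with h
  · exact sub_self _
  · rw [(mem_pow_idealOfVars_iff' d p).1 hp a (by omega), sub_zero]

theorem eq_zero_of_isHomogeneous_of_mem_pow {σ : Type*} {d : ℕ} {F : MvPolynomial σ κ}
    (hF : F.IsHomogeneous d) (h : F ∈ idealOfVars σ κ ^ (d + 1)) : F = 0 := by
  rw [← homogeneousComponent_eq_zero_of_mem_pow (Nat.lt_succ_self d) h,
    homogeneousComponent_of_mem hF, if_pos rfl]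

/-- The relations on a minimal system of generators of `𝔫` have order at least `v(S)`. -/
theorem ker_aeval_le_pow [IsNoetherianRing S] {σ : Type*} [Fintype σ]
    {x : σ → S} (hx : Ideal.span (Set.range x) = maximalIdeal S)
    (hσ : Fintype.card σ = embeddingDim S) {t : ℕ} (ht : (t : ℕ∞) ≤ vInv S)
    {p : MvPolynomial σ κ} (hp : aeval x p = 0) : p ∈ idealOfVars σ κ ^ t := by
  have hxm : ∀ i, x i ∈ maximalIdeal S := fun i => hx ▸ Ideal.subset_span ⟨i, rfl⟩
  suffices h : ∀ d ≤ t, p ∈ idealOfVars σ κ ^ d from h t le_rfl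
  intro d
  induction d with
  | zero => intro _; simp
  | succ d ih =>
    intro hd
    have h1 := ih (by omega)
    have h2 := sub_homogeneousComponent_mem_pow h1
    have h3 := aeval_mem_pow_of_mem hxm h2
    rw [map_sub, hp, zero_sub, neg_mem_iff] at h3
    rw [eq_zero_of_isHomogeneous_of_aeval_mem hx (hσ ▸ choose_le_hilbertFn ht hd)
      (homogeneousComponent_isHomogeneous d p) h3, sub_zero] at h2
    exact h2

/-- A family of elements of `𝔫` that is a minimal generating family of `𝔫` modulo `K`. Minimality is
expressed as linear independence over the residue field of the images in `𝔫 / (K + 𝔫 ^ 2)`. -/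
structure IsMinimalModulo (K : Ideal S) {k : ℕ} (u : Fin k → S) : Prop where
  mem : ∀ i, u i ∈ maximalIdeal S
  le_span : maximalIdeal S ≤ Ideal.span (Set.range u) ⊔ K
  indep : ∀ a : Fin k → S, ∑ i, a i * u i ∈ K ⊔ maximalIdeal S ^ 2 → ∀ i, a i ∈ maximalIdeal S

/-- A minimal system of generators of `𝔫` that consists of a family `u` and of elements `z` of the
ideal `K`. Minimality is expressed by the number of generators. -/
structure IsAdaptedSystem (K : Ideal S) {k s : ℕ} (u : Fin k → S) (z : Fin s → S) : Prop where
  span_eq : Ideal.span (Set.range (Sum.elim u z)) = maximalIdeal S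
  mem : ∀ j, z j ∈ K
  card : k + s = embeddingDim S

theorem mkQ_submoduleOf_eq_zero {R : Type u} [CommRing R] {I K : Ideal R} (y : I) :
    (K.submoduleOf I).mkQ y = 0 ↔ (y : R) ∈ K := by
  rw [← LinearMap.mem_ker, Submodule.ker_mkQ]
  rfl

/-- A generating family of `𝔫` modulo `K` is minimal if it has as many elements as
`𝔫 / (K ∩ 𝔫)` has minimal generators. -/
theorem isMinimalModulo_of_le_span [IsNoetherianRing S] {K : Ideal S}
    {k : ℕ} (hk : minGeneratorsMaxMod K = k) {u : Fin k → S} (hu : ∀ i, u i ∈ maximalIdeal S)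
    (hspan : maximalIdeal S ≤ Ideal.span (Set.range u) ⊔ K) : IsMinimalModulo K u := by
  subst hk
  refine ⟨hu, hspan, fun a ha => ?_⟩
  let L := K.submoduleOf (maximalIdeal S)
  let g : Fin (minGeneratorsMaxMod K) → (↥(maximalIdeal S) ⧸ L) :=
    fun i => L.mkQ ⟨u i, hu i⟩
  have hsum : ∀ a : Fin (minGeneratorsMaxMod K) → S, ∑ i, a i * u i ∈ maximalIdeal S :=
    fun a => Ideal.sum_mem _ fun i _ => Ideal.mul_mem_left _ _ (hu i)
  have hgsum : ∀ a : Fin (minGeneratorsMaxMod K) → S,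
      ∑ i, a i • g i = L.mkQ ⟨∑ i, a i * u i, hsum a⟩ := by
    intro a
    simp only [g, ← map_smul, ← map_sum]
    congr 1
    apply Subtype.ext
    simp
  have hg : Submodule.span S (Set.range g) = ⊤ := by
    rw [eq_top_iff]
    rintro y -
    obtain ⟨⟨y, hy⟩, rfl⟩ := L.mkQ_surjective y
    obtain ⟨t, ht, c, hc, rfl⟩ := Submodule.mem_sup.1 (hspan hy)
    obtain ⟨a, rfl⟩ := (Submodule.mem_span_range_iff_exists_fun S).1 ht
    refine (Submodule.mem_span_range_iff_exists_fun S).2 ⟨a, ?_⟩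
    rw [hgsum, ← sub_eq_zero, ← map_sub, mkQ_submoduleOf_eq_zero]
    simpa using hc
  refine mem_maximalIdeal_of_sum_mem (S := S) hg ?_
  change ∑ i : Fin (minGeneratorsMaxMod K), a i • g i ∈ _
  rw [hgsum]
  obtain ⟨c, hc, t, ht, hct⟩ := Submodule.mem_sup.1 ha
  have ht1 : t ∈ maximalIdeal S := Ideal.pow_le_self two_ne_zero ht
  have h1 : L.mkQ ⟨∑ i, a i * u i, hsum a⟩ = L.mkQ ⟨t, ht1⟩ := by
    rw [← sub_eq_zero, ← map_sub, mkQ_submoduleOf_eq_zero]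
    simpa [← hct] using hc
  rw [h1]
  have h2 : (⟨t, ht1⟩ : maximalIdeal S) ∈ (maximalIdeal S • ⊤ : Submodule S (maximalIdeal S)) := by
    rw [Submodule.mem_smul_top_iff, smul_eq_mul, ← pow_two]
    exact ht
  have h3 := Submodule.mem_map_of_mem (f := L.mkQ) h2
  rw [Submodule.map_smul''] at h3
  exact Submodule.smul_mono le_rfl le_top h3

theorem exists_isMinimalModulo [IsNoetherianRing S] {K : Ideal S}
    {k : ℕ} (hk : minGeneratorsMaxMod K = k) : ∃ u : Fin k → S, IsMinimalModulo K u := by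
  have hk' := hk
  subst hk
  let L := K.submoduleOf (maximalIdeal S)
  obtain ⟨g, hg⟩ := exists_minimal_generators (S := S) (M := ↥(maximalIdeal S) ⧸ L)
  choose f hf using fun i => L.mkQ_surjective (g i)
  refine ⟨fun i => f i, isMinimalModulo_of_le_span rfl (fun i => (f i).2) ?_⟩
  intro y hy
  obtain ⟨a, ha⟩ := (Submodule.mem_span_range_iff_exists_fun S).1
    (hg ▸ Submodule.mem_top (x := L.mkQ ⟨y, hy⟩))
  have h1 : L.mkQ (⟨y, hy⟩ - ∑ i, a i • f i) = 0 := by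
    rw [map_sub, map_sum, ← ha, sub_eq_zero]
    exact Finset.sum_congr rfl fun i _ => by rw [map_smul, hf]
  rw [mkQ_submoduleOf_eq_zero] at h1
  have h2 : y = (∑ i, a i * (f i : S)) + (y - ∑ i, a i * (f i : S)) := by ring
  rw [h2]
  refine add_mem (Ideal.mem_sup_left (Ideal.sum_mem _ fun i _ => Ideal.mul_mem_left _ _
    (Ideal.subset_span ⟨i, rfl⟩))) (Ideal.mem_sup_right ?_)
  simpa using h1

/-- A family that is minimal modulo `K` extends to a minimal system of generators of `𝔫` by
elements of a given subset that generates `K` modulo `𝔫 ^ 2`. -/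
theorem IsMinimalModulo.exists_isAdaptedSystem [IsNoetherianRing S] {K : Ideal S}
    {k : ℕ} {u : Fin k → S} (hu : IsMinimalModulo K u) {Z : Set S} (hZK : Z ⊆ K)
    (hZn : Z ⊆ maximalIdeal S) (hKZ : K ≤ Ideal.span Z ⊔ maximalIdeal S ^ 2) :
    ∃ (s : ℕ) (z : Fin s → S), (∀ j, z j ∈ Z) ∧ IsAdaptedSystem K u z := by
  classical
  set n := maximalIdeal S with hn
  let V := CotangentSpace S
  let q : n →ₗ[S] V := n.toCotangent
  have hres : ∀ (r : S) (v : V), r • v = residue S r • v := fun r v => by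
    rw [← ResidueField.algebraMap_eq, algebraMap_smul]
  have hq0 : ∀ y : n, q y = 0 ↔ (y : S) ∈ n ^ 2 := fun y => n.toCotangent_eq_zero y
  let U : Fin k → V := fun i => q ⟨u i, hu.mem i⟩
  have hU : LinearIndependent (ResidueField S) U := by
    rw [Fintype.linearIndependent_iff]
    intro g hg i
    choose a ha using fun i => residue_surjective (g i)
    have h1 : q (∑ i, a i • ⟨u i, hu.mem i⟩) = 0 := by
      rw [map_sum, ← hg]
      exact Finset.sum_congr rfl fun i _ => by rw [map_smul, hres, ha]
    rw [hq0] at h1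
    have h2 := hu.indep a (Ideal.mem_sup_right (by simpa using h1)) i
    rw [← ha]
    exact (residue_eq_zero_iff _).2 h2
  -- The images of `u` in the cotangent space are extended to a basis by images of elements of `Z`.
  let ZV : Set V := {v | ∃ y : n, (y : S) ∈ Z ∧ q y = v}
  have hUI : LinearIndepOn (ResidueField S) id (Set.range U) := hU.linearIndepOn_id
  have hsub : Set.range U ⊆ Set.range U ∪ ZV := Set.subset_union_left
  set b := hUI.extend hsub with hb
  have hbI : LinearIndepOn (ResidueField S) id b := hUI.linearIndepOn_extend hsub
  have hbfin : b.Finite := hbI.linearIndependent.setFinite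
  set c := b \ Set.range U with hc
  have hcfin : c.Finite := hbfin.subset Set.sdiff_subset
  obtain ⟨s, e⟩ : ∃ s : ℕ, Nonempty (Fin s ≃ c) :=
    ⟨hcfin.toFinset.card, ⟨(hcfin.toFinset.equivFin.symm).trans
      (Equiv.setCongr hcfin.coe_toFinset)⟩⟩
  obtain ⟨e⟩ := e
  have hcZ : ∀ v ∈ c, v ∈ ZV := fun v hv =>
    (hUI.extend_subset hsub hv.1).resolve_left hv.2
  choose z hzZ hz using fun j => hcZ (e j) (e j).2
  have hW : Set.range (Sum.elim U (fun j => (e j : V))) = b := by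
    rw [Set.Sum.elim_range]
    have h1 : Set.range (fun j => (e j : V)) = c := by
      rw [show (fun j => (e j : V)) = Subtype.val ∘ e from rfl, e.surjective.range_comp,
        Subtype.range_coe]
    rw [h1, hc, Set.union_sdiff_cancel (hUI.subset_extend hsub)]
  have hWinj : Function.Injective (Sum.elim U (fun j => (e j : V))) := by
    refine hU.injective.sumElim (Subtype.val_injective.comp e.injective) ?_
    intro i j h
    exact (e j).2.2 ⟨i, h⟩
  have hWI : LinearIndependent (ResidueField S) (Sum.elim U (fun j => (e j : V))) := by
    have h1 : LinearIndepOn (ResidueField S) id (Set.range (Sum.elim U (fun j => (e j : V)))) := by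
      rw [hW]; exact hbI
    exact (linearIndepOn_id_range_iff hWinj).1 h1
  have hgen : n ≤ Ideal.span (Set.range u) ⊔ Ideal.span Z ⊔ n ^ 2 := by
    refine hu.le_span.trans (sup_le (le_sup_left.trans le_sup_left) (hKZ.trans ?_))
    exact sup_le_sup_right le_sup_right _
  have hspanV : (⊤ : Submodule (ResidueField S) V) ≤ Submodule.span (ResidueField S) b := by
    refine le_trans ?_ (Submodule.span_le.2 (hUI.subset_span_extend hsub))
    rintro v -
    obtain ⟨⟨y, hy⟩, rfl⟩ := n.toCotangent_surjective v
    set N := (Submodule.span (ResidueField S) (Set.range U ∪ ZV)).restrictScalars S with hN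
    change q ⟨y, hy⟩ ∈ N
    have h1 : ∀ t ∈ Ideal.span (Set.range u ∪ Z), ∃ ht : t ∈ n, q ⟨t, ht⟩ ∈ N := by
      intro t ht
      induction ht using Submodule.span_induction with
      | mem t ht =>
        rcases ht with ⟨i, rfl⟩ | ht
        · exact ⟨hu.mem i, Submodule.subset_span (Or.inl ⟨i, rfl⟩)⟩
        · exact ⟨hZn ht, Submodule.subset_span (Or.inr ⟨⟨t, hZn ht⟩, ht, rfl⟩)⟩
      | zero => exact ⟨zero_mem _, by
        convert! N.zero_mem⟩
      | add t t' _ _ h h' =>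
        obtain ⟨h1, h2⟩ := h
        obtain ⟨h3, h4⟩ := h'
        exact ⟨add_mem h1 h3, by
          have := N.add_mem h2 h4
          rwa [← map_add] at this⟩
      | smul c t _ h =>
        obtain ⟨h1, h2⟩ := h
        exact ⟨n.mul_mem_left c h1, by
          have := N.smul_mem c h2
          rwa [← map_smul] at this⟩
    obtain ⟨t, ht, r, hr, htr⟩ := Submodule.mem_sup.1 (hgen hy)
    rw [← Ideal.span_union] at ht
    obtain ⟨ht1, ht2⟩ := h1 t ht
    have h2 : q ⟨y, hy⟩ = q ⟨t, ht1⟩ := by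
      rw [← sub_eq_zero, ← map_sub, hq0]
      simpa [← htr] using hr
    rw [h2]
    exact ht2
  refine ⟨s, fun j => z j, hzZ, ?_, fun j => hZK (hzZ j), ?_⟩
  · apply le_antisymm
    · rw [Ideal.span_le]
      rintro _ ⟨i | j, rfl⟩
      · exact hu.mem i
      · exact (z j).2
    · apply le_of_le_sup_maximalIdeal_mul
      intro y hy
      obtain ⟨a, ha⟩ := (Submodule.mem_span_range_iff_exists_fun (ResidueField S)).1
        (hW.symm ▸ hspanV (Submodule.mem_top (x := q ⟨y, hy⟩)))
      choose r hr using fun i => residue_surjective (a i)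
      let w : Fin k ⊕ Fin s → n := Sum.elim (fun i => ⟨u i, hu.mem i⟩) z
      have hw : ∀ i, q (w i) = Sum.elim U (fun j => (e j : V)) i := by
        rintro (i | j)
        · rfl
        · exact hz j
      have h1 : q (⟨y, hy⟩ - ∑ i, r i • w i) = 0 := by
        rw [map_sub, map_sum, ← ha, sub_eq_zero]
        exact Finset.sum_congr rfl fun i _ => by rw [map_smul, hw, hres, hr]
      rw [hq0] at h1
      have h2 : y = (∑ i, r i * (w i : S)) + (y - ∑ i, r i * (w i : S)) := by ring
      rw [h2]
      refine add_mem (Ideal.mem_sup_left (Ideal.sum_mem _ fun i _ => Ideal.mul_mem_left _ _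
        (Ideal.subset_span ⟨i, ?_⟩))) (Ideal.mem_sup_right ?_)
      · rcases i with i | j <;> rfl
      · rw [← hn, ← pow_two]
        simpa using h1
  · have h1 := Module.finrank_eq_card_basis (Module.Basis.mk hWI (by rw [hW]; exact hspanV))
    rw [embeddingDim, h1]
    simp

theorem IsAdaptedSystem.mem_left {K : Ideal S} {k s : ℕ} {u : Fin k → S}
    {z : Fin s → S} (h : IsAdaptedSystem K u z) (i : Fin k) : u i ∈ maximalIdeal S :=
  h.span_eq ▸ Ideal.subset_span ⟨Sum.inl i, rfl⟩

/-- A nonzero form of degree `d < v(S)` in the part `u` of an adapted system of generators does not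
lie in `(z) + 𝔫 ^ (d + 1)`. -/
theorem IsAdaptedSystem.eq_zero_of_isHomogeneous [IsArtinianRing S]
    (hκ : IsCoefficientField κ S)
    {K : Ideal S} {k s : ℕ} {u : Fin k → S} {z : Fin s → S} (h : IsAdaptedSystem K u z)
    {d t : ℕ} (ht : (t : ℕ∞) ≤ vInv S) (hd : d < t) {F : MvPolynomial (Fin k) κ}
    (hF : F.IsHomogeneous d)
    (hFu : aeval u F ∈ Ideal.span (Set.range z) ⊔ maximalIdeal S ^ (d + 1)) : F = 0 := by
  let π : MvPolynomial (Fin k ⊕ Fin s) κ →+* S := (aeval (Sum.elim u z)).toRingHom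
  have hπ : Function.Surjective π := aeval_surjective hκ h.span_eq
  have hz : Ideal.span (Set.range z) =
      (Ideal.span (Set.range fun j : Fin s => (X (Sum.inr j) : MvPolynomial (Fin k ⊕ Fin s) κ))).map
        π := by
    rw [Ideal.map_span, ← Set.range_comp]
    congr 2
    ext j
    simp [π]
  obtain ⟨g, hg, r, hr, hgr⟩ := Submodule.mem_sup.1 hFu
  rw [hz] at hg
  rw [← map_idealOfVars_pow (κ := κ) h.span_eq] at hr
  obtain ⟨G, hG, rfl⟩ := (Ideal.mem_map_iff_of_surjective π hπ).1 hg
  obtain ⟨H, hH, rfl⟩ := (Ideal.mem_map_iff_of_surjective π hπ).1 hr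
  have hker : rename Sum.inl F - (G + H) ∈ idealOfVars (Fin k ⊕ Fin s) κ ^ (d + 1) := by
    apply ker_aeval_le_pow h.span_eq (by simpa using h.card)
      ((by exact_mod_cast hd : ((d + 1 : ℕ) : ℕ∞) ≤ (t : ℕ∞)).trans ht)
    rw [map_sub, aeval_rename, Sum.elim_comp_inl, ← hgr, map_add]
    exact sub_self _
  -- The variables that correspond to `z` are set to zero.
  let θ : MvPolynomial (Fin k ⊕ Fin s) κ →ₐ[κ] MvPolynomial (Fin k) κ := aeval (Sum.elim X 0)
  have hθ : (idealOfVars (Fin k ⊕ Fin s) κ ^ (d + 1)).map θ ≤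
      idealOfVars (Fin k) κ ^ (d + 1) := by
    rw [Ideal.map_pow]
    apply Ideal.pow_right_mono
    rw [Ideal.map_span, Ideal.span_le]
    rintro _ ⟨_, ⟨i | j, rfl⟩, rfl⟩
    · simpa [θ] using Ideal.subset_span (Set.mem_range_self i)
    · simp [θ]
  have h0 : θ G = 0 := by
    have : Ideal.span (Set.range fun j : Fin s =>
        (X (Sum.inr j) : MvPolynomial (Fin k ⊕ Fin s) κ)) ≤ RingHom.ker θ := by
      rw [Ideal.span_le]
      rintro _ ⟨j, rfl⟩
      simp [θ]
    exact this hG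
  have h1 := hθ (Ideal.mem_map_of_mem θ hker)
  have h2 := hθ (Ideal.mem_map_of_mem θ hH)
  have h3 : θ (rename Sum.inl F) = F := by
    rw [aeval_rename, Sum.elim_comp_inl, aeval_X_left_apply]
  rw [map_sub, map_add, h0, zero_add, h3] at h1
  exact eq_zero_of_isHomogeneous_of_mem_pow hF (by simpa using add_mem h1 h2)

end Coordinates

/-! ### Dimensions over the coefficient field -/

section Dimension

theorem finrank_quotient_mono {S : Type u} [CommRing S] {κ : Type*} [Field κ] [Algebra κ S]
    [Module.Finite κ S] {I I' : Ideal S} (h : I ≤ I') :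
    Module.finrank κ (S ⧸ I') ≤ Module.finrank κ (S ⧸ I) :=
  LinearMap.finrank_le_finrank_of_surjective (f := (Ideal.Quotient.factorₐ κ h).toLinearMap)
    (Ideal.Quotient.factor_surjective h)

theorem eq_of_finrank_quotient_le {S : Type u} [CommRing S] {κ : Type*} [Field κ] [Algebra κ S]
    [Module.Finite κ S] {I I' : Ideal S} (h : I ≤ I')
    (hd : Module.finrank κ (S ⧸ I) ≤ Module.finrank κ (S ⧸ I')) : I = I' := by
  apply le_antisymm h
  have h1 := (LinearMap.injective_iff_surjective_of_finrank_eq_finrank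
    (f := (Ideal.Quotient.factorₐ κ h).toLinearMap)
    (le_antisymm hd (finrank_quotient_mono h))).2 (Ideal.Quotient.factor_surjective h)
  intro x hx
  rw [← Ideal.Quotient.eq_zero_iff_mem]
  apply h1
  rw [map_zero]
  exact Ideal.Quotient.eq_zero_iff_mem.2 hx

variable {S : Type u} [CommRing S] [IsLocalRing S] {κ : Type*} [Field κ] [Algebra κ S]

theorem length_eq_length_of_coefficientField
    (hκ : IsCoefficientField κ S) (M : Type*) [AddCommGroup M]
    [Module κ M] [Module S M] [IsScalarTower κ S M] : Module.length κ M = Module.length S M := by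
  rw [IsLocalRing.length_restrictScalars κ S M]
  have hsurj : Function.Surjective (algebraMap (ResidueField κ) (ResidueField S)) := by
    intro y
    obtain ⟨s, rfl⟩ := residue_surjective y
    obtain ⟨a, ha⟩ := hκ s
    refine ⟨residue κ a, ?_⟩
    rw [ResidueField.algebraMap_residue, eq_comm, ← sub_eq_zero, ← map_sub, residue_eq_zero_iff]
    exact ha
  rw [Module.length_eq_of_surjective (M := ResidueField S) hsurj,
    Module.length_eq_one (ResidueField S) (ResidueField S), mul_one]

theorem finite_of_coefficientField [IsArtinianRing S]
    (hκ : IsCoefficientField κ S) : Module.Finite κ S := by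
  have h : Module.length κ S ≠ ⊤ := by
    rw [length_eq_length_of_coefficientField hκ S]
    exact Module.length_ne_top
  rw [Module.length_ne_top_iff, isFiniteLength_iff_isNoetherian_isArtinian] at h
  have := h.1
  infer_instance

/-- The colength of `J` is the dimension of `S / (0 :_S J)`. -/
theorem colength_eq_finrank (hS : IsArtinianGorensteinLocal S)
    (hκ : IsCoefficientField κ S) (J : Ideal S) :
    colength J = (Module.finrank κ (S ⧸ annIdeal J) : ℕ∞) := by
  have := hS.isArtinianRing
  have := finite_of_coefficientField hκ
  rw [colength_eq_length_quotient_annIdeal hS, ← length_eq_length_of_coefficientField hκ,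
    Module.length_eq_finrank]

theorem finrank_quotient_sup_sq [IsArtinianRing S]
    (hκ : IsCoefficientField κ S) {K : Ideal S}
    (hK : K ≤ maximalIdeal S) {k : ℕ} {u : Fin k → S} (hu : IsMinimalModulo K u) :
    Module.finrank κ (S ⧸ (K ⊔ maximalIdeal S ^ 2)) = k + 1 := by
  set I := K ⊔ maximalIdeal S ^ 2 with hI
  have hIn : I ≤ maximalIdeal S := sup_le hK (Ideal.pow_le_self two_ne_zero)
  let f : (κ × (Fin k → κ)) →ₗ[κ] S :=
    (Algebra.linearMap κ S).coprod (Fintype.linearCombination κ u)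
  have hf : ∀ a b, f (a, b) = algebraMap κ S a + ∑ i, algebraMap κ S (b i) * u i := by
    intro a b
    simp [f, Fintype.linearCombination_apply, Algebra.smul_def]
  let g : (κ × (Fin k → κ)) →ₗ[κ] (S ⧸ I) := (Ideal.Quotient.mkₐ κ I).toLinearMap ∘ₗ f
  have hg0 : ∀ p, g p = 0 ↔ f p ∈ I := fun p => Ideal.Quotient.eq_zero_iff_mem
  have hsum : ∀ b : Fin k → S, ∑ i, b i * u i ∈ maximalIdeal S := fun b =>
    Ideal.sum_mem _ fun i _ => Ideal.mul_mem_left _ _ (hu.mem i)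
  have hinj : Function.Injective g := by
    rw [injective_iff_map_eq_zero]
    rintro ⟨a, b⟩ h
    rw [hg0, hf] at h
    have ha : a = 0 := mem_of_algebraMap_mem (by
      have := sub_mem (hIn h) (hsum fun i => algebraMap κ S (b i))
      rwa [add_sub_cancel_right] at this)
    subst ha
    rw [map_zero, zero_add] at h
    have hb : b = 0 := funext fun i => mem_of_algebraMap_mem (hu.indep _ h i)
    rw [hb]
    rfl
  have hsurj : Function.Surjective g := by
    intro y
    obtain ⟨s, rfl⟩ := Ideal.Quotient.mk_surjective y
    obtain ⟨a, ha⟩ := hκ s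
    obtain ⟨t, ht, c, hc, htc⟩ := Submodule.mem_sup.1 (hu.le_span ha)
    obtain ⟨r, rfl⟩ := (Submodule.mem_span_range_iff_exists_fun S).1 ht
    choose b hb using fun i => hκ (r i)
    refine ⟨(a, b), ?_⟩
    refine Eq.symm (Ideal.Quotient.eq.2 ?_)
    have h1 : s - f (a, b) = c + ∑ i, (r i - algebraMap κ S (b i)) * u i := by
      rw [hf, ← sub_sub, ← htc, add_sub_right_comm, ← Finset.sum_sub_distrib, add_comm]
      congr 1
      exact Finset.sum_congr rfl fun i _ => by rw [smul_eq_mul]; ring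
    rw [h1]
    refine add_mem (Ideal.mem_sup_left hc) (Ideal.mem_sup_right (Ideal.sum_mem _ fun i _ => ?_))
    rw [pow_two]
    exact Ideal.mul_mem_mul (hb i) (hu.mem i)
  have h := (LinearEquiv.ofBijective g ⟨hinj, hsurj⟩).finrank_eq
  rw [← h]
  simp [add_comm]

theorem pow_le_or_finrank_lt [IsArtinianRing S] [Module.Finite κ S] (K : Ideal S) (i : ℕ) :
    maximalIdeal S ^ i ≤ K ∨ Module.finrank κ (S ⧸ (K ⊔ maximalIdeal S ^ i)) <
      Module.finrank κ (S ⧸ (K ⊔ maximalIdeal S ^ (i + 1))) := by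
  by_contra! h
  have h1 := eq_of_finrank_quotient_le (sup_le_sup_left (Ideal.pow_le_pow_right i.le_succ) K) h.2
  apply h.1
  apply le_of_le_sup_maximalIdeal_mul
  rw [← pow_succ', h1]
  exact le_sup_right

theorem pow_le_of_finrank_le [IsArtinianRing S] [Module.Finite κ S] {K : Ideal S} {i : ℕ}
    (h : Module.finrank κ (S ⧸ K) ≤ Module.finrank κ (S ⧸ (K ⊔ maximalIdeal S ^ i))) :
    maximalIdeal S ^ i ≤ K := by
  rw [eq_of_finrank_quotient_le le_sup_left h]
  exact le_sup_right

theorem pow_finrank_le [IsArtinianRing S] [Module.Finite κ S] (K : Ideal S) :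
    maximalIdeal S ^ Module.finrank κ (S ⧸ K) ≤ K := by
  have key : ∀ i, maximalIdeal S ^ i ≤ K ∨
      i ≤ Module.finrank κ (S ⧸ (K ⊔ maximalIdeal S ^ i)) := by
    intro i
    induction i with
    | zero => exact Or.inr (Nat.zero_le _)
    | succ i ih =>
      rcases ih with ih | ih
      · exact Or.inl ((Ideal.pow_le_pow_right i.le_succ).trans ih)
      · rcases pow_le_or_finrank_lt (κ := κ) K i with h | h
        · exact Or.inl ((Ideal.pow_le_pow_right i.le_succ).trans h)
        · exact Or.inr (by omega)
  rcases key (Module.finrank κ (S ⧸ K)) with h | h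
  · exact h
  · exact pow_le_of_finrank_le h

/-- If `𝔫 ^ 2 + K` exceeds `𝔫 ^ 3 + K` by one dimension, then the multiplication
`𝔫 × 𝔫 → (𝔫 ^ 2 + K) / (𝔫 ^ 3 + K)` can be read off from a linear functional `φ`. -/
theorem exists_functional [IsArtinianRing S] [Module.Finite κ S]
    (hκ : IsCoefficientField κ S) {K : Ideal S}
    (h : Module.finrank κ (S ⧸ (K ⊔ maximalIdeal S ^ 3)) =
      Module.finrank κ (S ⧸ (K ⊔ maximalIdeal S ^ 2)) + 1) :
    ∃ (φ : S →ₗ[κ] κ) (w : S), w ∈ maximalIdeal S ^ 2 ∧ φ w = 1 ∧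
      (∀ t ∈ K ⊔ maximalIdeal S ^ 3, φ t = 0) ∧
      ∀ t ∈ maximalIdeal S ^ 2, t - algebraMap κ S (φ t) * w ∈ K ⊔ maximalIdeal S ^ 3 := by
  set I := K ⊔ maximalIdeal S ^ 3 with hI
  have hII : I ≤ K ⊔ maximalIdeal S ^ 2 := sup_le_sup_left (Ideal.pow_le_pow_right (by omega)) K
  obtain ⟨w, hw, hwI⟩ : ∃ w ∈ maximalIdeal S ^ 2, w ∉ I := by
    by_contra! hcon
    have := finrank_quotient_mono (κ := κ) (sup_le (le_sup_left.trans hI.ge) hcon)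
    omega
  obtain ⟨φ, hφw, hφI⟩ : ∃ φ : S →ₗ[κ] κ, φ w = 1 ∧ ∀ t ∈ I, φ t = 0 := by
    obtain ⟨f, hf, hfI⟩ := Submodule.exists_le_ker_of_notMem (p := I.restrictScalars κ)
      (v := w) hwI
    refine ⟨(f w)⁻¹ • f, by simp [hf], fun t ht => ?_⟩
    have : f t = 0 := hfI ht
    simp [this]
  refine ⟨φ, w, hw, hφw, hφI, ?_⟩
  have h1 : I ⊔ Ideal.span {w} = K ⊔ maximalIdeal S ^ 2 := by
    apply eq_of_finrank_quotient_le (κ := κ)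
    · exact sup_le hII ((Ideal.span_singleton_le_iff_mem _).2 (Ideal.mem_sup_right hw))
    · by_contra! hcon
      have h2 := eq_of_finrank_quotient_le (κ := κ) (le_sup_left : I ≤ I ⊔ Ideal.span {w})
        (by omega)
      exact hwI (h2 ▸ Ideal.mem_sup_right (Ideal.mem_span_singleton_self w))
  intro t ht
  obtain ⟨e, he, r, hr, rfl⟩ := Submodule.mem_sup.1 (h1.ge (Ideal.mem_sup_right ht))
  obtain ⟨r, rfl⟩ := Ideal.mem_span_singleton'.1 hr
  obtain ⟨a, ha⟩ := hκ r
  have h2 : e + r * w - algebraMap κ S a * w ∈ I := by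
    rw [add_sub_assoc, ← sub_mul]
    refine add_mem he (Ideal.mem_sup_right ?_)
    rw [pow_succ']
    exact Ideal.mul_mem_mul ha hw
  have h3 : φ (e + r * w) = a := by
    have := hφI _ h2
    rw [map_sub, ← Algebra.smul_def, map_smul, hφw, smul_eq_mul, mul_one, sub_eq_zero] at this
    exact this
  rw [h3]
  exact h2

end Dimension

/-! ### Socle elements outside of `K + 𝔫 ^ 2` -/

section Socle

open MvPolynomial

theorem mul_mem_sup_pow {S : Type u} [CommRing S] {A n : Ideal S} {x y : S} {i j : ℕ}
    (hx : x ∈ A ⊔ n ^ i) (hy : y ∈ n ^ j) : x * y ∈ A ⊔ n ^ (i + j) := by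
  obtain ⟨a, ha, b, hb, rfl⟩ := Submodule.mem_sup.1 hx
  rw [add_mul, pow_add]
  exact add_mem (Ideal.mem_sup_left (A.mul_mem_right y ha))
    (Ideal.mem_sup_right (Ideal.mul_mem_mul hb hy))

variable {S : Type u} [CommRing S] [IsLocalRing S] {κ : Type*} [Field κ] [Algebra κ S]

theorem IsMinimalModulo.exists_sub_sum_mem (hκ : IsCoefficientField κ S) {K : Ideal S} {k : ℕ}
    {u : Fin k → S} (hu : IsMinimalModulo K u) {x : S} (hx : x ∈ maximalIdeal S) :
    ∃ a : Fin k → κ, x - ∑ i, algebraMap κ S (a i) * u i ∈ K ⊔ maximalIdeal S ^ 2 := by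
  obtain ⟨t, ht, c, hc, rfl⟩ := Submodule.mem_sup.1 (hu.le_span hx)
  obtain ⟨r, rfl⟩ := (Submodule.mem_span_range_iff_exists_fun S).1 ht
  choose a ha using fun i => hκ (r i)
  refine ⟨a, ?_⟩
  have h1 : (∑ i, r i • u i) + c - ∑ i, algebraMap κ S (a i) * u i
      = c + ∑ i, (r i - algebraMap κ S (a i)) * u i := by
    rw [add_sub_right_comm, ← Finset.sum_sub_distrib, add_comm]
    congr 1
    exact Finset.sum_congr rfl fun i _ => by rw [smul_eq_mul]; ring
  rw [h1]
  refine add_mem (Ideal.mem_sup_left hc) (Ideal.mem_sup_right (Ideal.sum_mem _ fun i _ => ?_))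
  rw [pow_two]
  exact Ideal.mul_mem_mul (ha i) (hu.mem i)

theorem IsMinimalModulo.eq_zero_of_sum_mem {K : Ideal S} {k : ℕ}
    {u : Fin k → S} (hu : IsMinimalModulo K u) {a : Fin k → κ}
    (ha : ∑ i, algebraMap κ S (a i) * u i ∈ K ⊔ maximalIdeal S ^ 2) : a = 0 :=
  funext fun i => mem_of_algebraMap_mem (hu.indep _ ha i)

theorem IsAdaptedSystem.le_span {K : Ideal S} (hK : K ≤ maximalIdeal S) {k s : ℕ} {u : Fin k → S}
    (hu : IsMinimalModulo K u) {z : Fin s → S} (h : IsAdaptedSystem K u z) :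
    K ≤ Ideal.span (Set.range z) ⊔ maximalIdeal S ^ 2 := by
  intro x hx
  have h1 := hK hx
  rw [← h.span_eq, Set.Sum.elim_range, Ideal.span_union] at h1
  obtain ⟨t, ht, c, hc, rfl⟩ := Submodule.mem_sup.1 h1
  obtain ⟨r, rfl⟩ := (Submodule.mem_span_range_iff_exists_fun S).1 ht
  have hzK : Ideal.span (Set.range z) ≤ K := by
    rw [Ideal.span_le]
    rintro _ ⟨j, rfl⟩
    exact h.mem j
  have h2 : ∑ i, r i * u i ∈ K := by
    have := sub_mem hx (hzK hc)
    rwa [add_sub_cancel_right] at this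
  have h3 := hu.indep r (Ideal.mem_sup_left h2)
  refine add_mem (Ideal.mem_sup_right (Ideal.sum_mem _ fun i _ => ?_)) (Ideal.mem_sup_left hc)
  rw [pow_two]
  exact Ideal.mul_mem_mul (h3 i) (hu.mem i)

theorem IsAdaptedSystem.maximalIdeal_mul_le {K : Ideal S} (hK : K ≤ maximalIdeal S) {k s : ℕ}
    {u : Fin k → S} (hu : IsMinimalModulo K u) {z : Fin s → S} (h : IsAdaptedSystem K u z) :
    maximalIdeal S * K ≤ Ideal.span (Set.range z) ⊔ maximalIdeal S ^ 3 := by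
  rw [Ideal.mul_le]
  intro x hx y hy
  rw [mul_comm]
  exact mul_mem_sup_pow (j := 1) (h.le_span hK hu hy) (by rwa [pow_one])

/-- If `l ∈ 𝔫` is not in `K + 𝔫 ^ 2` and `l 𝔫 ⊆ K`, then the first splitting theorem applies:
multiplication by `l` is injective on `𝔫 / (K + 𝔫 ^ 2)`, since forms over the coefficient field
have no zero divisors. -/
theorem firstSplittingApplies_of_socle (hS : IsArtinianGorensteinLocal S)
    (hκ : IsCoefficientField κ S) {J : Ideal S} (hK : annIdeal J ≤ maximalIdeal S)
    {k : ℕ} {u : Fin k → S} (hu : IsMinimalModulo (annIdeal J) u) (hk : 2 ≤ k)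
    (hv : ((3 : ℕ) : ℕ∞) ≤ vInv S) {l : S} (hl : l ∈ maximalIdeal S)
    (hl2 : l ∉ annIdeal J ⊔ maximalIdeal S ^ 2)
    (hlK : ∀ x ∈ maximalIdeal S, l * x ∈ annIdeal J) : FirstSplittingApplies J := by
  have := hS.isArtinianRing
  set n := maximalIdeal S with hn
  set K := annIdeal J with hKdef
  obtain ⟨s, z, -, hz⟩ := hu.exists_isAdaptedSystem (Z := (K : Set S)) le_rfl hK
    (by rw [Ideal.span_eq]; exact le_sup_left)
  obtain ⟨c, hc⟩ := hu.exists_sub_sum_mem hκ hl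
  let i₀ : Fin k := ⟨0, by omega⟩
  let i₁ : Fin k := ⟨1, by omega⟩
  have hi : i₀ ≠ i₁ := by simp [i₀, i₁]
  refine firstSplittingApplies_of_independent hS (m := l) hlK (hu.mem i₀) (hu.mem i₁) ?_
  intro a b hab
  obtain ⟨a₀, ha⟩ := hκ a
  obtain ⟨b₀, hb⟩ := hκ b
  set Z := Ideal.span (Set.range z) with hZ
  let F : MvPolynomial (Fin k) κ := ∑ i, C (c i) * X i
  let G : MvPolynomial (Fin k) κ := C a₀ * X i₀ + C b₀ * X i₁
  have hF : F.IsHomogeneous 1 := IsHomogeneous.sum _ _ _ fun i _ => (isHomogeneous_C_mul_X _ _)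
  have hG : G.IsHomogeneous 1 := (isHomogeneous_C_mul_X _ _).add (isHomogeneous_C_mul_X _ _)
  have hFv : aeval u F = ∑ i, algebraMap κ S (c i) * u i := by simp [F]
  have hGv : aeval u G = algebraMap κ S a₀ * u i₀ + algebraMap κ S b₀ * u i₁ := by simp [G]
  have hGm : aeval u G ∈ n := by
    rw [hGv]
    exact add_mem (n.mul_mem_left _ (hu.mem i₀)) (n.mul_mem_left _ (hu.mem i₁))
  have hKZ : K ⊔ n ^ 2 ≤ Z ⊔ n ^ 2 := sup_le (hz.le_span hK hu) le_sup_right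
  -- `F` and `G` represent `l` and the factor `a u₀ + b u₁` of the given element of `𝔫 K`.
  have hmem : aeval u (F * G) ∈ Z ⊔ n ^ (2 + 1) := by
    have h1 := mul_mem_sup_pow (j := 1) (hKZ hc) (by rwa [pow_one] : aeval u G ∈ n ^ 1)
    have h2 : l * ((a - algebraMap κ S a₀) * u i₀ + (b - algebraMap κ S b₀) * u i₁) ∈ n ^ 3 := by
      rw [pow_succ', pow_two]
      exact Ideal.mul_mem_mul hl (add_mem (Ideal.mul_mem_mul ha (hu.mem i₀))
        (Ideal.mul_mem_mul hb (hu.mem i₁)))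
    have h3 := hz.maximalIdeal_mul_le hK hu hab
    have h4 : aeval u (F * G) = a * (l * u i₀) + b * (l * u i₁)
        - l * ((a - algebraMap κ S a₀) * u i₀ + (b - algebraMap κ S b₀) * u i₁)
        - (l - ∑ i, algebraMap κ S (c i) * u i) * aeval u G := by
      rw [map_mul, hFv, hGv]
      ring
    rw [h4]
    exact sub_mem (sub_mem h3 (Ideal.mem_sup_right h2)) h1
  rcases mul_eq_zero.1 (hz.eq_zero_of_isHomogeneous hκ hv (by omega) (hF.mul hG) hmem) with h | h
  · rw [← hFv, h, map_zero, sub_zero] at hc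
    exact absurd hc hl2
  · have hcoef : ∀ i, coeff (Finsupp.single i 1) G = 0 := fun i => by rw [h, coeff_zero]
    have h0 := hcoef i₀
    have h1 := hcoef i₁
    simp only [G, coeff_add, coeff_C_mul, coeff_X, Finsupp.single_left_inj one_ne_zero, hi,
      hi.symm, if_true, if_false, mul_one, mul_zero, add_zero, zero_add] at h0 h1
    rw [h0, map_zero, sub_zero] at ha
    rw [h1, map_zero, sub_zero] at hb
    exact ⟨ha, hb⟩

/-- The first splitting theorem applies if `0 :_S J` is the maximal ideal. -/
theorem firstSplittingApplies_of_annIdeal_eq (hS : IsArtinianGorensteinLocal S) {J : Ideal S}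
    (he : 2 ≤ embeddingDim S) (hJ : annIdeal J = maximalIdeal S) : FirstSplittingApplies J := by
  have := hS.isArtinianRing
  have hmin : minGenerators S (maximalIdeal S) = embeddingDim S := by
    rw [minGenerators, Submodule.spanFinrank_top,
      spanFinrank_maximalIdeal_eq_finrank_cotangentSpace, embeddingDim]
  obtain ⟨g, hg⟩ := exists_minimal_generators (S := S) (M := maximalIdeal S)
  let i₀ : Fin (minGenerators S (maximalIdeal S)) := ⟨0, by omega⟩
  let i₁ : Fin (minGenerators S (maximalIdeal S)) := ⟨1, by omega⟩
  have hi : i₀ ≠ i₁ := by simp [i₀, i₁]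
  refine firstSplittingApplies_of_independent hS (m := 1) (fun x hx => ?_) (g i₀).2 (g i₁).2 ?_
  · rwa [one_mul, hJ]
  · intro a b hab
    rw [one_mul, one_mul, hJ] at hab
    have h1 : ∑ i, (Pi.single i₀ a + Pi.single i₁ b : _ → S) i • g i = a • g i₀ + b • g i₁ := by
      simp [add_smul, Finset.sum_add_distrib, Pi.single_apply, ite_smul]
    have h2 := mem_maximalIdeal_of_sum_mem hg
      (r := (Pi.single i₀ a + Pi.single i₁ b : _ → S)) (by
        rw [h1, Submodule.mem_smul_top_iff]
        simpa using hab)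
    refine ⟨?_, ?_⟩
    · simpa [hi] using h2 i₀
    · simpa [hi.symm] using h2 i₁

/-- Assume that `(K + 𝔫 ^ 2) / (K + 𝔫 ^ 3)` is one-dimensional and that the multiplication
`𝔫 / (K + 𝔫 ^ 2) × 𝔫 / (K + 𝔫 ^ 2) → (K + 𝔫 ^ 2) / (K + 𝔫 ^ 3)` is nondegenerate, where
`𝔫 / (K + 𝔫 ^ 2)` has dimension at least two. Then `𝔫 ^ 3 ⊆ 𝔫 K`: for `a ∉ K + 𝔫 ^ 2` there are `b`
and `c` such that `a c` vanishes modulo `K + 𝔫 ^ 3` and `b c` does not, and `a (b c) = b (a c)`. -/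
theorem pow_three_le_of_nondegenerate [IsArtinianRing S]
    (hκ : IsCoefficientField κ S) {K : Ideal S} {k : ℕ} {u : Fin k → S}
    (hu : IsMinimalModulo K u) (hk : 2 ≤ k) {φ : S →ₗ[κ] κ} {w : S} (hw : w ∈ maximalIdeal S ^ 2)
    (hφ' : ∀ t ∈ maximalIdeal S ^ 2, t - algebraMap κ S (φ t) * w ∈ K ⊔ maximalIdeal S ^ 3)
    (hnd : ∀ l ∈ maximalIdeal S, (∀ x ∈ maximalIdeal S, l * x ∈ K ⊔ maximalIdeal S ^ 3) →
      l ∈ K ⊔ maximalIdeal S ^ 2) :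
    maximalIdeal S ^ 3 ≤ maximalIdeal S * K := by
  set n := maximalIdeal S with hn
  have hnn : ∀ {x y}, x ∈ n → y ∈ n → x * y ∈ n ^ 2 := fun hx hy => by
    rw [pow_two]; exact Ideal.mul_mem_mul hx hy
  have hK3 : ∀ {x y}, x ∈ n → y ∈ K ⊔ n ^ 3 → x * y ∈ n * K ⊔ n * n ^ 3 := by
    intro x y hx hy
    have := Ideal.mul_mem_mul hx hy
    rwa [Ideal.mul_sup] at this
  have hex : ∀ l ∈ n, l ∉ K ⊔ n ^ 2 → ∃ x ∈ n, φ (l * x) ≠ 0 := by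
    intro l hl hl2
    by_contra! hcon
    refine hl2 (hnd l hl fun x hx => ?_)
    have := hφ' _ (hnn hl hx)
    rwa [hcon x hx, map_zero, zero_mul, sub_zero] at this
  have hsm : ∀ (c : κ) (x : S), φ (algebraMap κ S c * x) = c * φ x := fun c x => by
    rw [← Algebra.smul_def, map_smul, smul_eq_mul]
  have hunit : ∀ {c : κ} {I : Ideal S} {x : S}, c ≠ 0 → algebraMap κ S c * x ∈ I → x ∈ I := by
    intro c I x hc h
    have := I.mul_mem_left (algebraMap κ S c⁻¹) h
    rwa [← mul_assoc, ← map_mul, inv_mul_cancel₀ hc, map_one, one_mul] at this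
  -- As `w` generates `𝔫 ^ 2` modulo `K + 𝔫 ^ 3`, this is sufficient by Nakayama's lemma.
  have hmain : ∀ a ∈ n, a * w ∈ n * K ⊔ n * n ^ 3 := by
    intro a ha
    by_cases ha2 : a ∈ K ⊔ n ^ 2
    · obtain ⟨p, hp, q, hq, rfl⟩ := Submodule.mem_sup.1 ha2
      rw [add_mul]
      refine add_mem (Ideal.mem_sup_left ?_) (Ideal.mem_sup_right ?_)
      · rw [mul_comm p]
        exact Ideal.mul_mem_mul (Ideal.pow_le_self two_ne_zero hw) hp
      · rw [← pow_succ', show 3 + 1 = 2 + 2 from rfl, pow_add]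
        exact Ideal.mul_mem_mul hq hw
    -- an element `b` of `𝔫` that is independent of `a` modulo `K + 𝔫 ^ 2`
    obtain ⟨b, hb, hab⟩ : ∃ b ∈ n, ∀ c : κ, b - algebraMap κ S c * a ∉ K ⊔ n ^ 2 := by
      obtain ⟨r, hr⟩ := hu.exists_sub_sum_mem hκ ha
      obtain ⟨i, hi⟩ : ∃ i, r i ≠ 0 := by
        by_contra! hcon
        rw [Finset.sum_eq_zero fun i _ => by rw [hcon i, map_zero, zero_mul], sub_zero] at hr
        exact ha2 hr
      have : Nontrivial (Fin k) := Fin.nontrivial_iff_two_le.2 hk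
      obtain ⟨j, hj⟩ := exists_ne i
      refine ⟨u j, hu.mem j, fun c hc => ?_⟩
      have h1 : ∑ m, algebraMap κ S ((Pi.single j 1 - c • r : Fin k → κ) m) * u m
          ∈ K ⊔ n ^ 2 := by
        have h2 := add_mem hc (Ideal.mul_mem_left _ (algebraMap κ S c) hr)
        convert! h2 using 1
        simp only [Pi.sub_apply, Pi.smul_apply, smul_eq_mul, map_sub, map_mul, sub_mul,
          Finset.sum_sub_distrib, mul_sub, Finset.mul_sum, mul_assoc]
        rw [Finset.sum_eq_single j (fun m _ hm => by simp [hm]) (by simp)]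
        simp
      have h2 := hu.eq_zero_of_sum_mem h1
      have h3 := congrFun h2 i
      have h4 := congrFun h2 j
      simp only [Pi.sub_apply, Pi.smul_apply, smul_eq_mul, Pi.single_eq_same, Pi.zero_apply,
        Pi.single_eq_of_ne hj.symm, zero_sub, neg_eq_zero, mul_eq_zero, hi, or_false] at h3 h4
      rw [h3, zero_mul, sub_zero] at h4
      exact one_ne_zero h4
    obtain ⟨x, hx, hax⟩ := hex a ha ha2
    set e := φ (b * x) / φ (a * x) with he
    obtain ⟨y, hy, hby⟩ := hex (b - algebraMap κ S e * a)
      (sub_mem hb (n.mul_mem_left _ ha)) (hab e)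
    -- The functionals `φ (a ·)` and `φ (b ·)` are linearly independent, and so there is an element
    -- `c` at which only the first of them vanishes.
    set f := φ (a * y) / φ (a * x) with hf
    set c := y - algebraMap κ S f * x with hc
    have hcn : c ∈ n := sub_mem hy (n.mul_mem_left _ hx)
    have hac : φ (a * c) = 0 := by
      rw [hc, mul_sub, mul_left_comm, map_sub, hsm, hf, div_mul_cancel₀ _ hax, sub_self]
    have hbc : φ (b * c) ≠ 0 := by
      convert! hby using 1
      rw [hc, mul_sub, mul_left_comm, map_sub, hsm, sub_mul, map_sub, mul_assoc, hsm, he, hf]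
      ring
    have h1 : a * c ∈ K ⊔ n ^ 3 := by
      have := hφ' _ (hnn ha hcn)
      rwa [hac, map_zero, zero_mul, sub_zero] at this
    have h2 := hK3 ha (hφ' _ (hnn hb hcn))
    have h3 := sub_mem (hK3 hb h1) h2
    apply hunit hbc
    convert! h3 using 1
    ring
  apply le_of_le_sup_maximalIdeal_mul
  rw [pow_succ', Ideal.mul_le]
  intro a ha t ht
  have h1 := hK3 ha (hφ' t ht)
  have h2 := Ideal.mul_mem_left _ (algebraMap κ S (φ t)) (hmain a ha)
  rw [← pow_succ']
  convert! add_mem h1 h2 using 1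
  ring

end Socle

/-! ### Forms in adapted coordinates -/

section Forms

open MvPolynomial

/-- Modulo `(z)`, the value of a polynomial at `(u, z)` depends only on the part of the polynomial
in the variables that correspond to `u`. -/
theorem aeval_sumElim_sub_mem_span {S : Type u} [CommRing S] {κ : Type*} [Field κ] [Algebra κ S]
    {σ τ : Type*} (u : σ → S) (z : τ → S) (p : MvPolynomial (σ ⊕ τ) κ) :
    aeval (Sum.elim u z) p - aeval u (aeval (Sum.elim X 0 : σ ⊕ τ → MvPolynomial σ κ) p) ∈
      Ideal.span (Set.range z) := by
  rw [← Ideal.Quotient.eq]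
  have h : (Ideal.Quotient.mkₐ κ (Ideal.span (Set.range z))).comp (aeval (Sum.elim u z)) =
      ((Ideal.Quotient.mkₐ κ (Ideal.span (Set.range z))).comp (aeval u)).comp
        (aeval (Sum.elim X 0 : σ ⊕ τ → MvPolynomial σ κ)) := by
    apply MvPolynomial.algHom_ext
    rintro (i | j)
    · simp
    · simp [Ideal.Quotient.eq_zero_iff_mem.2 (Ideal.subset_span (Set.mem_range_self j))]
  exact DFunLike.congr_fun h p

theorem aeval_sumElim_mem_pow {κ : Type*} [Field κ] {σ τ : Type*} {d : ℕ}
    {p : MvPolynomial (σ ⊕ τ) κ} (hp : p ∈ idealOfVars (σ ⊕ τ) κ ^ d) :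
    aeval (Sum.elim X 0 : σ ⊕ τ → MvPolynomial σ κ) p ∈ idealOfVars σ κ ^ d := by
  have h : (idealOfVars (σ ⊕ τ) κ ^ d).map
      (aeval (Sum.elim X 0 : σ ⊕ τ → MvPolynomial σ κ)) ≤ idealOfVars σ κ ^ d := by
    rw [Ideal.map_pow]
    apply Ideal.pow_right_mono
    rw [Ideal.map_span, Ideal.span_le]
    rintro _ ⟨_, ⟨i | j, rfl⟩, rfl⟩
    · simpa using Ideal.subset_span (Set.mem_range_self i)
    · simp
  exact h (Ideal.mem_map_of_mem _ hp)

variable {S : Type u} [CommRing S] [IsLocalRing S] {κ : Type*} [Field κ] [Algebra κ S]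

theorem IsAdaptedSystem.exists_form (hκ : IsCoefficientField κ S) {K : Ideal S} {k s : ℕ}
    {u : Fin k → S} {z : Fin s → S} (h : IsAdaptedSystem K u z) {d : ℕ} {x : S}
    (hx : x ∈ maximalIdeal S ^ d) :
    ∃ F : MvPolynomial (Fin k) κ, F.IsHomogeneous d ∧
      x - aeval u F ∈ Ideal.span (Set.range z) ⊔ maximalIdeal S ^ (d + 1) := by
  obtain ⟨p, hp, hxp⟩ := exists_aeval_sub_mem hκ h.span_eq hx
  refine ⟨homogeneousComponent d (aeval (Sum.elim X 0) p), homogeneousComponent_isHomogeneous _ _,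
    ?_⟩
  have h1 := aeval_sumElim_sub_mem_span u z p
  have h2 := aeval_mem_pow_of_mem h.mem_left
    (sub_homogeneousComponent_mem_pow (aeval_sumElim_mem_pow hp))
  rw [map_sub] at h2
  have h3 := add_mem (Ideal.mem_sup_right (S := Ideal.span (Set.range z)) (add_mem hxp h2))
    (Ideal.mem_sup_left h1)
  convert! h3 using 1
  ring

theorem IsAdaptedSystem.span_le {K : Ideal S} {k s : ℕ} {u : Fin k → S} {z : Fin s → S}
    (h : IsAdaptedSystem K u z) : Ideal.span (Set.range z) ≤ K := by
  rw [Ideal.span_le]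
  rintro _ ⟨j, rfl⟩
  exact h.mem j

/-- If `𝔫 ^ 3 ⊆ K`, then `K` is generated modulo `𝔫 ^ 3` by the linear elements `z` and by
quadratic forms. -/
theorem IsAdaptedSystem.exists_quadratic_form (hκ : IsCoefficientField κ S) {K : Ideal S}
    (hK : K ≤ maximalIdeal S) {k s : ℕ} {u : Fin k → S} (hu : IsMinimalModulo K u)
    {z : Fin s → S} (h : IsAdaptedSystem K u z) (h3 : maximalIdeal S ^ 3 ≤ K) {x : S}
    (hx : x ∈ K) :
    ∃ F : MvPolynomial (Fin k) κ, F.IsHomogeneous 2 ∧ aeval u F ∈ K ∧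
      x - aeval u F ∈ Ideal.span (Set.range z) ⊔ maximalIdeal S ^ 3 := by
  obtain ⟨c, hc, t, ht, rfl⟩ := Submodule.mem_sup.1 (h.le_span hK hu hx)
  obtain ⟨F, hF, hFt⟩ := h.exists_form hκ ht
  have h1 : c + t - aeval u F ∈ Ideal.span (Set.range z) ⊔ maximalIdeal S ^ 3 := by
    rw [add_sub_assoc]
    exact add_mem (Ideal.mem_sup_left hc) hFt
  refine ⟨F, hF, ?_, h1⟩
  have h2 := sub_mem hx (sup_le h.span_le h3 h1)
  rwa [sub_sub_cancel] at h2

/-- The case of two variables of `IsAdaptedSystem.eq_zero_of_isHomogeneous`, in terms of the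
coefficients `p` of the form. -/
theorem IsAdaptedSystem.binary_form_eq_zero [IsArtinianRing S] (hκ : IsCoefficientField κ S)
    {K : Ideal S} {s : ℕ} {u : Fin 2 → S} {z : Fin s → S} (h : IsAdaptedSystem K u z)
    {d t : ℕ} (ht : (t : ℕ∞) ≤ vInv S) (hd : d < t) {p : ℕ → κ}
    (hp : ∑ i ∈ Finset.range (d + 1), algebraMap κ S (p i) * (u 0 ^ (d - i) * u 1 ^ i) ∈
      Ideal.span (Set.range z) ⊔ maximalIdeal S ^ (d + 1)) {i : ℕ} (hi : i ≤ d) : p i = 0 := by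
  classical
  let e : ℕ → (Fin 2 →₀ ℕ) := fun i => Finsupp.single 0 (d - i) + Finsupp.single 1 i
  let F : MvPolynomial (Fin 2) κ := ∑ i ∈ Finset.range (d + 1), monomial (e i) (p i)
  have hF : F.IsHomogeneous d := by
    refine IsHomogeneous.sum _ _ _ fun i hi => isHomogeneous_monomial _ ?_
    have := Finset.mem_range.1 hi
    simp only [e, map_add, Finsupp.degree_single]
    omega
  have hFu : aeval u F =
      ∑ i ∈ Finset.range (d + 1), algebraMap κ S (p i) * (u 0 ^ (d - i) * u 1 ^ i) := by
    rw [map_sum]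
    refine Finset.sum_congr rfl fun i _ => ?_
    rw [aeval_monomial, Finsupp.prod_fintype _ _ (fun _ => pow_zero _), Fin.prod_univ_two]
    simp [e]
  rw [← hFu] at hp
  have h0 := h.eq_zero_of_isHomogeneous hκ ht hd hF hp
  have h1 : coeff (e i) F = p i := by
    rw [coeff_sum, Finset.sum_eq_single i]
    · rw [coeff_monomial, if_pos rfl]
    · intro j _ hj
      rw [coeff_monomial, if_neg]
      intro hij
      exact hj (by simpa [e] using DFunLike.congr_fun hij 1)
    · intro hi'
      exact absurd (Finset.mem_range.2 (by omega)) hi'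
  rw [← h1, h0, coeff_zero]

theorem sup_mul_sup_self_le {S : Type u} [CommRing S] (A B : Ideal S) :
    (A ⊔ B) * (A ⊔ B) ≤ A * A ⊔ B := by
  rw [Ideal.sup_mul, Ideal.mul_sup]
  have h₁ : A * B ≤ B := Ideal.mul_le_right
  have h₂ : B * (A ⊔ B) ≤ B := Ideal.mul_le_left
  exact sup_le (sup_le le_sup_left (le_sup_of_le_right h₁)) (le_sup_of_le_right h₂)

theorem IsAdaptedSystem.exists_binary_quadratic (hκ : IsCoefficientField κ S)
    {K : Ideal S} {s : ℕ} {u : Fin 2 → S} {z : Fin s → S} (h : IsAdaptedSystem K u z) {x : S}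
    (hx : x ∈ maximalIdeal S ^ 2) :
    ∃ a b c : κ, x - (algebraMap κ S a * u 0 ^ 2 + algebraMap κ S b * (u 0 * u 1) +
      algebraMap κ S c * u 1 ^ 2) ∈ Ideal.span (Set.range z) ⊔ maximalIdeal S ^ 3 := by
  have h1 : maximalIdeal S = Ideal.span {u 0, u 1} ⊔ Ideal.span (Set.range z) := by
    rw [← h.span_eq, Set.Sum.elim_range, Ideal.span_union]
    congr 2
    ext y
    simp [eq_comm]
  have h2 : maximalIdeal S ^ 2 ≤ Ideal.span {u 0 * u 0, u 0 * u 1, u 1 * u 0, u 1 * u 1} ⊔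
      Ideal.span (Set.range z) := by
    rw [h1, pow_two, ← Ideal.span_pair_mul_span_pair]
    exact sup_mul_sup_self_le _ _
  obtain ⟨y, hy, w, hw, rfl⟩ := Submodule.mem_sup.1 (h2 hx)
  obtain ⟨r₁, y₁, hy₁, rfl⟩ := Submodule.mem_span_insert.1 hy
  obtain ⟨r₂, y₂, hy₂, rfl⟩ := Submodule.mem_span_insert.1 hy₁
  obtain ⟨r₃, y₃, hy₃, rfl⟩ := Submodule.mem_span_insert.1 hy₂
  obtain ⟨r₄, rfl⟩ := Submodule.mem_span_singleton.1 hy₃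
  obtain ⟨a, ha⟩ := hκ r₁
  obtain ⟨b, hb⟩ := hκ (r₂ + r₃)
  obtain ⟨c, hc⟩ := hκ r₄
  have hmul : ∀ {r x y}, r ∈ maximalIdeal S → x ∈ maximalIdeal S → y ∈ maximalIdeal S →
      r * (x * y) ∈ maximalIdeal S ^ 3 := by
    intro r x y hr hx hy
    rw [pow_succ', pow_two]
    exact Ideal.mul_mem_mul hr (Ideal.mul_mem_mul hx hy)
  refine ⟨a, b, c, ?_⟩
  have h3 := add_mem (Ideal.mem_sup_left hw) (Ideal.mem_sup_right
    (S := Ideal.span (Set.range z)) (add_mem (add_mem (hmul ha (h.mem_left 0) (h.mem_left 0))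
      (hmul hb (h.mem_left 0) (h.mem_left 1))) (hmul hc (h.mem_left 1) (h.mem_left 1))))
  convert! h3 using 1
  simp only [smul_eq_mul]
  ring

/-- If `S / K` has Hilbert function `(1, 2, 2)`, then `K` is generated modulo `𝔫 ^ 3` by the linear
elements `z` and by at most one quadratic form. -/
theorem IsAdaptedSystem.exists_quadric [IsArtinianRing S] (hκ : IsCoefficientField κ S)
    {K : Ideal S} (hK : K ≤ maximalIdeal S) {s : ℕ} {u : Fin 2 → S} (hu : IsMinimalModulo K u)
    {z : Fin s → S} (h : IsAdaptedSystem K u z) (h3 : maximalIdeal S ^ 3 ≤ K)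
    (hdim : 5 ≤ Module.finrank κ (S ⧸ K)) :
    ∃ a b c : κ, ∀ x ∈ K, ∃ e : κ, x - algebraMap κ S e * (algebraMap κ S a * u 0 ^ 2 +
      algebraMap κ S b * (u 0 * u 1) + algebraMap κ S c * u 1 ^ 2) ∈
        Ideal.span (Set.range z) ⊔ maximalIdeal S ^ 3 := by
  have := finite_of_coefficientField hκ
  let f : (κ × κ × κ) →ₗ[κ] S := (LinearMap.toSpanSingleton κ S (u 0 ^ 2)).coprod
    ((LinearMap.toSpanSingleton κ S (u 0 * u 1)).coprod
      (LinearMap.toSpanSingleton κ S (u 1 ^ 2)))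
  have hf : ∀ a b c : κ, f (a, b, c) = algebraMap κ S a * u 0 ^ 2 +
      algebraMap κ S b * (u 0 * u 1) + algebraMap κ S c * u 1 ^ 2 := by
    intro a b c
    simp [f, Algebra.smul_def, add_assoc]
  let g : (κ × κ × κ) →ₗ[κ] S ⧸ K := (Ideal.Quotient.mkₐ κ K).toLinearMap ∘ₗ f
  let p : (S ⧸ K) →ₗ[κ] S ⧸ (K ⊔ maximalIdeal S ^ 2) :=
    (Ideal.Quotient.factorₐ κ le_sup_left).toLinearMap
  have hZ : Ideal.span (Set.range z) ⊔ maximalIdeal S ^ 3 ≤ K := sup_le h.span_le h3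
  have hpg : LinearMap.ker p ≤ LinearMap.range g := by
    intro x hx
    obtain ⟨x, rfl⟩ := Ideal.Quotient.mk_surjective x
    have hx' : x ∈ K ⊔ maximalIdeal S ^ 2 := Ideal.Quotient.eq_zero_iff_mem.1 hx
    obtain ⟨y, hy, t, ht, rfl⟩ := Submodule.mem_sup.1 hx'
    obtain ⟨a, b, c, habc⟩ := h.exists_binary_quadratic hκ ht
    refine ⟨(a, b, c), ?_⟩
    change Ideal.Quotient.mk K (f (a, b, c)) = _
    rw [hf, eq_comm, Ideal.Quotient.eq, add_sub_assoc]
    exact add_mem hy (hZ habc)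
  -- The three-dimensional space of quadratic forms maps onto the two-dimensional `(K + 𝔫 ^ 2) / K`.
  have hker : Module.finrank κ (LinearMap.ker g) ≤ 1 := by
    have h1 := LinearMap.finrank_range_add_finrank_ker g
    have h2 := LinearMap.finrank_range_add_finrank_ker p
    have h3 := Submodule.finrank_mono hpg
    have h4 := (Submodule.finrank_le (LinearMap.range p)).trans_eq
      (finrank_quotient_sup_sq hκ hK hu)
    have h5 : Module.finrank κ (κ × κ × κ) = 3 := by simp
    omega
  obtain ⟨⟨⟨a, b, c⟩, _⟩, hq⟩ := finrank_le_one_iff.1 hker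
  refine ⟨a, b, c, fun x hx => ?_⟩
  obtain ⟨y, hy, t, ht, rfl⟩ := Submodule.mem_sup.1 (h.le_span hK hu hx)
  obtain ⟨a', b', c', h'⟩ := h.exists_binary_quadratic hκ ht
  have hg : (a', b', c') ∈ LinearMap.ker g := by
    change Ideal.Quotient.mk K (f (a', b', c')) = 0
    rw [hf, Ideal.Quotient.eq_zero_iff_mem]
    have h1 := sub_mem (sub_mem hx (h.span_le hy)) (hZ h')
    rwa [add_sub_cancel_left, sub_sub_cancel] at h1
  obtain ⟨e, he⟩ := hq ⟨_, hg⟩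
  have he' : e • (a, b, c) = (a', b', c') := congrArg Subtype.val he
  have h1 := congrArg f he'
  rw [map_smul, hf, hf, Algebra.smul_def] at h1
  refine ⟨e, ?_⟩
  rw [h1, add_sub_assoc]
  exact add_mem (Ideal.mem_sup_left hy) h'

/-- The first splitting theorem applies if `S / (0 :_S J)` has Hilbert function `(1, 2, 2)`. Then
`0 :_S J` is generated modulo `𝔫 ^ 3` by linear elements and at most one quadratic form `q` in two
elements `x` and `y`, and there is a nonzero quadratic form `m` that, unless `q = 0`, has no common
factor with `q`. Then `m x` and `m y` are part of a minimal generating family: no nonzero linear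
multiple of `m` is a linear multiple of `q`. -/
theorem firstSplittingApplies_of_one_two_two (hS : IsArtinianGorensteinLocal S)
    (hκ : IsCoefficientField κ S) {J : Ideal S} (hK : annIdeal J ≤ maximalIdeal S)
    {u : Fin 2 → S} (hu : IsMinimalModulo (annIdeal J) u)
    (h3 : maximalIdeal S ^ 3 ≤ annIdeal J) (hdim : 5 ≤ Module.finrank κ (S ⧸ annIdeal J))
    (hv : ((4 : ℕ) : ℕ∞) ≤ vInv S) : FirstSplittingApplies J := by
  have := hS.isArtinianRing
  have hfin := finite_of_coefficientField hκ
  set n := maximalIdeal S with hn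
  set K := annIdeal J with hKdef
  have hJ : annIdeal K = J := annIdeal_annIdeal hS J
  obtain ⟨s, z, -, hz⟩ := hu.exists_isAdaptedSystem (Z := (K : Set S)) le_rfl hK
    (by rw [Ideal.span_eq]; exact le_sup_left)
  obtain ⟨a, b, c, hq⟩ := hz.exists_quadric hκ hK hu h3 hdim
  have hKZ := hz.le_span hK hu
  set Z := Ideal.span (Set.range z) with hZ
  set A := algebraMap κ S with hA
  have hsq : ∀ i j, u i * u j ∈ n ^ 2 := fun i j => by
    rw [pow_two]
    exact Ideal.mul_mem_mul (hu.mem i) (hu.mem j)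
  -- The elements of `𝔫 K` are congruent to the multiples of the quadratic form by linear forms.
  have hnK : ∀ y ∈ n * K, ∃ γ δ : κ, y - (A γ * u 0 + A δ * u 1) *
      (A a * u 0 ^ 2 + A b * (u 0 * u 1) + A c * u 1 ^ 2) ∈ Z ⊔ n ^ 4 := by
    set q := A a * u 0 ^ 2 + A b * (u 0 * u 1) + A c * u 1 ^ 2 with hqdef
    have hqn : q ∈ n ^ 2 := by
      rw [hqdef, pow_two (u 0), pow_two (u 1)]
      exact add_mem (add_mem (Ideal.mul_mem_left _ _ (hsq 0 0)) (Ideal.mul_mem_left _ _ (hsq 0 1)))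
        (Ideal.mul_mem_left _ _ (hsq 1 1))
    intro y hy
    refine Submodule.mul_induction_on hy ?_ ?_
    · intro r hr x hx
      obtain ⟨d, hd⟩ := hu.exists_sub_sum_mem hκ hr
      obtain ⟨e, he⟩ := hq x hx
      refine ⟨d 0 * e, d 1 * e, ?_⟩
      have h1 := mul_mem_sup_pow he (show r ∈ n ^ 1 by rwa [pow_one])
      have h2 := mul_mem_sup_pow (sup_le hKZ le_sup_right hd) hqn
      rw [Fin.sum_univ_two] at h2
      have h4 := add_mem h1 (Ideal.mul_mem_left _ (A e) h2)
      convert! h4 using 1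
      rw [map_mul, map_mul]
      ring
    · rintro x y ⟨γ, δ, h⟩ ⟨γ', δ', h'⟩
      refine ⟨γ + γ', δ + δ', ?_⟩
      convert! add_mem h h' using 1
      rw [map_add, map_add]
      ring
  -- In terms of the coefficients of `q` and `m`, the hypothesis on `m` says that
  -- `(α x + β y) m = (γ x + δ y) q` is possible only for `α = β = 0`.
  have key : ∀ m₀ m₁ m₂ : κ, (∀ α β γ δ : κ, α * m₀ - γ * a = 0 →
      α * m₁ + β * m₀ - γ * b - δ * a = 0 → α * m₂ + β * m₁ - γ * c - δ * b = 0 →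
      β * m₂ - δ * c = 0 → α = 0 ∧ β = 0) → FirstSplittingApplies J := by
    intro m₀ m₁ m₂ hm
    have hmn : A m₀ * (u 0 * u 0) + A m₁ * (u 0 * u 1) + A m₂ * (u 1 * u 1) ∈ n ^ 2 :=
      add_mem (add_mem (Ideal.mul_mem_left _ _ (hsq 0 0)) (Ideal.mul_mem_left _ _ (hsq 0 1)))
        (Ideal.mul_mem_left _ _ (hsq 1 1))
    refine firstSplittingApplies_of_independent hS
      (m := A m₀ * (u 0 * u 0) + A m₁ * (u 0 * u 1) + A m₂ * (u 1 * u 1)) ?_ (hu.mem 0)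
      (hu.mem 1) ?_
    · intro x hx
      apply h3
      rw [pow_succ]
      exact Ideal.mul_mem_mul hmn hx
    · intro r r' hr
      obtain ⟨α, hα⟩ := hκ r
      obtain ⟨β, hβ⟩ := hκ r'
      obtain ⟨γ, δ, h⟩ := hnK _ hr
      have h4 : ∀ x i, x ∈ n → x * ((A m₀ * (u 0 * u 0) + A m₁ * (u 0 * u 1) +
          A m₂ * (u 1 * u 1)) * u i) ∈ n ^ 4 := by
        intro x i hx
        rw [pow_succ' n 3, pow_succ n 2]
        exact Ideal.mul_mem_mul hx (Ideal.mul_mem_mul hmn (hu.mem i))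
      have h5 := sub_mem h (Ideal.mem_sup_right (S := Z) (add_mem (h4 _ 0 hα) (h4 _ 1 hβ)))
      let p : ℕ → κ := fun i => match i with
        | 0 => α * m₀ - γ * a
        | 1 => α * m₁ + β * m₀ - γ * b - δ * a
        | 2 => α * m₂ + β * m₁ - γ * c - δ * b
        | _ => β * m₂ - δ * c
      have hp : ∑ i ∈ Finset.range (3 + 1), A (p i) * (u 0 ^ (3 - i) * u 1 ^ i) ∈
          Z ⊔ n ^ (3 + 1) := by
        convert! h5 using 1
        simp only [Finset.sum_range_succ, Finset.sum_range_zero, p, map_sub, map_add, map_mul]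
        ring
      have h6 := fun i (hi : i ≤ 3) => hz.binary_form_eq_zero hκ hv (by norm_num) hp hi
      obtain ⟨rfl, rfl⟩ := hm α β γ δ (h6 0 (by norm_num)) (h6 1 (by norm_num))
        (h6 2 (by norm_num)) (h6 3 (by norm_num))
      rw [map_zero, sub_zero] at hα hβ
      exact ⟨hα, hβ⟩
  by_cases ha : a = 0
  · by_cases hc : c = 0
    · refine key 1 0 1 fun α β γ δ e₀ e₁ e₂ e₃ => ⟨?_, ?_⟩
      · simpa [ha] using e₀
      · simpa [hc] using e₃
    · refine key 1 0 0 fun α β γ δ e₀ e₁ e₂ e₃ => ?_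
      have hδ : δ = 0 := by simpa [hc] using e₃
      have hγ : γ = 0 := by simpa [hc, hδ] using e₂
      exact ⟨by simpa [hγ] using e₀, by simpa [hγ, hδ] using e₁⟩
  · refine key 0 0 1 fun α β γ δ e₀ e₁ e₂ e₃ => ?_
    have hγ : γ = 0 := by simpa [ha] using e₀
    have hδ : δ = 0 := by simpa [ha, hγ] using e₁
    exact ⟨by simpa [hγ, hδ] using e₂, by simpa [hγ, hδ] using e₃⟩

end Forms

/-! ### Gorenstein quotients -/

section GorensteinQuotient

/-- A finite-dimensional local algebra over a field is Gorenstein if it has a linear functional `φ`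
such that the bilinear form `(x, y) ↦ φ (x y)` is nondegenerate: the module is then isomorphic to
its dual. -/
theorem isArtinianGorensteinLocal_of_functional {κ : Type*} [Field κ] {R : Type u} [CommRing R]
    [IsLocalRing R] [Algebra κ R] [Module.Finite κ R] (φ : R →ₗ[κ] κ)
    (hφ : ∀ r, r ≠ 0 → ∃ x, φ (r * x) ≠ 0) : IsArtinianGorensteinLocal R := by
  refine ⟨inferInstance, IsArtinianRing.of_finite κ R, Module.Baer.injective fun I g => ?_⟩
  let D : R →ₗ[κ] Module.Dual κ R := (LinearMap.mul κ R).compr₂ φ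
  have hD : Function.Injective D := by
    rw [← LinearMap.ker_eq_bot, LinearMap.ker_eq_bot']
    intro r hr
    by_contra h
    obtain ⟨x, hx⟩ := hφ r h
    exact hx (DFunLike.congr_fun hr x)
  have hD' : Function.Surjective D :=
    (LinearMap.injective_iff_surjective_of_finrank_eq_finrank
      (Subspace.dual_finrank_eq (K := κ) (V := R)).symm).1 hD
  obtain ⟨ψ, hψ⟩ := LinearMap.exists_extend (p := I.restrictScalars κ)
    (φ ∘ₗ (g.restrictScalars κ : I →ₗ[κ] R))
  obtain ⟨r, rfl⟩ := hD' ψ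
  refine ⟨LinearMap.mulLeft R r, fun x hx => ?_⟩
  by_contra hne
  obtain ⟨y, hy⟩ := hφ (r * x - g ⟨x, hx⟩) (sub_ne_zero.2 hne)
  apply hy
  have h1 : φ (r * (x * y)) = φ (g ⟨x * y, I.mul_mem_right y hx⟩) :=
    DFunLike.congr_fun hψ ⟨x * y, I.mul_mem_right y hx⟩
  have h2 : g ⟨x * y, I.mul_mem_right y hx⟩ = g ⟨x, hx⟩ * y := by
    rw [mul_comm (g _) y, ← smul_eq_mul y, ← map_smul]
    exact congrArg g (Subtype.ext (mul_comm x y))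
  rw [sub_mul, map_sub, mul_assoc, h1, h2, sub_self]

theorem isArtinianGorensteinLocal_quotient {κ : Type*} [Field κ] {S : Type u} [CommRing S]
    [IsLocalRing S] [Algebra κ S] [Module.Finite κ S] {K : Ideal S} (hK : K ≠ ⊤) (φ : S →ₗ[κ] κ)
    (hφK : ∀ x ∈ K, φ x = 0) (hφ : ∀ r, r ∉ K → ∃ x, φ (r * x) ≠ 0) :
    IsArtinianGorensteinLocal (S ⧸ K) := by
  have := Ideal.Quotient.nontrivial_iff.2 hK
  have := IsLocalRing.of_surjective' (Ideal.Quotient.mk K) Ideal.Quotient.mk_surjective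
  have : Module.Finite κ (S ⧸ K) :=
    Module.Finite.of_surjective (Ideal.Quotient.mkₐ κ K).toLinearMap Ideal.Quotient.mk_surjective
  refine isArtinianGorensteinLocal_of_functional
    ((K.restrictScalars κ).liftQ φ fun x hx => hφK x hx : (S ⧸ K) →ₗ[κ] κ) fun r hr => ?_
  obtain ⟨r, rfl⟩ := Ideal.Quotient.mk_surjective r
  obtain ⟨x, hx⟩ := hφ r fun h => hr (Ideal.Quotient.eq_zero_iff_mem.2 h)
  exact ⟨Ideal.Quotient.mk K x, hx⟩

end GorensteinQuotient

/-! ### Regular sequences of polynomials -/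

section RegularSequences

open MvPolynomial RingTheory.Sequence

theorem isWeaklyRegular_self_iff {R : Type*} [CommRing R] (rs : List R) :
    IsWeaklyRegular R rs ↔ ∀ i (h : i < rs.length), ∀ f : R,
      rs[i] * f ∈ Ideal.ofList (rs.take i) → f ∈ Ideal.ofList (rs.take i) := by
  rw [isWeaklyRegular_iff]
  refine forall₂_congr fun i h => ?_
  rw [isSMulRegular_quotient_iff_mem_of_smul_mem]
  simp only [smul_eq_mul, Ideal.mul_top]

theorem mem_span_X_sup_map_C {R σ : Type*} [CommRing R] {b : Ideal R} {f : MvPolynomial σ R} :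
    f ∈ Ideal.span (Set.range (X : σ → MvPolynomial σ R)) ⊔ b.map C ↔ constantCoeff f ∈ b := by
  constructor
  · have h : Ideal.span (Set.range (X : σ → MvPolynomial σ R)) ⊔ b.map C ≤
        b.comap constantCoeff := by
      refine sup_le ?_ ?_
      · rw [Ideal.span_le]
        rintro _ ⟨i, rfl⟩
        simp
      · rw [Ideal.map_le_iff_le_comap]
        intro r hr
        simpa using hr
    exact fun hf => h hf
  · intro hf
    rw [← sub_add_cancel f (C (constantCoeff f))]
    refine add_mem (Ideal.mem_sup_left ?_) (Ideal.mem_sup_right (Ideal.mem_map_of_mem _ hf))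
    rw [← Set.image_univ, mem_ideal_span_X_image]
    intro m hm
    by_contra! h
    have hm0 : m = 0 := Finsupp.ext fun i => h i (Set.mem_univ i)
    rw [hm0, mem_support_iff] at hm
    simp [constantCoeff_eq] at hm

/-- The variables followed by a weakly regular sequence of constants form a weakly regular
sequence of polynomials. -/
theorem isWeaklyRegular_X_append {R : Type*} [CommRing R] (s : ℕ) {rs : List R}
    (h : IsWeaklyRegular R rs) :
    IsWeaklyRegular (MvPolynomial (Fin s) R) (List.ofFn (X : Fin s → _) ++ rs.map C) := by
  rw [isWeaklyRegular_self_iff] at h ⊢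
  intro i hi f hf
  rcases lt_or_ge i s with his | his
  · have h1 : Ideal.ofList ((List.ofFn (X : Fin s → MvPolynomial (Fin s) R) ++ rs.map C).take i) =
        Ideal.span (X '' {j : Fin s | (j : ℕ) < i}) := by
      rw [List.take_append_of_le_length (by simpa using his.le)]
      refine congrArg Ideal.span (Set.ext fun p => ?_)
      rw [Set.mem_image]
      change p ∈ List.take i _ ↔ _
      rw [List.mem_take_iff_getElem]
      constructor
      · rintro ⟨j, hj, rfl⟩
        rw [List.getElem_ofFn]
        exact ⟨⟨j, _⟩, (lt_min_iff.1 hj).1, rfl⟩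
      · rintro ⟨j, hj, rfl⟩
        exact ⟨j, lt_min hj (by simp), List.getElem_ofFn _⟩
    rw [h1] at hf ⊢
    rw [List.getElem_append_left (by simpa using his), List.getElem_ofFn] at hf
    rw [mem_ideal_span_X_image] at hf ⊢
    intro m hm
    obtain ⟨j, hj, hmj⟩ := hf (Finsupp.single ⟨i, his⟩ 1 + m) (by
      rwa [mem_support_iff, coeff_X_mul, ← mem_support_iff])
    refine ⟨j, hj, ?_⟩
    have hij : (⟨i, his⟩ : Fin s) ≠ j := by
      rintro rfl
      exact lt_irrefl i hj
    simpa [Finsupp.single_apply, hij] using hmj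
  · obtain ⟨j, rfl⟩ := Nat.exists_eq_add_of_le his
    have hj : j < rs.length := by
      rw [List.length_append, List.length_ofFn, List.length_map] at hi
      omega
    have h1 : Ideal.ofList ((List.ofFn (X : Fin s → MvPolynomial (Fin s) R) ++
        rs.map C).take (s + j)) =
          Ideal.span (Set.range X) ⊔ (Ideal.ofList (rs.take j)).map C := by
      rw [List.take_append, List.take_of_length_le (by simp), Ideal.ofList_append,
        Ideal.map_ofList, List.map_take]
      congr 2
      · refine congrArg Ideal.span (Set.ext fun p => ?_)
        exact List.mem_ofFn' _ _
      · simp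
    rw [h1, mem_span_X_sup_map_C] at hf ⊢
    rw [List.getElem_append_right (by simp), List.getElem_map, map_mul, constantCoeff_C] at hf
    refine h j hj _ ?_
    simpa using hf

end RegularSequences

/-! ### The second splitting theorem -/

section Second

open MvPolynomial RingTheory.Sequence

theorem sup_pow_le_sup_sq {R : Type*} [CommRing R] (Z U : Ideal R) (t : ℕ) :
    (Z ⊔ U) ^ (t + 1) ≤ Z ^ 2 ⊔ Z * U ^ t ⊔ U ^ (t + 1) := by
  induction t with
  | zero =>
    rw [pow_zero, Ideal.one_eq_top, Ideal.mul_top, zero_add, pow_one, pow_one]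
    exact sup_le_sup_right le_sup_right _
  | succ t ih =>
    rw [pow_succ]
    refine (Ideal.mul_mono_left ih).trans ?_
    have h₁ : Z ^ 2 * (Z ⊔ U) ≤ Z ^ 2 := Ideal.mul_le_left
    have h₂ : Z * U ^ t * Z ≤ Z ^ 2 := by
      rw [mul_right_comm, ← pow_two]
      exact Ideal.mul_le_left
    have h₃ : U ^ (t + 1) * Z = Z * U ^ (t + 1) := mul_comm _ _
    rw [Ideal.sup_mul, Ideal.sup_mul]
    refine sup_le (sup_le (h₁.trans (le_sup_left.trans le_sup_left)) ?_) ?_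
    · rw [Ideal.mul_sup, mul_assoc Z (U ^ t) U, ← pow_succ]
      exact sup_le (h₂.trans (le_sup_left.trans le_sup_left)) (le_sup_right.trans le_sup_left)
    · rw [Ideal.mul_sup, h₃, ← pow_succ]
      exact sup_le (le_sup_right.trans le_sup_left) le_sup_right

theorem comap_eq_colon {S : Type u} [CommRing S] (hS : IsArtinianGorensteinLocal S) {J : Ideal S}
    {P : Type*} [CommRing P] {π : P →+* S} (hπ : Function.Surjective π) {B : Ideal P}
    (hB : B.map π = annIdeal J) : J.comap π = (RingHom.ker π).colon (B : Set P) := by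
  ext p
  rw [Submodule.mem_colon, Ideal.mem_comap, ← annIdeal_annIdeal hS J, annIdeal_def, ← hB]
  constructor
  · intro hp q hq
    rw [smul_eq_mul, RingHom.mem_ker, map_mul]
    exact hp _ (Ideal.mem_map_of_mem π hq)
  · intro hp y hy
    obtain ⟨q, hq, rfl⟩ := (Ideal.mem_map_iff_of_surjective π hπ).1 hy
    have h1 := hp q hq
    rwa [smul_eq_mul, RingHom.mem_ker, map_mul] at h1

/-- The second splitting theorem applies if `S` is a quotient of `P` such that `0 :_S J` is the
image of an ideal `B` that is generated by a regular sequence and whose square contains the kernel: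
then `J` is the image of the colon ideal of the kernel by `B`. -/
theorem secondSplittingApplies_of_surjective {S : Type u} [CommRing S] [IsLocalRing S]
    (hS : IsArtinianGorensteinLocal S) {J : Ideal S} (hK : annIdeal J ≤ maximalIdeal S)
    (hG : IsArtinianGorensteinLocal (S ⧸ annIdeal J)) {P : Type u} [CommRing P] [IsNoetherianRing P]
    {π : P →+* S} (hπ : Function.Surjective π) {B : Ideal P} (hBmap : B.map π = annIdeal J)
    (hA : RingHom.ker π ≤ B ^ 2) {rs : List P} (hrs : IsWeaklyRegular P rs)
    (hlen : 2 ≤ rs.length) (hlist : Ideal.ofList rs = B) : SecondSplittingApplies J := by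
  have hB : (annIdeal J).comap π = B := by
    rw [← hBmap, Ideal.comap_map_of_surjective π hπ, sup_eq_left, ← RingHom.ker_eq_comap_bot]
    exact hA.trans (Ideal.pow_le_self two_ne_zero)
  have hBker : RingHom.ker ((Ideal.Quotient.mk (annIdeal J)).comp π) = B := by
    rw [← hB, ← RingHom.comap_ker, Ideal.mk_ker]
  refine ⟨P, inferInstance, RingHom.ker π, B, π, hπ, rfl,
    ⟨inferInstance, hA, ?_, ?_, rs, ⟨hrs, ?_⟩, hlen, hlist⟩, ?_⟩
  · exact hS.of_ringEquiv (RingHom.quotientKerEquivOfSurjective hπ).symm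
  · rw [← hBker]
    exact hG.of_ringEquiv (RingHom.quotientKerEquivOfSurjective
      (f := (Ideal.Quotient.mk (annIdeal J)).comp π)
      (Ideal.Quotient.mk_surjective.comp hπ)).symm
  · rw [hlist, smul_eq_mul, Ideal.mul_top]
    intro htop
    have h1 : annIdeal J = ⊤ := by rw [← hBmap, ← htop, Ideal.map_top]
    exact (maximalIdeal.isMaximal S).ne_top (top_le_iff.1 (h1 ▸ hK))
  · exact comap_eq_colon hS hπ hBmap

variable {S : Type u} [CommRing S] [IsLocalRing S] {κ : Type u} [Field κ] [Algebra κ S]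

/-- The second splitting theorem applies if `0 :_S J` is generated by a part `z` of a minimal system
of generators of `𝔫` and by the values of a weakly regular sequence of polynomials in the remaining
generators `u`, and the square of the ideal of that sequence contains a power of the variables with
exponent at most `v(S)`. The ring `P` of the theorem is the polynomial ring over `κ` in the
variables that correspond to `z` and `u`. -/
theorem secondSplittingApplies_of_regular (hS : IsArtinianGorensteinLocal S)
    (hκ : IsCoefficientField κ S) {J : Ideal S} (hK : annIdeal J ≤ maximalIdeal S) {k s : ℕ}
    {u : Fin k → S} {z : Fin s → S} (h : IsAdaptedSystem (annIdeal J) u z)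
    {rs : List (MvPolynomial (Fin k) κ)} (hrs : IsWeaklyRegular (MvPolynomial (Fin k) κ) rs)
    (hlen : 2 ≤ s + rs.length) (hmem : ∀ r ∈ rs, aeval u r ∈ annIdeal J)
    (hspan : annIdeal J ≤ (Ideal.ofList rs).map (aeval u) ⊔ Ideal.span (Set.range z)) {t : ℕ}
    (ht : ((t + 1 : ℕ) : ℕ∞) ≤ vInv S)
    (hsq : idealOfVars (Fin k) κ ^ (t + 1) ≤ Ideal.ofList rs ^ 2)
    (hpow : idealOfVars (Fin k) κ ^ t ≤ Ideal.ofList rs)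
    (hG : IsArtinianGorensteinLocal (S ⧸ annIdeal J)) : SecondSplittingApplies J := by
  have := hS.isArtinianRing
  have hspan' : Ideal.span (Set.range (Sum.elim z u)) = maximalIdeal S := by
    rw [← h.span_eq, Set.Sum.elim_range, Set.Sum.elim_range, Set.union_comm]
  let e := sumAlgEquiv κ (Fin s) (Fin k)
  let π : MvPolynomial (Fin s) (MvPolynomial (Fin k) κ) →ₐ[κ] S :=
    (aeval (Sum.elim z u)).comp e.symm.toAlgHom
  have hπ : Function.Surjective π := (aeval_surjective hκ hspan').comp e.symm.surjective
  have hX : ∀ j, π (X j) = z j := fun j => by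
    change aeval (Sum.elim z u) ((sumAlgEquiv κ (Fin s) (Fin k)).symm (X j)) = z j
    rw [sumAlgEquiv_symm_X, aeval_X, Sum.elim_inl]
  have hC : ∀ r, π (C r) = aeval u r := fun r => by
    have h1 : π.comp (IsScalarTower.toAlgHom κ (MvPolynomial (Fin k) κ)
        (MvPolynomial (Fin s) (MvPolynomial (Fin k) κ))) = aeval u := by
      refine MvPolynomial.algHom_ext fun i => ?_
      change aeval (Sum.elim z u) ((sumAlgEquiv κ (Fin s) (Fin k)).symm (C (X i))) = aeval u (X i)
      rw [← sumAlgEquiv_X_inr, AlgEquiv.symm_apply_apply, aeval_X, aeval_X, Sum.elim_inr]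
    exact DFunLike.congr_fun h1 r
  set b := Ideal.ofList rs with hb
  let Z : Ideal (MvPolynomial (Fin s) (MvPolynomial (Fin k) κ)) := Ideal.span (Set.range X)
  let B : Ideal (MvPolynomial (Fin s) (MvPolynomial (Fin k) κ)) := Z ⊔ b.map C
  have hBmap : B.map π.toRingHom = annIdeal J := by
    have hC' : π.toRingHom.comp C = (aeval u : MvPolynomial (Fin k) κ →ₐ[κ] S).toRingHom :=
      RingHom.ext hC
    apply le_antisymm
    · rw [Ideal.map_le_iff_le_comap]
      refine sup_le ?_ ?_
      · rw [Ideal.span_le]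
        rintro _ ⟨j, rfl⟩
        change π (X j) ∈ annIdeal J
        rw [hX]
        exact h.mem j
      · rw [Ideal.map_le_iff_le_comap, hb, Ideal.span_le]
        intro r hr
        change π (C r) ∈ annIdeal J
        rw [hC]
        exact hmem r hr
    · refine hspan.trans (sup_le ?_ ?_)
      · rw [Ideal.map_le_iff_le_comap]
        intro r hr
        change aeval u r ∈ B.map π.toRingHom
        rw [← hC]
        exact Ideal.mem_map_of_mem π.toRingHom (Ideal.mem_sup_right (Ideal.mem_map_of_mem C hr))
      · rw [Ideal.span_le]
        rintro _ ⟨j, rfl⟩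
        change z j ∈ B.map π.toRingHom
        rw [← hX]
        exact Ideal.mem_map_of_mem π.toRingHom
          (Ideal.mem_sup_left (Ideal.subset_span (Set.mem_range_self j)))
  -- The kernel has order at least `t + 1`. With `U` the ideal of the variables that correspond to
  -- `u`, this is used in the form `(Z + U) ^ (t + 1) ⊆ Z ^ 2 + Z U ^ t + U ^ (t + 1) ⊆ B ^ 2`.
  have hA : RingHom.ker π.toRingHom ≤ B ^ 2 := by
    intro p hp
    have hp' : e.symm p ∈ idealOfVars (Fin s ⊕ Fin k) κ ^ (t + 1) :=
      ker_aeval_le_pow hspan' (by simpa [add_comm] using h.card) ht hp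
    let f : MvPolynomial (Fin s ⊕ Fin k) κ →+* MvPolynomial (Fin s) (MvPolynomial (Fin k) κ) :=
      RingHomClass.toRingHom e
    have hvars : (idealOfVars (Fin s ⊕ Fin k) κ).map f ≤
        Z ⊔ (idealOfVars (Fin k) κ).map C := by
      rw [idealOfVars, Ideal.map_span, Ideal.span_le]
      rintro _ ⟨_, ⟨i | j, rfl⟩, rfl⟩
      · have h1 : f (X (Sum.inl i)) = X i := sumAlgEquiv_X_inl κ (Fin s) (Fin k) i
        rw [h1]
        exact Ideal.mem_sup_left (Ideal.subset_span (Set.mem_range_self i))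
      · have h1 : f (X (Sum.inr j)) = C (X j) := sumAlgEquiv_X_inr κ (Fin s) (Fin k) j
        rw [h1]
        exact Ideal.mem_sup_right
          (Ideal.mem_map_of_mem C (Ideal.subset_span (Set.mem_range_self j)))
    have h1 := Ideal.mem_map_of_mem f hp'
    rw [Ideal.map_pow] at h1
    have h2 : f (e.symm p) = p := e.apply_symm_apply p
    rw [h2] at h1
    have h3 := sup_pow_le_sup_sq _ _ t (Ideal.pow_right_mono hvars (t + 1) h1)
    have h4 : Z ^ 2 ⊔ Z * (idealOfVars (Fin k) κ).map C ^ t ⊔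
        (idealOfVars (Fin k) κ).map C ^ (t + 1) ≤ B ^ 2 := by
      refine sup_le (sup_le ?_ ?_) ?_
      · exact Ideal.pow_right_mono le_sup_left 2
      · rw [← Ideal.map_pow, pow_two]
        exact Ideal.mul_mono le_sup_left ((Ideal.map_mono hpow).trans le_sup_right)
      · rw [← Ideal.map_pow]
        refine (Ideal.map_mono hsq).trans ?_
        rw [Ideal.map_pow]
        exact Ideal.pow_right_mono le_sup_right 2
    exact h4 h3
  have hlist : Ideal.ofList (List.ofFn (X : Fin s → _) ++ rs.map C) = B := by
    rw [Ideal.ofList_append, ← Ideal.map_ofList]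
    exact congrArg (· ⊔ _) (congrArg Ideal.span (Set.ext fun p => List.mem_ofFn' _ _))
  exact secondSplittingApplies_of_surjective hS hK hG hπ hBmap hA (isWeaklyRegular_X_append s hrs)
    (by simpa using hlen) hlist

end Second

/-! ### Quotients of embedding dimension one -/

section EmbeddingDimensionOne

open MvPolynomial RingTheory.Sequence

variable {S : Type u} [CommRing S] [IsLocalRing S] {κ : Type u} [Field κ] [Algebra κ S]

theorem exists_sub_sum_pow_mem (hκ : IsCoefficientField κ S) {I : Ideal S} {x : S}
    (hx : maximalIdeal S ≤ Ideal.span {x} ⊔ I) (i : ℕ) (r : S) :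
    ∃ a : Fin i → κ, r - ∑ j, algebraMap κ S (a j) * x ^ (j : ℕ) ∈ Ideal.span {x ^ i} ⊔ I := by
  induction i with
  | zero => exact ⟨0, by simp⟩
  | succ i ih =>
    obtain ⟨a, ha⟩ := ih
    obtain ⟨b, y, hy, hb⟩ := Ideal.mem_span_singleton_sup.1 ha
    obtain ⟨c, hc⟩ := hκ b
    obtain ⟨b', y', hy', hb'⟩ := Ideal.mem_span_singleton_sup.1 (hx hc)
    refine ⟨Fin.snoc a c, Ideal.mem_span_singleton_sup.2
      ⟨b', y' * x ^ i + y, add_mem (I.mul_mem_right _ hy') hy, ?_⟩⟩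
    rw [Fin.sum_univ_castSucc]
    simp only [Fin.snoc_castSucc, Fin.snoc_last, Fin.val_castSucc, Fin.val_last]
    rw [← sub_sub, ← hb, pow_succ]
    linear_combination x ^ i * hb'

theorem finrank_le_of_pow_mem [IsArtinianRing S] (hκ : IsCoefficientField κ S) {I : Ideal S}
    {x : S} (hx : maximalIdeal S ≤ Ideal.span {x} ⊔ I) {i : ℕ} (hi : x ^ i ∈ I) :
    Module.finrank κ (S ⧸ I) ≤ i := by
  let g : (Fin i → κ) →ₗ[κ] S ⧸ I :=
    Fintype.linearCombination κ fun j : Fin i => Ideal.Quotient.mk I (x ^ (j : ℕ))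
  have hg : Function.Surjective g := by
    intro r
    obtain ⟨r, rfl⟩ := Ideal.Quotient.mk_surjective r
    obtain ⟨a, ha⟩ := exists_sub_sum_pow_mem hκ hx i r
    have hle : Ideal.span {x ^ i} ⊔ I ≤ I :=
      sup_le ((Ideal.span_singleton_le_iff_mem I).2 hi) le_rfl
    refine ⟨a, ?_⟩
    rw [Ideal.Quotient.eq.2 (hle ha), Fintype.linearCombination_apply, map_sum]
    refine Finset.sum_congr rfl fun j _ => ?_
    rw [map_mul, Algebra.smul_def]
    rfl
  simpa using LinearMap.finrank_le_finrank_of_surjective hg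

/-- If `𝔫` is generated by `x` modulo `I`, then every element outside of `I` divides the highest
power of `x` modulo `I`. -/
theorem exists_mul_sub_pow_mem {I : Ideal S} {x : S} (hx : maximalIdeal S ≤ Ideal.span {x} ⊔ I)
    {c : ℕ} (hc : x ^ (c + 1) ∈ I) {r : S} (hr : r ∉ I) : ∃ y, r * y - x ^ c ∈ I := by
  have key : ∀ j ≤ c + 1, r ∈ Ideal.span {x ^ (c + 1 - j)} ⊔ I → ∃ y, r * y - x ^ c ∈ I := by
    intro j
    induction j with
    | zero =>
      intro _ h
      exact absurd (sup_le ((Ideal.span_singleton_le_iff_mem I).2 hc) le_rfl h) hr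
    | succ j ih =>
      intro hj h
      obtain ⟨a, y, hy, hay⟩ := Ideal.mem_span_singleton_sup.1 h
      by_cases ha : IsUnit a
      · obtain ⟨b, hb⟩ := ha.exists_left_inv
        refine ⟨b * x ^ j, ?_⟩
        have h1 : x ^ (c + 1 - (j + 1)) * x ^ j = x ^ c := by
          rw [← pow_add]
          congr 1
          omega
        have h2 : r * (b * x ^ j) - x ^ c = b * x ^ j * y := by
          rw [← hay, ← h1]
          linear_combination x ^ (c + 1 - (j + 1)) * x ^ j * hb
        rw [h2]
        exact I.mul_mem_left _ hy
      · obtain ⟨a', y', hy', hay'⟩ :=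
          Ideal.mem_span_singleton_sup.1 (hx ((mem_maximalIdeal a).2 ha))
        refine ih (by omega) (Ideal.mem_span_singleton_sup.2
          ⟨a', y' * x ^ (c + 1 - (j + 1)) + y, add_mem (I.mul_mem_right _ hy') hy, ?_⟩)
        have h1 : x ^ (c + 1 - j) = x * x ^ (c + 1 - (j + 1)) := by
          rw [← pow_succ']
          congr 1
          omega
        rw [h1, ← hay, ← hay']
        ring
  exact key (c + 1) le_rfl (by simp)

/-- The second splitting theorem applies if `𝔫 / (0 :_S J)` is generated by one element `x`. Then
`0 :_S J` is generated by a power of `x` and by a part of a minimal system of generators of `𝔫`. -/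
theorem secondSplittingApplies_of_one (hS : IsArtinianGorensteinLocal S)
    (he : 2 ≤ embeddingDim S) (hκ : IsCoefficientField κ S) {J : Ideal S}
    (hK : annIdeal J ≤ maximalIdeal S) {u : Fin 1 → S} (hu : IsMinimalModulo (annIdeal J) u)
    (hv : ((2 * Module.finrank κ (S ⧸ annIdeal J) : ℕ) : ℕ∞) ≤ vInv S) :
    SecondSplittingApplies J := by
  have := hS.isArtinianRing
  have hfin := finite_of_coefficientField hκ
  set K := annIdeal J with hKdef
  have hrange : Set.range u = {u 0} := Set.range_unique
  have hx : maximalIdeal S ≤ Ideal.span {u 0} ⊔ K := hrange ▸ hu.le_span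
  have hcK : u 0 ^ Module.finrank κ (S ⧸ K) ∈ K :=
    pow_finrank_le K (Ideal.pow_mem_pow (hu.mem 0) _)
  have hK1 : (1 : S) ∉ K := fun h => (Ideal.ne_top_iff_one _).1
    (maximalIdeal.isMaximal S).ne_top (hK h)
  obtain ⟨c, hc⟩ : ∃ c, Module.finrank κ (S ⧸ K) = c + 1 := by
    refine Nat.exists_eq_succ_of_ne_zero fun h => hK1 ?_
    rwa [h, pow_zero] at hcK
  rw [hc] at hcK hv
  have hcK' : u 0 ^ c ∉ K := fun h => by
    have := finrank_le_of_pow_mem hκ hx h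
    omega
  obtain ⟨s, z, -, hz⟩ := hu.exists_isAdaptedSystem (Z := (K : Set S)) le_rfl hK
    (by rw [Ideal.span_eq]; exact le_sup_left)
  -- With `c + 1` the dimension of `S / K`, the ideal `K` is generated by `x ^ (c + 1)` and `z`.
  have hvars : idealOfVars (Fin 1) κ = Ideal.span {X 0} := by
    rw [idealOfVars, Set.range_unique]
    rfl
  have hlist : Ideal.ofList [(X 0 : MvPolynomial (Fin 1) κ) ^ (c + 1)] =
      Ideal.span {X 0 ^ (c + 1)} := Ideal.ofList_singleton _
  refine secondSplittingApplies_of_regular hS hκ hK hz (rs := [X 0 ^ (c + 1)])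
    (t := 2 * c + 1) ?_ ?_ ?_ ?_ ?_ ?_ ?_ ?_
  · rw [isWeaklyRegular_self_iff]
    intro i hi f hf
    obtain rfl : i = 0 := by simpa using hi
    have hf' : X 0 ^ (c + 1) * f = 0 := by simpa using hf
    rcases mul_eq_zero.1 hf' with h | h
    · exact absurd h (pow_ne_zero _ (X_ne_zero 0))
    · simp [h]
  · have := hz.card
    rw [List.length_singleton]
    omega
  · intro r hr
    rw [List.mem_singleton.1 hr, map_pow, aeval_X]
    exact hcK
  · -- An element of `K` outside of the right-hand side would divide `x ^ c` modulo `K`.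
    rw [hlist, Ideal.map_span, Set.image_singleton, map_pow, aeval_X]
    intro r hr
    by_contra h
    have hle : Ideal.span {u 0 ^ (c + 1)} ⊔ Ideal.span (Set.range z) ≤ K :=
      sup_le ((Ideal.span_singleton_le_iff_mem K).2 hcK) hz.span_le
    have hx' : maximalIdeal S ≤ Ideal.span {u 0} ⊔
        (Ideal.span {u 0 ^ (c + 1)} ⊔ Ideal.span (Set.range z)) := by
      rw [← hz.span_eq, Set.Sum.elim_range, Ideal.span_union, hrange]
      exact sup_le_sup_left le_sup_right _
    obtain ⟨y, hy⟩ := exists_mul_sub_pow_mem hx'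
      (Ideal.mem_sup_left (Ideal.mem_span_singleton_self _)) h
    have h1 := sub_mem (K.mul_mem_right y hr) (hle hy)
    rw [sub_sub_cancel] at h1
    exact hcK' h1
  · convert! hv using 2
  · rw [hlist, hvars, Ideal.span_singleton_pow, Ideal.span_singleton_pow, ← pow_mul]
    exact (Ideal.span_singleton_le_span_singleton).2 (pow_dvd_pow _ (by omega))
  · rw [hlist, hvars, Ideal.span_singleton_pow]
    exact (Ideal.span_singleton_le_span_singleton).2 (pow_dvd_pow _ (by omega))
  · -- A functional that does not vanish at the highest power of `x` is nondegenerate.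
    obtain ⟨φ, hφ, hφK⟩ := Submodule.exists_le_ker_of_notMem (p := K.restrictScalars κ)
      (v := u 0 ^ c) hcK'
    refine isArtinianGorensteinLocal_quotient (fun h => hK1 ((Ideal.eq_top_iff_one K).1 h)) φ
      (fun x hx => hφK hx) fun r hr => ?_
    obtain ⟨y, hy⟩ := exists_mul_sub_pow_mem hx hcK hr
    refine ⟨y, fun h => hφ ?_⟩
    have h1 : φ (r * y - u 0 ^ c) = 0 := hφK hy
    rwa [map_sub, h, zero_sub, neg_eq_zero] at h1

end EmbeddingDimensionOne

/-! ### Quotients with Hilbert function `(1, 2, 1)` -/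

section OneTwoOne

open MvPolynomial RingTheory.Sequence

theorem span_pair_pow_three_le {R : Type*} [CommRing R] {x y : R} {I : Ideal R}
    (h₀ : x ^ 3 ∈ I) (h₁ : x ^ 2 * y ∈ I) (h₂ : x * y ^ 2 ∈ I) (h₃ : y ^ 3 ∈ I) :
    Ideal.span {x, y} ^ 3 ≤ I := by
  rw [pow_succ, pow_two, Ideal.span_pair_mul_span_pair, Ideal.span_mul_span', Ideal.span_le]
  rintro _ ⟨a, ha, b, hb, rfl⟩
  simp only [Set.mem_insert_iff, Set.mem_singleton_iff] at ha hb
  rcases ha with rfl | rfl | rfl | rfl <;> rcases hb with rfl | rfl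
  · convert! h₀ using 1; ring
  · convert! h₁ using 1; ring
  · convert! h₁ using 1; ring
  · convert! h₂ using 1; ring
  · convert! h₁ using 1; ring
  · convert! h₂ using 1; ring
  · convert! h₂ using 1; ring
  · convert! h₃ using 1; ring

theorem idealOfVars_fin_two {κ : Type*} [Field κ] :
    idealOfVars (Fin 2) κ = Ideal.span {X 0, X 1} := by
  rw [idealOfVars]
  congr 1
  ext p
  simp [eq_comm]

theorem isWeaklyRegular_pair {R : Type*} [CommRing R] [IsDomain R] {q₁ q₂ : R} (h₁ : q₁ ≠ 0)
    (h : ∀ f, q₁ ∣ q₂ * f → q₁ ∣ f) : IsWeaklyRegular R [q₁, q₂] := by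
  rw [isWeaklyRegular_self_iff]
  intro i hi f hf
  obtain rfl | rfl : i = 0 ∨ i = 1 := by
    have : i < 2 := hi
    omega
  · have hf' : q₁ * f = 0 := by simpa using hf
    rcases mul_eq_zero.1 hf' with h0 | h0
    · exact absurd h0 h₁
    · simp [h0]
  · have hlist : Ideal.ofList (List.take 1 [q₁, q₂]) = Ideal.span {q₁} := Ideal.ofList_singleton _
    rw [hlist, Ideal.mem_span_singleton] at hf ⊢
    exact h f hf

theorem isWeaklyRegular_mul_sub {κ : Type*} [Field κ] {c : κ} (hc : c ≠ 0) :
    IsWeaklyRegular (MvPolynomial (Fin 2) κ)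
      [(X 0 * X 1 : MvPolynomial (Fin 2) κ), X 1 ^ 2 - C c * X 0 ^ 2] := by
  have h0 : ¬ (X 0 : MvPolynomial (Fin 2) κ) ∣ X 1 ^ 2 - C c * X 0 ^ 2 := by
    rintro ⟨g, hg⟩
    have := congrArg (eval ![0, 1]) hg
    simp at this
  have h1 : ¬ (X 1 : MvPolynomial (Fin 2) κ) ∣ X 1 ^ 2 - C c * X 0 ^ 2 := by
    rintro ⟨g, hg⟩
    have := congrArg (eval ![1, 0]) hg
    simp [hc] at this
  have h10 : ¬ (X 1 : MvPolynomial (Fin 2) κ) ∣ X 0 := by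
    rintro ⟨g, hg⟩
    have := congrArg (eval ![1, 0]) hg
    simp at this
  refine isWeaklyRegular_pair (mul_ne_zero (X_ne_zero 0) (X_ne_zero 1)) fun f hf => ?_
  obtain ⟨g, rfl⟩ := ((X_prime (i := 0)).dvd_or_dvd ((dvd_mul_right _ _).trans hf)).resolve_left h0
  have h2 := ((X_prime (i := 1)).dvd_or_dvd ((dvd_mul_left _ _).trans hf)).resolve_left h1
  exact mul_dvd_mul_left _ (((X_prime (i := 1)).dvd_or_dvd h2).resolve_left h10)

theorem isWeaklyRegular_sq_sq {κ : Type*} [Field κ] :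
    IsWeaklyRegular (MvPolynomial (Fin 2) κ) [(X 0 ^ 2 : MvPolynomial (Fin 2) κ), X 1 ^ 2] := by
  have h01 : ¬ (X 0 : MvPolynomial (Fin 2) κ) ∣ X 1 ^ 2 := by
    rintro ⟨g, hg⟩
    have := congrArg (eval ![0, 1]) hg
    simp at this
  exact isWeaklyRegular_pair (pow_ne_zero _ (X_ne_zero 0))
    fun f hf => (X_prime (i := 0)).pow_dvd_of_dvd_mul_left 2 h01 hf

variable {S : Type u} [CommRing S] [IsLocalRing S]

/-- Every element of `𝔫` outside of `K + 𝔫 ^ 2` is the first of two minimal generators of `𝔫`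
modulo `K`, if two are needed. -/
theorem IsMinimalModulo.exists_complement [IsNoetherianRing S] {κ : Type*} [Field κ] [Algebra κ S]
    (hκ : IsCoefficientField κ S) {K : Ideal S} (hk : minGeneratorsMaxMod K = 2) {u : Fin 2 → S}
    (hu : IsMinimalModulo K u) {l : S} (hl : l ∈ maximalIdeal S)
    (hl2 : l ∉ K ⊔ maximalIdeal S ^ 2) : ∃ l', IsMinimalModulo K ![l, l'] := by
  have key : ∀ i j : Fin 2, i ≠ j → ∀ a b : κ, a ≠ 0 →
      l - (algebraMap κ S a * u i + algebraMap κ S b * u j) ∈ K ⊔ maximalIdeal S ^ 2 →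
      ∃ l', IsMinimalModulo K ![l, l'] := by
    intro i j hij a b ha hab
    refine ⟨u j, isMinimalModulo_of_le_span hk ?_ ?_⟩
    · intro m
      fin_cases m
      · exact hl
      · exact hu.mem j
    · rw [Matrix.range_cons_cons_empty]
      set I := Ideal.span {l, u j} ⊔ K with hI
      have hjI : u j ∈ I := Ideal.mem_sup_left (Ideal.subset_span (by simp))
      have hlI : l ∈ I := Ideal.mem_sup_left (Ideal.subset_span (by simp))
      have hKI : K ⊔ maximalIdeal S ^ 2 ≤ I ⊔ maximalIdeal S ^ 2 :=
        sup_le_sup_right le_sup_right _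
      have hiI : u i ∈ I ⊔ maximalIdeal S ^ 2 := by
        have h1 : algebraMap κ S a * u i ∈ I ⊔ maximalIdeal S ^ 2 := by
          have h2 := sub_mem (sub_mem (Ideal.mem_sup_left hlI) (hKI hab))
            (Ideal.mem_sup_left (I.mul_mem_left (algebraMap κ S b) hjI))
          convert! h2 using 1
          ring
        have h3 := Ideal.mul_mem_left _ (algebraMap κ S a⁻¹) h1
        rwa [← mul_assoc, ← map_mul, inv_mul_cancel₀ ha, map_one, one_mul] at h3
      have hall : ∀ m, u m ∈ I ⊔ maximalIdeal S ^ 2 := by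
        intro m
        by_cases hm : m = i
        · exact hm ▸ hiI
        · have : m = j := by omega
          exact this ▸ Ideal.mem_sup_left hjI
      apply le_of_le_sup_maximalIdeal_mul
      rw [← pow_two]
      refine hu.le_span.trans (sup_le ?_ (le_sup_right.trans le_sup_left))
      rw [Ideal.span_le]
      rintro _ ⟨m, rfl⟩
      exact hall m
  obtain ⟨a, ha⟩ := hu.exists_sub_sum_mem hκ hl
  rw [Fin.sum_univ_two] at ha
  by_cases h0 : a 0 = 0
  · by_cases h1 : a 1 = 0
    · rw [h0, h1, map_zero, zero_mul, zero_mul, add_zero, sub_zero] at ha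
      exact absurd ha hl2
    · exact key 1 0 (by decide) (a 1) (a 0) h1 (by rwa [add_comm])
  · exact key 0 1 (by decide) (a 0) (a 1) h0 ha

/-- If `𝔫 ^ 3 ⊆ 𝔫 K`, `𝔫 ^ 2 ⊄ K`, and `𝔫 / K` is generated by two elements, then the multiplication
`𝔫 / (K + 𝔫 ^ 2) × 𝔫 / (K + 𝔫 ^ 2) → (K + 𝔫 ^ 2) / K` is nondegenerate: if `l 𝔫 ⊆ K` for one of the
generators `l` and `y` is the other one, then the quadratic forms in `K` are multiples of `l`, and
`y ^ 3` is not in `𝔫 K`. -/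
theorem mem_sup_sq_of_mul_mem [IsArtinianRing S] {κ : Type*} [Field κ] [Algebra κ S]
    (hκ : IsCoefficientField κ S) {K : Ideal S} (hK : K ≤ maximalIdeal S)
    (hk : minGeneratorsMaxMod K = 2) (h2 : ¬ maximalIdeal S ^ 2 ≤ K)
    (h3 : maximalIdeal S ^ 3 ≤ maximalIdeal S * K) (hv : ((4 : ℕ) : ℕ∞) ≤ vInv S) {l : S}
    (hl : l ∈ maximalIdeal S) (hlK : ∀ x ∈ maximalIdeal S, l * x ∈ K) :
    l ∈ K ⊔ maximalIdeal S ^ 2 := by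
  by_contra hl2
  obtain ⟨u, hu⟩ := exists_isMinimalModulo hk
  obtain ⟨y, hy⟩ := hu.exists_complement hκ hk hl hl2
  obtain ⟨s, z, -, hz⟩ := hy.exists_isAdaptedSystem (Z := (K : Set S)) le_rfl hK
    (by rw [Ideal.span_eq]; exact le_sup_left)
  have hyn : y ∈ maximalIdeal S := hy.mem 1
  have hquad : ∀ x ∈ maximalIdeal S ^ 2, ∃ a b c : κ, x - (algebraMap κ S a * l ^ 2 +
      algebraMap κ S b * (l * y) + algebraMap κ S c * y ^ 2) ∈
        Ideal.span (Set.range z) ⊔ maximalIdeal S ^ 3 :=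
    fun x hx => hz.exists_binary_quadratic hκ hx
  have h3K : maximalIdeal S ^ 3 ≤ K := h3.trans Ideal.mul_le_right
  have hZK : Ideal.span (Set.range z) ⊔ maximalIdeal S ^ 3 ≤ K := sup_le hz.span_le h3K
  have hform : ∀ a b : κ, algebraMap κ S a * l ^ 2 + algebraMap κ S b * (l * y) ∈ K := by
    intro a b
    rw [pow_two]
    exact add_mem (K.mul_mem_left _ (hlK l hl)) (K.mul_mem_left _ (hlK y hyn))
  have hyK : y ^ 2 ∉ K := by
    intro h
    refine h2 fun x hx => ?_
    obtain ⟨a, b, c, habc⟩ := hquad x hx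
    have h4 := add_mem (hZK habc) (add_mem (hform a b) (K.mul_mem_left (algebraMap κ S c) h))
    rwa [sub_add_cancel] at h4
  have hKl : K ≤ Ideal.span {l} * maximalIdeal S ⊔ (Ideal.span (Set.range z) ⊔
      maximalIdeal S ^ 3) := by
    intro x hx
    obtain ⟨w, hw, t, ht, rfl⟩ := Submodule.mem_sup.1 (hz.le_span hK hy hx)
    obtain ⟨a, b, c, habc⟩ := hquad t ht
    have hc : c = 0 := by
      by_contra hc
      have h4 : algebraMap κ S c * y ^ 2 ∈ K := by
        have h5 := sub_mem (sub_mem (sub_mem hx (hz.span_le hw)) (hZK habc)) (hform a b)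
        convert! h5 using 1
        ring
      have h5 := K.mul_mem_left (algebraMap κ S c⁻¹) h4
      rw [← mul_assoc, ← map_mul, inv_mul_cancel₀ hc, map_one, one_mul] at h5
      exact hyK h5
    rw [hc, map_zero, zero_mul, add_zero] at habc
    have h4 : algebraMap κ S a * l ^ 2 + algebraMap κ S b * (l * y) ∈
        Ideal.span {l} * maximalIdeal S := by
      have h5 := Ideal.mul_mem_mul (Ideal.mem_span_singleton_self l)
        (add_mem (Ideal.mul_mem_left _ (algebraMap κ S a) hl)
          (Ideal.mul_mem_left _ (algebraMap κ S b) hyn))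
      convert! h5 using 1
      ring
    have h6 := add_mem (Ideal.mem_sup_left h4) (Ideal.mem_sup_right
      (S := Ideal.span {l} * maximalIdeal S) (add_mem (Ideal.mem_sup_left hw) habc))
    convert! h6 using 1
    ring
  have hnK : maximalIdeal S * K ≤ Ideal.span {l} * maximalIdeal S ^ 2 ⊔
      (Ideal.span (Set.range z) ⊔ maximalIdeal S ^ 4) := by
    refine (Ideal.mul_mono_right hKl).trans ?_
    rw [Ideal.mul_sup, Ideal.mul_sup]
    refine sup_le_sup ?_ (sup_le_sup Ideal.mul_le_right ?_)
    · rw [mul_left_comm, ← pow_two]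
    · rw [← pow_succ']
  obtain ⟨w, hw, w', hw', hww⟩ := Submodule.mem_sup.1 (hnK (h3 (Ideal.pow_mem_pow hyn 3)))
  obtain ⟨t, ht, rfl⟩ := Ideal.mem_span_singleton_mul.1 hw
  obtain ⟨a, b, c, habc⟩ := hquad t ht
  have h4 := mul_mem_sup_pow habc (show l ∈ maximalIdeal S ^ 1 by rwa [pow_one])
  -- `y ^ 3 = l (a l ^ 2 + b l y + c y ^ 2)` would be a nontrivial relation between cubic forms.
  let p : ℕ → κ := fun i => match i with
    | 0 => -a
    | 1 => -b
    | 2 => -c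
    | _ => 1
  have hp : ∑ i ∈ Finset.range (3 + 1), algebraMap κ S (p i) *
      ((![l, y] : Fin 2 → S) 0 ^ (3 - i) * (![l, y] : Fin 2 → S) 1 ^ i) ∈
        Ideal.span (Set.range z) ⊔ maximalIdeal S ^ (3 + 1) := by
    convert! add_mem h4 hw' using 1
    simp only [Finset.sum_range_succ, Finset.sum_range_zero, p, map_neg, map_one,
      Matrix.cons_val_zero, Matrix.cons_val_one]
    linear_combination -hww
  exact one_ne_zero (hz.binary_form_eq_zero hκ hv (by norm_num) hp (i := 3) le_rfl)

end OneTwoOne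

/-! ### Complete intersections of two quadrics -/

section OneTwoOneSecond

open MvPolynomial RingTheory.Sequence

theorem mem_ofList_pair {R : Type*} [CommRing R] {q₁ q₂ p : R} :
    p ∈ Ideal.ofList [q₁, q₂] ↔ ∃ f g, f * q₁ + g * q₂ = p := by
  rw [Ideal.ofList_cons, Ideal.ofList_singleton, ← Ideal.span_insert, Ideal.mem_span_pair]

theorem span_pair_pow_three_le_mul_sub {R : Type*} [CommRing R] (x y : R) {c d : R}
    (hdc : d * c = 1) :
    Ideal.span {x, y} ^ 3 ≤ Ideal.ofList [x * y, y ^ 2 - c * x ^ 2] * Ideal.span {x, y} := by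
  have hx : x ∈ Ideal.span {x, y} := Ideal.subset_span (by simp)
  have hy : y ∈ Ideal.span {x, y} := Ideal.subset_span (by simp)
  have h₁ : x * y ∈ Ideal.ofList [x * y, y ^ 2 - c * x ^ 2] := Ideal.subset_span (by simp)
  have h₂ : y ^ 2 - c * x ^ 2 ∈ Ideal.ofList [x * y, y ^ 2 - c * x ^ 2] :=
    Ideal.subset_span (by simp)
  have h₁x := Ideal.mul_mem_mul h₁ hx
  have h₁y := Ideal.mul_mem_mul h₁ hy
  apply span_pair_pow_three_le
  · convert! Ideal.mul_mem_left _ d (sub_mem h₁y (Ideal.mul_mem_mul h₂ hx)) using 1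
    linear_combination -x ^ 3 * hdc
  · convert! h₁x using 1
    ring
  · convert! h₁y using 1
    ring
  · convert! add_mem (Ideal.mul_mem_mul h₂ hy) (Ideal.mul_mem_left _ c h₁x) using 1
    ring

theorem span_pair_pow_three_le_sq_sq {R : Type*} [CommRing R] (x y : R) :
    Ideal.span {x, y} ^ 3 ≤ Ideal.ofList [x ^ 2, y ^ 2] * Ideal.span {x, y} := by
  have hx : x ∈ Ideal.span {x, y} := Ideal.subset_span (by simp)
  have hy : y ∈ Ideal.span {x, y} := Ideal.subset_span (by simp)
  have h₁ : x ^ 2 ∈ Ideal.ofList [x ^ 2, y ^ 2] := Ideal.subset_span (by simp)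
  have h₂ : y ^ 2 ∈ Ideal.ofList [x ^ 2, y ^ 2] := Ideal.subset_span (by simp)
  apply span_pair_pow_three_le
  · rw [pow_succ x 2]
    exact Ideal.mul_mem_mul h₁ hx
  · exact Ideal.mul_mem_mul h₁ hy
  · rw [mul_comm x]
    exact Ideal.mul_mem_mul h₂ hx
  · rw [pow_succ y 2]
    exact Ideal.mul_mem_mul h₂ hy

variable {S : Type u} [CommRing S] [IsLocalRing S]

theorem functional_mul_eq_zero_of_generators {κ : Type*} [Field κ] [Algebra κ S]
    (hκ : IsCoefficientField κ S)
    {K : Ideal S} {k : ℕ} {u : Fin k → S} (hu : IsMinimalModulo K u) {φ : S →ₗ[κ] κ}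
    (hφ : ∀ t ∈ K ⊔ maximalIdeal S ^ 3, φ t = 0) {l : S} (hl : l ∈ maximalIdeal S)
    (h : ∀ i, φ (l * u i) = 0) {x : S} (hx : x ∈ maximalIdeal S) : φ (l * x) = 0 := by
  obtain ⟨a, ha⟩ := hu.exists_sub_sum_mem hκ hx
  have h1 : (x - ∑ i, algebraMap κ S (a i) * u i) * l ∈ K ⊔ maximalIdeal S ^ (2 + 1) :=
    mul_mem_sup_pow ha (by rwa [pow_one])
  have h2 : φ ((∑ i, algebraMap κ S (a i) * u i) * l) = 0 := by
    rw [Finset.sum_mul, map_sum]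
    refine Finset.sum_eq_zero fun i _ => ?_
    rw [mul_assoc, ← Algebra.smul_def, map_smul, mul_comm (u i), h i, smul_zero]
  have h3 := hφ _ h1
  rwa [sub_mul, map_sub, h2, sub_zero, mul_comm] at h3

/-- A local ring whose maximal ideal modulo `K` has a nondegenerate multiplication with values in a
one-dimensional `(K + 𝔫 ^ 2) / K` is Gorenstein modulo `K`. -/
theorem isArtinianGorensteinLocal_quotient_of_nondegenerate {κ : Type*} [Field κ] [Algebra κ S]
    [Module.Finite κ S] {K : Ideal S} (hK : K ≤ maximalIdeal S) (h3 : maximalIdeal S ^ 3 ≤ K)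
    {φ : S →ₗ[κ] κ} {w : S} (hφw : φ w = 1)
    (hφ : ∀ t ∈ K ⊔ maximalIdeal S ^ 3, φ t = 0)
    (hφ' : ∀ t ∈ maximalIdeal S ^ 2, t - algebraMap κ S (φ t) * w ∈ K ⊔ maximalIdeal S ^ 3)
    (hnd : ∀ l ∈ maximalIdeal S, (∀ x ∈ maximalIdeal S, l * x ∈ K) →
      l ∈ K ⊔ maximalIdeal S ^ 2) : IsArtinianGorensteinLocal (S ⧸ K) := by
  have hK3 : K ⊔ maximalIdeal S ^ 3 ≤ K := sup_le le_rfl h3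
  have hker : ∀ t ∈ maximalIdeal S ^ 2, φ t = 0 → t ∈ K := by
    intro t ht h
    have h1 := hφ' t ht
    rw [h, map_zero, zero_mul, sub_zero] at h1
    exact hK3 h1
  refine isArtinianGorensteinLocal_quotient
    (fun h => (maximalIdeal.isMaximal S).ne_top (top_le_iff.1 (h ▸ hK))) φ
    (fun x hx => hφ x (Ideal.mem_sup_left hx)) fun r hr => ?_
  by_cases hrn : r ∈ maximalIdeal S
  · by_cases hr2 : r ∈ K ⊔ maximalIdeal S ^ 2
    · obtain ⟨x, hx, t, ht, rfl⟩ := Submodule.mem_sup.1 hr2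
      refine ⟨1, fun h => hr (add_mem hx (hker t ht ?_))⟩
      rwa [mul_one, map_add, hφ x (Ideal.mem_sup_left hx), zero_add] at h
    · by_contra! h
      refine hr2 (hnd r hrn fun x hx => hker _ ?_ (h x))
      rw [pow_two]
      exact Ideal.mul_mem_mul hrn hx
  · obtain ⟨b, hb⟩ := (notMem_maximalIdeal.1 hrn).exists_right_inv
    refine ⟨b * w, ?_⟩
    rw [← mul_assoc, hb, one_mul, hφw]
    exact one_ne_zero

variable {κ : Type u} [Field κ] [Algebra κ S]

/-- The second splitting theorem applies if `0 :_S J` is generated by a part of a minimal system of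
generators of `𝔫` and a regular sequence of two quadratic forms `q₁`, `q₂` in the remaining two
generators. -/
theorem secondSplittingApplies_of_quadrics (hS : IsArtinianGorensteinLocal S)
    (hκ : IsCoefficientField κ S) {J : Ideal S} (hK : annIdeal J ≤ maximalIdeal S)
    {u : Fin 2 → S} (hu : IsMinimalModulo (annIdeal J) u) {q₁ q₂ : MvPolynomial (Fin 2) κ}
    (hreg : IsWeaklyRegular (MvPolynomial (Fin 2) κ) [q₁, q₂]) (hq₁ : aeval u q₁ ∈ annIdeal J)
    (hq₂ : aeval u q₂ ∈ annIdeal J)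
    (h3 : idealOfVars (Fin 2) κ ^ 3 ≤ Ideal.ofList [q₁, q₂] * idealOfVars (Fin 2) κ)
    (hspan : ∀ a b c : κ, aeval u (C a * X 0 ^ 2 + C b * (X 0 * X 1) + C c * X 1 ^ 2) ∈
      annIdeal J → C a * X 0 ^ 2 + C b * (X 0 * X 1) + C c * X 1 ^ 2 ∈ Ideal.ofList [q₁, q₂])
    (hG : IsArtinianGorensteinLocal (S ⧸ annIdeal J)) (hv : ((5 : ℕ) : ℕ∞) ≤ vInv S) :
    SecondSplittingApplies J := by
  have := hS.isArtinianRing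
  obtain ⟨s, z, -, hz⟩ := hu.exists_isAdaptedSystem (Z := (annIdeal J : Set S)) le_rfl hK
    (by rw [Ideal.span_eq]; exact le_sup_left)
  set b := Ideal.ofList [q₁, q₂] with hb
  have hbU : idealOfVars (Fin 2) κ ^ 3 ≤ b := h3.trans Ideal.mul_le_left
  have hmem : ∀ r ∈ [q₁, q₂], aeval u r ∈ annIdeal J := by
    intro r hr
    rcases List.mem_pair.1 hr with rfl | rfl
    · exact hq₁
    · exact hq₂
  have hbK : b.map (aeval u) ≤ annIdeal J := by
    rw [Ideal.map_le_iff_le_comap, hb, Ideal.span_le]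
    exact hmem
  set I := b.map (aeval u) ⊔ Ideal.span (Set.range z) with hI
  have hIK : I ≤ annIdeal J := sup_le hbK hz.span_le
  have hn3 : maximalIdeal S ^ 3 ≤ I := by
    apply le_of_le_sup_maximalIdeal_mul
    intro x hx
    obtain ⟨F, hF, hxF⟩ := hz.exists_form hκ hx
    have hFb : aeval u F ∈ I := by
      refine Ideal.mem_sup_left (Ideal.mem_map_of_mem _ (hbU ?_))
      rw [mem_pow_idealOfVars_iff']
      intro m hm
      refine hF.coeff_eq_zero ?_
      omega
    have h1 : Ideal.span (Set.range z) ⊔ maximalIdeal S ^ (3 + 1) ≤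
        I ⊔ maximalIdeal S * maximalIdeal S ^ 3 := by
      rw [pow_succ' (maximalIdeal S) 3]
      exact sup_le_sup_right le_sup_right _
    have h2 := add_mem (h1 hxF) (Ideal.mem_sup_left hFb)
    rwa [sub_add_cancel] at h2
  refine secondSplittingApplies_of_regular hS hκ hK hz (t := 4) hreg (by simp) hmem ?_ hv ?_ ?_ hG
  · intro x hx
    obtain ⟨w, hw, t, ht, rfl⟩ := Submodule.mem_sup.1 (hz.le_span hK hu hx)
    obtain ⟨a₀, a₁, a₂, ha⟩ := hz.exists_binary_quadratic hκ ht
    have hF : aeval u (C a₀ * X 0 ^ 2 + C a₁ * (X 0 * X 1) + C a₂ * X 1 ^ 2) =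
        algebraMap κ S a₀ * u 0 ^ 2 + algebraMap κ S a₁ * (u 0 * u 1) +
          algebraMap κ S a₂ * u 1 ^ 2 := by
      simp
    rw [← hF] at ha
    have hle : Ideal.span (Set.range z) ⊔ maximalIdeal S ^ 3 ≤ I := sup_le le_sup_right hn3
    have h1 := sub_mem (sub_mem hx (hz.span_le hw)) (hIK (hle ha))
    rw [add_sub_cancel_left, sub_sub_cancel] at h1
    have h2 := add_mem (hle ha) (Ideal.mem_sup_left
      (Ideal.mem_map_of_mem (aeval u) (hspan _ _ _ h1)))
    rw [sub_add_cancel] at h2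
    exact add_mem (Ideal.mem_sup_right hw) h2
  · calc idealOfVars (Fin 2) κ ^ (4 + 1)
        = idealOfVars (Fin 2) κ ^ 3 * idealOfVars (Fin 2) κ ^ 2 := by rw [← pow_add]
      _ ≤ b * idealOfVars (Fin 2) κ * idealOfVars (Fin 2) κ ^ 2 := Ideal.mul_mono_left h3
      _ = b * idealOfVars (Fin 2) κ ^ 3 := by ring
      _ ≤ b * b := Ideal.mul_mono_right hbU
      _ = b ^ 2 := (pow_two b).symm
  · exact (Ideal.pow_le_pow_right (by norm_num)).trans hbU

/-- The second splitting theorem applies if `S / (0 :_S J)` is Gorenstein with Hilbert function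
`(1, 2, 1)`. The quadratic forms in `0 :_S J` are those that are orthogonal to the bilinear form
given by multiplication, and this form is either diagonal in suitable coordinates or alternating. -/
theorem secondSplittingApplies_of_one_two_one (hS : IsArtinianGorensteinLocal S)
    (hκ : IsCoefficientField κ S) {J : Ideal S} (hK : annIdeal J ≤ maximalIdeal S)
    (hk : minGeneratorsMaxMod (annIdeal J) = 2) (hdim : Module.finrank κ (S ⧸ annIdeal J) = 4)
    (h3 : maximalIdeal S ^ 3 ≤ maximalIdeal S * annIdeal J) (hv : ((5 : ℕ) : ℕ∞) ≤ vInv S) :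
    SecondSplittingApplies J := by
  have := hS.isArtinianRing
  have hfin := finite_of_coefficientField hκ
  set K := annIdeal J with hKdef
  obtain ⟨u, hu⟩ := exists_isMinimalModulo hk
  have h3K : maximalIdeal S ^ 3 ≤ K := h3.trans Ideal.mul_le_right
  have hK3 : K ⊔ maximalIdeal S ^ 3 = K := sup_eq_left.2 h3K
  have hD2 := finrank_quotient_sup_sq hκ hK hu
  have h2K : ¬ maximalIdeal S ^ 2 ≤ K := by
    intro h
    rw [sup_eq_left.2 h] at hD2
    omega
  obtain ⟨φ, w, -, hφw, hφ, hφ'⟩ := exists_functional hκ (K := K) (by rw [hD2, hK3, hdim])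
  have hnd : ∀ l ∈ maximalIdeal S, (∀ x ∈ maximalIdeal S, l * x ∈ K) →
      l ∈ K ⊔ maximalIdeal S ^ 2 := fun l hl hlK =>
    mem_sup_sq_of_mul_mem hκ hK hk h2K h3 (le_trans (by norm_cast) hv) hl hlK
  have hG := isArtinianGorensteinLocal_quotient_of_nondegenerate hK h3K hφw hφ hφ' hnd
  have hker : ∀ x ∈ maximalIdeal S, ∀ y ∈ maximalIdeal S, φ (x * y) = 0 → x * y ∈ K := by
    intro x hx y hy h
    have h1 := hφ' (x * y) (by rw [pow_two]; exact Ideal.mul_mem_mul hx hy)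
    rw [h, map_zero, zero_mul, sub_zero, hK3] at h1
    exact h1
  have hφK : ∀ t ∈ K, φ t = 0 := fun t ht => hφ t (Ideal.mem_sup_left ht)
  have hφu : ∀ v : Fin 2 → S, IsMinimalModulo K v → ∀ i, ∃ j, φ (v i * v j) ≠ 0 := by
    intro v hv i
    by_contra! h
    have h1 := hnd (v i) (hv.mem i) fun x hx =>
      hker _ (hv.mem i) _ hx (functional_mul_eq_zero_of_generators hκ hv hφ (hv.mem i) h hx)
    have h2 := hv.indep (Pi.single i 1) (by simpa [Pi.single_apply] using h1) i
    rw [Pi.single_eq_same] at h2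
    exact (Ideal.ne_top_iff_one _).1 (maximalIdeal.isMaximal S).ne_top h2
  have hφmul : ∀ (a : κ) (x : S), φ (algebraMap κ S a * x) = a * φ x := by
    intro a x
    rw [← Algebra.smul_def, map_smul, smul_eq_mul]
  have hform : ∀ (v : Fin 2 → S) (a b c : κ),
      φ (aeval v (C a * X 0 ^ 2 + C b * (X 0 * X 1) + C c * X 1 ^ 2 : MvPolynomial (Fin 2) κ)) =
        a * φ (v 0 * v 0) + b * φ (v 0 * v 1) + c * φ (v 1 * v 1) := by
    intro v a b c
    simp [hφmul, pow_two]
  by_cases hdiag : ∃ x ∈ maximalIdeal S, φ (x * x) ≠ 0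
  · obtain ⟨x, hx, hxx⟩ := hdiag
    have hx2 : x ∉ K ⊔ maximalIdeal S ^ 2 := fun h =>
      hxx (hφ _ (mul_mem_sup_pow (j := 1) h (by rwa [pow_one])))
    obtain ⟨y₀, hy₀⟩ := hu.exists_complement hκ hk hx hx2
    -- The orthogonal projection of `y₀` completes `x` to an orthogonal basis.
    set d := φ (x * y₀) / φ (x * x) with hd
    set y := y₀ - algebraMap κ S d * x with hy
    have hxy0 : φ (x * y) = 0 := by
      rw [hy, mul_sub, map_sub, mul_left_comm, hφmul, hd, div_mul_cancel₀ _ hxx, sub_self]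
    have hmin : IsMinimalModulo K ![x, y] := by
      refine isMinimalModulo_of_le_span hk ?_ ?_
      · intro m
        fin_cases m
        · exact hx
        · exact sub_mem (hy₀.mem 1) (Ideal.mul_mem_left _ _ hx)
      · refine hy₀.le_span.trans (sup_le_sup_right ?_ K)
        rw [Matrix.range_cons_cons_empty, Matrix.range_cons_cons_empty, Ideal.span_le]
        rintro p (rfl | rfl)
        · exact Ideal.subset_span (by simp)
        · exact Ideal.mem_span_pair.2 ⟨algebraMap κ S d, 1, by rw [hy]; ring⟩
    have hyn : y ∈ maximalIdeal S := hmin.mem 1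
    have hyy : φ (y * y) ≠ 0 := by
      obtain ⟨j, hj⟩ := hφu _ hmin 1
      fin_cases j
      · exact absurd ((congrArg φ (mul_comm y x)).trans hxy0) hj
      · exact hj
    set c := φ (y * y) / φ (x * x) with hc
    have hc0 : c ≠ 0 := div_ne_zero hyy hxx
    refine secondSplittingApplies_of_quadrics hS hκ hK hmin (isWeaklyRegular_mul_sub hc0) ?_ ?_ ?_
      ?_ hG hv
    · simpa using hker x hx y hyn hxy0
    · have h1 : y * y - algebraMap κ S c * (x * x) ∈ maximalIdeal S ^ 2 := by
        rw [pow_two]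
        exact sub_mem (Ideal.mul_mem_mul hyn hyn)
          (Ideal.mul_mem_left _ _ (Ideal.mul_mem_mul hx hx))
      have h2 := hφ' _ h1
      rw [map_sub, hφmul, hc, div_mul_cancel₀ _ hxx, sub_self, map_zero, zero_mul, sub_zero,
        hK3] at h2
      simpa [pow_two] using h2
    · rw [idealOfVars_fin_two]
      exact span_pair_pow_three_le_mul_sub (X 0) (X 1)
        (show C c⁻¹ * C c = 1 by rw [← C_mul, inv_mul_cancel₀ hc0, C_1])
    · intro a b e h
      have h1 := hφK _ h
      rw [hform] at h1
      simp only [Matrix.cons_val_zero, Matrix.cons_val_one, hxy0, mul_zero, add_zero] at h1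
      have h2 : a = -(e * c) := by
        rw [hc]
        field_simp
        linear_combination h1
      refine mem_ofList_pair.2 ⟨C b, C e, ?_⟩
      rw [h2, C_neg, C_mul]
      ring
  · push Not at hdiag
    have h01 : φ (u 0 * u 1) ≠ 0 := by
      obtain ⟨j, hj⟩ := hφu _ hu 0
      fin_cases j
      · exact absurd (hdiag _ (hu.mem 0)) hj
      · exact hj
    refine secondSplittingApplies_of_quadrics hS hκ hK hu isWeaklyRegular_sq_sq ?_ ?_ ?_ ?_ hG hv
    · simpa [pow_two] using hker _ (hu.mem 0) _ (hu.mem 0) (hdiag _ (hu.mem 0))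
    · simpa [pow_two] using hker _ (hu.mem 1) _ (hu.mem 1) (hdiag _ (hu.mem 1))
    · rw [idealOfVars_fin_two]
      exact span_pair_pow_three_le_sq_sq (X 0) (X 1)
    · intro a b e h
      have h1 := hφK _ h
      rw [hform, hdiag _ (hu.mem 0), hdiag _ (hu.mem 1), mul_zero, mul_zero, zero_add,
        add_zero] at h1
      have hb := (mul_eq_zero.1 h1).resolve_right h01
      refine mem_ofList_pair.2 ⟨C a, C e, ?_⟩
      rw [hb, C_0]
      ring

end OneTwoOneSecond

/-! ### Quotients with one-dimensional square of the maximal ideal -/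

section Socle

variable {S : Type u} [CommRing S] [IsLocalRing S] {κ : Type*} [Field κ] [Algebra κ S]

theorem IsMinimalModulo.notMem {K : Ideal S} {k : ℕ} {u : Fin k → S} (hu : IsMinimalModulo K u)
    (i : Fin k) : u i ∉ K ⊔ maximalIdeal S ^ 2 := by
  intro h
  have h2 := hu.indep (Pi.single i 1) (by simpa [Pi.single_apply] using h) i
  rw [Pi.single_eq_same] at h2
  exact (Ideal.ne_top_iff_one _).1 (maximalIdeal.isMaximal S).ne_top h2

/-- The first splitting theorem applies if `S / (0 :_S J)` has Hilbert function `(1, k)` with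
`2 ≤ k`: all of `𝔫` is annihilated by `𝔫` modulo `0 :_S J`. -/
theorem firstSplittingApplies_of_finrank_eq (hS : IsArtinianGorensteinLocal S)
    (hκ : IsCoefficientField κ S) {J : Ideal S} (hK : annIdeal J ≤ maximalIdeal S) {k : ℕ}
    {u : Fin k → S} (hu : IsMinimalModulo (annIdeal J) u) (hk : 2 ≤ k)
    (hdim : Module.finrank κ (S ⧸ annIdeal J) = k + 1) (hv : ((3 : ℕ) : ℕ∞) ≤ vInv S) :
    FirstSplittingApplies J := by
  have := hS.isArtinianRing
  have hfin := finite_of_coefficientField hκ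
  have h2 : maximalIdeal S ^ 2 ≤ annIdeal J := by
    apply pow_le_of_finrank_le (κ := κ)
    rw [hdim, finrank_quotient_sup_sq hκ hK hu]
  refine firstSplittingApplies_of_socle hS hκ hK hu hk hv (hu.mem ⟨0, by omega⟩) (hu.notMem _)
    fun x hx => h2 ?_
  rw [pow_two]
  exact Ideal.mul_mem_mul (hu.mem _) hx

theorem pow_three_le_of_finrank_eq [IsArtinianRing S] [Module.Finite κ S]
    (hκ : IsCoefficientField κ S) {K : Ideal S} (hK : K ≤ maximalIdeal S) {k : ℕ} {u : Fin k → S}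
    (hu : IsMinimalModulo K u) (hdim : Module.finrank κ (S ⧸ K) = k + 2) :
    maximalIdeal S ^ 3 ≤ K := by
  apply pow_le_of_finrank_le (κ := κ)
  have hD2 := finrank_quotient_sup_sq hκ hK hu
  rcases pow_le_or_finrank_lt (κ := κ) K 2 with h | h
  · rw [sup_eq_left.2 h] at hD2
    omega
  · rw [hD2] at h
    rw [hdim]
    exact h

theorem exists_functional_of_finrank_eq [IsArtinianRing S] [Module.Finite κ S]
    (hκ : IsCoefficientField κ S) {K : Ideal S} (hK : K ≤ maximalIdeal S) {k : ℕ} {u : Fin k → S}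
    (hu : IsMinimalModulo K u) (hdim : Module.finrank κ (S ⧸ K) = k + 2) :
    ∃ (φ : S →ₗ[κ] κ) (w : S), w ∈ maximalIdeal S ^ 2 ∧ φ w = 1 ∧
      (∀ t ∈ K ⊔ maximalIdeal S ^ 3, φ t = 0) ∧
      ∀ t ∈ maximalIdeal S ^ 2, t - algebraMap κ S (φ t) * w ∈ K ⊔ maximalIdeal S ^ 3 :=
  exists_functional hκ (by
    rw [sup_eq_left.2 (pow_three_le_of_finrank_eq hκ hK hu hdim), hdim,
      finrank_quotient_sup_sq hκ hK hu])

/-- If `𝔫` needs at least two generators modulo `K = 0 :_S J`, then the first splitting theorem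
applies unless the multiplication on `𝔫 / (K + 𝔫 ^ 2)` with values in `𝔫 / K` is nondegenerate. -/
theorem firstSplittingApplies_or_nondegenerate (hS : IsArtinianGorensteinLocal S)
    (hκ : IsCoefficientField κ S) {J : Ideal S} (hK : annIdeal J ≤ maximalIdeal S) {k : ℕ}
    {u : Fin k → S} (hu : IsMinimalModulo (annIdeal J) u) (hk : 2 ≤ k)
    (hv : ((3 : ℕ) : ℕ∞) ≤ vInv S) :
    FirstSplittingApplies J ∨ ∀ l ∈ maximalIdeal S, (∀ x ∈ maximalIdeal S, l * x ∈ annIdeal J) →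
      l ∈ annIdeal J ⊔ maximalIdeal S ^ 2 := by
  by_contra! h
  obtain ⟨h1, l, hl, hlK, hl2⟩ := h
  exact h1 (firstSplittingApplies_of_socle hS hκ hK hu hk hv hl hl2 hlK)

theorem pow_three_le_maximalIdeal_mul [IsArtinianRing S] [Module.Finite κ S]
    (hκ : IsCoefficientField κ S) {K : Ideal S} (hK : K ≤ maximalIdeal S) {k : ℕ} {u : Fin k → S}
    (hu : IsMinimalModulo K u) (hk : 2 ≤ k) (hdim : Module.finrank κ (S ⧸ K) = k + 2)
    (hnd : ∀ l ∈ maximalIdeal S, (∀ x ∈ maximalIdeal S, l * x ∈ K) →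
      l ∈ K ⊔ maximalIdeal S ^ 2) : maximalIdeal S ^ 3 ≤ maximalIdeal S * K := by
  obtain ⟨φ, w, hw, -, -, hφ'⟩ := exists_functional_of_finrank_eq hκ hK hu hdim
  have h3 : K ⊔ maximalIdeal S ^ 3 = K :=
    sup_eq_left.2 (pow_three_le_of_finrank_eq hκ hK hu hdim)
  exact pow_three_le_of_nondegenerate hκ hu hk hw hφ' fun l hl h => hnd l hl (by rwa [h3] at h)

theorem mem_torsionBySet_mk_iff {K : Ideal S} {x : S} :
    Ideal.Quotient.mk K x ∈ Submodule.torsionBySet S (S ⧸ K) (maximalIdeal S : Set S) ↔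
      ∀ y ∈ maximalIdeal S, x * y ∈ K := by
  rw [Submodule.mem_torsionBySet_iff, Subtype.forall]
  refine forall₂_congr fun y _ => ?_
  rw [← Ideal.Quotient.eq_zero_iff_mem, mul_comm, map_mul, Algebra.smul_def]
  rfl

/-- If `S / K` has Hilbert function `(1, k, 1)` with `1 ≤ k` and the multiplication on
`𝔫 / (K + 𝔫 ^ 2)` is nondegenerate, then the socle of `S / K` is `(K + 𝔫 ^ 2) / K`. -/
theorem socleDim_le_one [IsArtinianRing S] [Module.Finite κ S]
    (hκ : IsCoefficientField κ S) {K : Ideal S} (hK : K ≤ maximalIdeal S) {k : ℕ} {u : Fin k → S}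
    (hu : IsMinimalModulo K u) (hk : 1 ≤ k) (hdim : Module.finrank κ (S ⧸ K) = k + 2)
    (hnd : ∀ l ∈ maximalIdeal S, (∀ x ∈ maximalIdeal S, l * x ∈ K) →
      l ∈ K ⊔ maximalIdeal S ^ 2) : socleDim K ≤ 1 := by
  let := Ideal.Quotient.field (maximalIdeal S)
  obtain ⟨φ, w, hw, -, -, hφ'⟩ := exists_functional_of_finrank_eq hκ hK hu hdim
  have h3 := pow_three_le_of_finrank_eq hκ hK hu hdim
  have hwK : ∀ y ∈ maximalIdeal S, w * y ∈ K := fun y hy => h3 (by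
    rw [pow_succ]
    exact Ideal.mul_mem_mul hw hy)
  refine finrank_le_one ⟨Ideal.Quotient.mk K w, mem_torsionBySet_mk_iff.2 hwK⟩ ?_
  rintro ⟨x, hx⟩
  obtain ⟨x, rfl⟩ := Ideal.Quotient.mk_surjective x
  have hxK := mem_torsionBySet_mk_iff.1 hx
  have hxn : x ∈ maximalIdeal S := by
    by_contra h
    obtain ⟨b, hb⟩ := (notMem_maximalIdeal.1 h).exists_right_inv
    have h1 := K.mul_mem_right b (hxK _ (hu.mem ⟨0, hk⟩))
    rw [mul_right_comm, hb, one_mul] at h1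
    exact hu.notMem _ (Ideal.mem_sup_left h1)
  obtain ⟨y, hy, t, ht, rfl⟩ := Submodule.mem_sup.1 (hnd x hxn hxK)
  refine ⟨Ideal.Quotient.mk _ (algebraMap κ S (φ t)), Subtype.ext ?_⟩
  change Ideal.Quotient.mk K (algebraMap κ S (φ t) * w) = Ideal.Quotient.mk K (y + t)
  rw [eq_comm, Ideal.Quotient.eq, add_sub_assoc]
  exact add_mem hy (sup_le le_rfl h3 (hφ' t ht))

/-- If `S / K` has Hilbert function `(1, k, 1)` and a one-dimensional socle, then the multiplication
on `𝔫 / (K + 𝔫 ^ 2)` is nondegenerate: the socle contains `(K + 𝔫 ^ 2) / K`, and so it is equal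
to it. -/
theorem mem_sup_sq_of_socleDim_le_one [IsArtinianRing S] [Module.Finite κ S]
    (hκ : IsCoefficientField κ S) {K : Ideal S} (hK : K ≤ maximalIdeal S) {k : ℕ} {u : Fin k → S}
    (hu : IsMinimalModulo K u) (hdim : Module.finrank κ (S ⧸ K) = k + 2)
    (hsoc : socleDim K ≤ 1) {l : S} (hlK : ∀ x ∈ maximalIdeal S, l * x ∈ K) :
    l ∈ K ⊔ maximalIdeal S ^ 2 := by
  let := Ideal.Quotient.field (maximalIdeal S)
  obtain ⟨φ, w, hw, hφw, hφ, -⟩ := exists_functional_of_finrank_eq hκ hK hu hdim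
  have h3 := pow_three_le_of_finrank_eq hκ hK hu hdim
  have hwK : ∀ y ∈ maximalIdeal S, w * y ∈ K := fun y hy => h3 (by
    rw [pow_succ]
    exact Ideal.mul_mem_mul hw hy)
  have : Module.Finite (S ⧸ maximalIdeal S)
      ↥(Submodule.torsionBySet S (S ⧸ K) (maximalIdeal S : Set S)) :=
    Module.Finite.of_restrictScalars_finite S _ _
  obtain ⟨⟨x, hx⟩, hspan⟩ := finrank_le_one_iff.1 hsoc
  obtain ⟨x, rfl⟩ := Ideal.Quotient.mk_surjective x
  have key : ∀ y, (∀ m ∈ maximalIdeal S, y * m ∈ K) → ∃ a, a * x - y ∈ K := by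
    intro y hy
    obtain ⟨a, ha⟩ := hspan ⟨Ideal.Quotient.mk K y, mem_torsionBySet_mk_iff.2 hy⟩
    obtain ⟨a, rfl⟩ := Ideal.Quotient.mk_surjective a
    exact ⟨a, Ideal.Quotient.eq.1 (congrArg Subtype.val ha)⟩
  have hxK := mem_torsionBySet_mk_iff.1 hx
  obtain ⟨a, ha⟩ := key w hwK
  have hwK' : w ∉ K := fun h => by
    rw [hφ w (Ideal.mem_sup_left h)] at hφw
    exact zero_ne_one hφw
  have hau : IsUnit a := by
    by_contra h
    refine hwK' ?_
    have h1 := sub_mem (hxK a ((mem_maximalIdeal a).2 h)) ha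
    rwa [mul_comm, sub_sub_cancel] at h1
  have hx2 : x ∈ K ⊔ maximalIdeal S ^ 2 := by
    obtain ⟨b, hb⟩ := hau.exists_left_inv
    have h1 := Ideal.mul_mem_left _ b
      (add_mem (Ideal.mem_sup_left ha) (Ideal.mem_sup_right (S := K) hw))
    rwa [sub_add_cancel, ← mul_assoc, hb, one_mul] at h1
  obtain ⟨c, hc⟩ := key l hlK
  have h1 := sub_mem (Ideal.mul_mem_left _ c hx2) (Ideal.mem_sup_left hc)
  rwa [sub_sub_cancel] at h1

end Socle

/-! ### Standard-graded local rings -/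

section Graded

open DirectSum

theorem IsStandardGradedOverField.exists_sub_mem_span {S : Type u} [CommRing S]
    {𝒜 : ℕ → AddSubgroup S} [GradedRing 𝒜] (h : IsStandardGradedOverField 𝒜) (x : S) :
    ∃ a : 𝒜 0, x - a ∈ Ideal.span (𝒜 1 : Set S) := by
  have hx : x ∈ Algebra.adjoin ↥(𝒜 0) (𝒜 1 : Set S) := h.generated ▸ Algebra.mem_top
  induction hx using Algebra.adjoin_induction with
  | mem x hx => exact ⟨0, by simpa using Ideal.subset_span hx⟩
  | algebraMap r =>
    refine ⟨r, ?_⟩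
    rw [show algebraMap ↥(𝒜 0) S r = r from rfl, sub_self]
    exact zero_mem _
  | add x y _ _ hx hy =>
    obtain ⟨a, ha⟩ := hx
    obtain ⟨b, hb⟩ := hy
    refine ⟨a + b, ?_⟩
    rw [AddSubgroup.coe_add, add_sub_add_comm]
    exact add_mem ha hb
  | mul x y _ _ hx hy =>
    obtain ⟨a, ha⟩ := hx
    obtain ⟨b, hb⟩ := hy
    refine ⟨a * b, ?_⟩
    have h1 := add_mem (Ideal.mul_mem_left _ x hb) (Ideal.mul_mem_left _ (b : S) ha)
    convert! h1 using 1
    change x * y - a * b = _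
    ring

variable {S : Type u} [CommRing S] [IsLocalRing S] {𝒜 : ℕ → AddSubgroup S} [GradedRing 𝒜]

theorem mem_maximalIdeal_of_mem_grade_one {x : S} (hx : x ∈ 𝒜 1) : x ∈ maximalIdeal S := by
  rw [mem_maximalIdeal, mem_nonunits_iff, isUnit_iff_exists_inv]
  rintro ⟨y, hxy⟩
  have h1 := coe_decompose_mul_of_left_mem_of_not_le (n := 0) (b := y) 𝒜 hx (by norm_num)
  rw [hxy, decompose_of_mem_same 𝒜 (SetLike.GradedOne.one_mem)] at h1
  exact one_ne_zero h1

theorem IsStandardGradedOverField.span_grade_one (h : IsStandardGradedOverField 𝒜) :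
    Ideal.span (𝒜 1 : Set S) = maximalIdeal S := by
  have hle : Ideal.span (𝒜 1 : Set S) ≤ maximalIdeal S :=
    Ideal.span_le.2 fun x hx => mem_maximalIdeal_of_mem_grade_one hx
  refine le_antisymm hle fun x hx => ?_
  obtain ⟨a, ha⟩ := h.exists_sub_mem_span x
  have han : (a : S) ∈ maximalIdeal S := by
    have h1 := sub_mem hx (hle ha)
    rwa [sub_sub_cancel] at h1
  have ha0 : a = 0 := by
    by_contra hne
    obtain ⟨b, hb⟩ := h.isField.mul_inv_cancel hne
    have h1 : (a : S) * b = 1 := congrArg Subtype.val hb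
    exact (mem_maximalIdeal _).1 han (IsUnit.of_mul_eq_one _ h1)
  rwa [ha0, AddSubgroup.coe_zero, sub_zero] at ha

/-- The field `[S]_0` is a coefficient field of `S`. -/
theorem IsStandardGradedOverField.exists_coefficientField (h : IsStandardGradedOverField 𝒜) :
    ∃ (κ : Type u) (_ : Field κ) (_ : Algebra κ S), IsCoefficientField κ S ∧
      ∀ a : κ, algebraMap κ S a ∈ 𝒜 0 := by
  let F : Field ↥(𝒜 0) := h.isField.toField
  let i : Algebra ↥(𝒜 0) S := inferInstance
  refine ⟨↥(𝒜 0), F, i, fun s => ?_, fun a => a.2⟩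
  obtain ⟨a, ha⟩ := h.exists_sub_mem_span s
  exact ⟨a, h.span_grade_one ▸ ha⟩

theorem IsStandardGradedOverField.decompose_mem_pow (h : IsStandardGradedOverField 𝒜) (x : S) :
    ∀ j, (decompose 𝒜 x j : S) ∈ maximalIdeal S ^ j := by
  classical
  have hx : x ∈ Algebra.adjoin ↥(𝒜 0) (𝒜 1 : Set S) := h.generated ▸ Algebra.mem_top
  induction hx using Algebra.adjoin_induction with
  | mem x hx =>
    intro j
    by_cases hj : 1 = j
    · rw [← hj, decompose_of_mem_same 𝒜 hx, pow_one]
      exact mem_maximalIdeal_of_mem_grade_one hx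
    · rw [decompose_of_mem_ne 𝒜 hx hj]
      exact zero_mem _
  | algebraMap r =>
    intro j
    by_cases hj : 0 = j
    · rw [← hj, pow_zero, Ideal.one_eq_top]
      exact Submodule.mem_top
    · rw [decompose_of_mem_ne 𝒜 (show algebraMap ↥(𝒜 0) S r ∈ 𝒜 0 from r.2) hj]
      exact zero_mem _
  | add x y _ _ hx hy =>
    intro j
    rw [decompose_add, DirectSum.add_apply, AddSubgroup.coe_add]
    exact add_mem (hx j) (hy j)
  | mul x y _ _ hx hy =>
    intro j
    rw [← sum_support_decompose 𝒜 x, Finset.sum_mul, decompose_sum, DFinsupp.finsetSum_apply,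
      AddSubmonoidClass.coe_finsetSum]
    refine sum_mem fun i _ => ?_
    rw [coe_decompose_mul_of_left_mem 𝒜 j (SetLike.coe_mem (decompose 𝒜 x i))]
    split_ifs with hij
    · have h1 := Ideal.mul_mem_mul (hx i) (hy (j - i))
      rwa [← pow_add, Nat.add_sub_cancel' hij] at h1
    · exact zero_mem _

theorem IsStandardGradedOverField.grade_le_pow (h : IsStandardGradedOverField 𝒜) {j : ℕ} {x : S}
    (hx : x ∈ 𝒜 j) : x ∈ maximalIdeal S ^ j := by
  rw [← decompose_of_mem_same 𝒜 hx]
  exact h.decompose_mem_pow x j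

theorem IsStandardGradedOverField.decompose_eq_zero (h : IsStandardGradedOverField 𝒜) {i : ℕ}
    {x : S} (hx : x ∈ maximalIdeal S ^ i) : ∀ j < i, (decompose 𝒜 x j : S) = 0 := by
  induction i generalizing x with
  | zero => exact fun j hj => absurd hj (Nat.not_lt_zero j)
  | succ i ih =>
    rw [pow_succ'] at hx
    refine Submodule.mul_induction_on hx ?_ ?_
    · intro r hr t ht j hj
      rw [← h.span_grade_one] at hr
      induction hr using Submodule.span_induction generalizing t with
      | mem r hr =>
        classical
        rw [coe_decompose_mul_of_left_mem 𝒜 j hr]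
        split_ifs with h1
        · rw [ih ht _ (by omega), mul_zero]
        · rfl
      | zero => rw [zero_mul, decompose_zero, DirectSum.zero_apply, AddSubgroup.coe_zero]
      | add r r' _ _ hr hr' =>
        rw [add_mul, decompose_add, DirectSum.add_apply, AddSubgroup.coe_add, hr t ht, hr' t ht,
          add_zero]
      | smul a r _ hr =>
        rw [smul_eq_mul, mul_comm a, mul_assoc]
        exact hr _ (Ideal.mul_mem_left _ _ ht)
    · intro x y hx hy j hj
      rw [decompose_add, DirectSum.add_apply, AddSubgroup.coe_add, hx j hj, hy j hj, add_zero]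

theorem IsStandardGradedOverField.sub_sum_decompose_mem (h : IsStandardGradedOverField 𝒜)
    (n : ℕ) (x : S) :
    x - ∑ i ∈ Finset.range n, (decompose 𝒜 x i : S) ∈ maximalIdeal S ^ n := by
  induction x using Decomposition.inductionOn 𝒜 with
  | zero => simp
  | @homogeneous j x =>
    by_cases hj : j < n
    · rw [Finset.sum_eq_single j]
      · rw [decompose_of_mem_same 𝒜 x.2, sub_self]
        exact zero_mem _
      · intro i _ hi
        exact decompose_of_mem_ne 𝒜 x.2 hi.symm
      · intro hj'
        exact absurd (Finset.mem_range.2 hj) hj'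
    · rw [Finset.sum_eq_zero, sub_zero]
      · exact Ideal.pow_le_pow_right (not_lt.1 hj) (h.grade_le_pow x.2)
      · intro i hi
        refine decompose_of_mem_ne 𝒜 x.2 ?_
        rintro rfl
        exact hj (Finset.mem_range.1 hi)
  | add x y hx hy =>
    have h1 := add_mem hx hy
    rw [← add_sub_add_comm, ← Finset.sum_add_distrib] at h1
    simpa only [decompose_add, DirectSum.add_apply, AddSubgroup.coe_add] using h1

theorem IsStandardGradedOverField.sub_decompose_one_mem (h : IsStandardGradedOverField 𝒜) {x : S}
    (hx : x ∈ maximalIdeal S) : x - (decompose 𝒜 x 1 : S) ∈ maximalIdeal S ^ 2 := by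
  have h1 := h.sub_sum_decompose_mem 2 x
  rwa [Finset.sum_range_succ, Finset.sum_range_one,
    h.decompose_eq_zero (i := 1) (by rwa [pow_one]) 0 zero_lt_one, zero_add] at h1

theorem isHomogeneous_annIdeal {R : Type*} [CommRing R] {ℬ : ℕ → AddSubgroup R} [GradedRing ℬ]
    {J : Ideal R} (hJ : J.IsHomogeneous ℬ) : (annIdeal J).IsHomogeneous ℬ := by
  classical
  intro i x hx
  rw [annIdeal_def] at hx ⊢
  intro y hy
  rw [← sum_support_decompose ℬ y, Finset.mul_sum]
  refine Finset.sum_eq_zero fun j _ => ?_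
  rw [← coe_decompose_mul_add_of_right_mem ℬ (SetLike.coe_mem (decompose ℬ y j)),
    hx _ (hJ j hy), decompose_zero, DirectSum.zero_apply, AddSubgroup.coe_zero]

end Graded

/-! ### Homogeneous ideals with small quotient -/

section GradedFirst

open DirectSum

variable {S : Type u} [CommRing S] [IsLocalRing S] {𝒜 : ℕ → AddSubgroup S} [GradedRing 𝒜]
  {κ : Type*} [Field κ] [Algebra κ S]

/-- The first splitting theorem applies if `J` is homogeneous and `S / (0 :_S J)` has Hilbert
function `(1, 2, 1, 1)`. The multiplication `𝔫 / 𝔫 ^ 2 × 𝔫 / 𝔫 ^ 2 → 𝔫 ^ 2 / 𝔫 ^ 3` modulo `0 :_S J`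
is degenerate, since otherwise `𝔫 ^ 3` would be contained in `0 :_S J`, and a linear element in its
radical multiplies `𝔫` into `0 :_S J`, because this ideal is homogeneous. -/
theorem firstSplittingApplies_of_one_two_one_one (hS : IsArtinianGorensteinLocal S)
    (h𝒜 : IsStandardGradedOverField 𝒜) (hκ : IsCoefficientField κ S) {J : Ideal S}
    (hJ : J.IsHomogeneous 𝒜) (hK : annIdeal J ≤ maximalIdeal S) {u : Fin 2 → S}
    (hu : IsMinimalModulo (annIdeal J) u) (h3 : ¬ maximalIdeal S ^ 3 ≤ annIdeal J)
    (hdim : Module.finrank κ (S ⧸ (annIdeal J ⊔ maximalIdeal S ^ 3)) = 4)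
    (hv : ((3 : ℕ) : ℕ∞) ≤ vInv S) : FirstSplittingApplies J := by
  have := hS.isArtinianRing
  have hfin := finite_of_coefficientField hκ
  obtain ⟨φ, w, hw, -, -, hφ'⟩ := exists_functional hκ (K := annIdeal J)
    (by rw [hdim, finrank_quotient_sup_sq hκ hK hu])
  have hdeg : ∃ l ∈ maximalIdeal S, (∀ x ∈ maximalIdeal S,
      l * x ∈ annIdeal J ⊔ maximalIdeal S ^ 3) ∧ l ∉ annIdeal J ⊔ maximalIdeal S ^ 2 := by
    by_contra! h
    exact h3 ((pow_three_le_of_nondegenerate hκ hu le_rfl hw hφ' h).trans Ideal.mul_le_right)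
  obtain ⟨l, hl, hlx, hl2⟩ := hdeg
  have hl₁ := h𝒜.sub_decompose_one_mem hl
  refine firstSplittingApplies_of_socle hS hκ hK hu le_rfl hv (l := (decompose 𝒜 l 1 : S))
    (mem_maximalIdeal_of_mem_grade_one (SetLike.coe_mem _)) (fun h => hl2 ?_) ?_
  · rw [← sub_add_cancel l (decompose 𝒜 l 1 : S)]
    exact add_mem (Ideal.mem_sup_right hl₁) h
  · -- The quadratic part of an element of `K + 𝔫 ^ 3` is in `K`.
    intro x hx
    rw [← h𝒜.span_grade_one] at hx
    induction hx using Submodule.span_induction with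
    | mem x hx =>
      have hxn : x ∈ maximalIdeal S := mem_maximalIdeal_of_mem_grade_one hx
      have h1 : (decompose 𝒜 l 1 : S) * x ∈ annIdeal J ⊔ maximalIdeal S ^ 3 := by
        have h2 := sub_mem (hlx x hxn) (Ideal.mem_sup_right (S := annIdeal J)
          (show (l - decompose 𝒜 l 1) * x ∈ maximalIdeal S ^ 3 by
            rw [pow_succ]
            exact Ideal.mul_mem_mul hl₁ hxn))
        convert! h2 using 1
        ring
      have h2 : (decompose 𝒜 l 1 : S) * x ∈ 𝒜 2 :=
        SetLike.GradedMul.mul_mem (SetLike.coe_mem _) hx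
      obtain ⟨y, hy, t, ht, hyt⟩ := Submodule.mem_sup.1 h1
      rw [← decompose_of_mem_same 𝒜 h2, ← hyt, decompose_add, DirectSum.add_apply,
        AddSubgroup.coe_add, h𝒜.decompose_eq_zero ht 2 (by norm_num), add_zero]
      exact isHomogeneous_annIdeal hJ 2 hy
    | zero => rw [mul_zero]; exact zero_mem _
    | add x y _ _ hx hy => rw [mul_add]; exact add_mem hx hy
    | smul a x _ hx =>
      rw [smul_eq_mul, mul_left_comm]
      exact Ideal.mul_mem_left _ _ hx

/-- If `𝔫 ^ 3 ⊆ 𝔫 K`, then the homogeneous ideal `K` is generated in degrees at most two, by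
Nakayama's lemma. -/
theorem IsStandardGradedOverField.maxGenDeg_le_two [IsNoetherianRing S]
    (h𝒜 : IsStandardGradedOverField 𝒜) {K : Ideal S} (hK : K.IsHomogeneous 𝒜)
    (h3 : maximalIdeal S ^ 3 ≤ maximalIdeal S * K) : maxGenDeg 𝒜 K ≤ 2 := by
  refine sInf_le ?_
  set G := {x : S | x ∈ K ∧ ∃ j : ℕ, (((j : ℕ∞) : WithBot ℕ∞) ≤ 2) ∧ x ∈ 𝒜 j} with hG
  refine le_antisymm (Ideal.span_le.2 fun x hx => hx.1) ?_
  apply le_of_le_sup_maximalIdeal_mul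
  intro x hx
  rw [← sub_add_cancel x (∑ i ∈ Finset.range 3, (decompose 𝒜 x i : S))]
  refine add_mem (Ideal.mem_sup_right (h3 (h𝒜.sub_sum_decompose_mem 3 x)))
    (Ideal.mem_sup_left (sum_mem fun i hi => Ideal.subset_span ⟨hK i hx, i, ?_, SetLike.coe_mem _⟩))
  have hi' := Finset.mem_range.1 hi
  interval_cases i
  · norm_num
  · norm_num
  · norm_num

/-- Generators modulo `K` can be replaced by their linear parts. -/
theorem IsStandardGradedOverField.isMinimalModulo_decompose [IsNoetherianRing S]
    (h𝒜 : IsStandardGradedOverField 𝒜) {K : Ideal S} {k : ℕ} (hk : minGeneratorsMaxMod K = k)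
    {u : Fin k → S} (hu : IsMinimalModulo K u) :
    IsMinimalModulo K fun i => (decompose 𝒜 (u i) 1 : S) := by
  refine isMinimalModulo_of_le_span hk
    (fun i => mem_maximalIdeal_of_mem_grade_one (SetLike.coe_mem _)) ?_
  apply le_of_le_sup_maximalIdeal_mul
  rw [← pow_two]
  refine hu.le_span.trans (sup_le ?_ (le_sup_right.trans le_sup_left))
  rw [Ideal.span_le]
  rintro _ ⟨i, rfl⟩
  have h1 := add_mem (Ideal.mem_sup_right (S := Ideal.span (Set.range fun i =>
    (decompose 𝒜 (u i) 1 : S)) ⊔ K) (h𝒜.sub_decompose_one_mem (hu.mem i)))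
    (Ideal.mem_sup_left (Ideal.mem_sup_left (Ideal.subset_span (Set.mem_range_self i))))
  rwa [sub_add_cancel] at h1

theorem IsStandardGradedOverField.le_span_inter (h𝒜 : IsStandardGradedOverField 𝒜) {K : Ideal S}
    (hK : K.IsHomogeneous 𝒜) (hKn : K ≤ maximalIdeal S) :
    K ≤ Ideal.span ((K : Set S) ∩ 𝒜 1) ⊔ maximalIdeal S ^ 2 := by
  intro x hx
  rw [← sub_add_cancel x (decompose 𝒜 x 1 : S)]
  exact add_mem (Ideal.mem_sup_right (h𝒜.sub_decompose_one_mem (hKn hx)))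
    (Ideal.mem_sup_left (Ideal.subset_span ⟨hK 1 hx, SetLike.coe_mem _⟩))

open MvPolynomial in
theorem aeval_mem_grade {R : Type*} [CommRing R] {ℬ : ℕ → AddSubgroup R} [GradedRing ℬ]
    {κ : Type*} [Field κ] [Algebra κ R] (h0 : ∀ a : κ, algebraMap κ R a ∈ ℬ 0) {σ : Type*}
    {x : σ → R} (hx : ∀ i, x i ∈ ℬ 1) {d : ℕ} {F : MvPolynomial σ κ} (hF : F.IsHomogeneous d) :
    aeval x F ∈ ℬ d := by
  rw [aeval_def, eval₂_eq]
  refine sum_mem fun m hm => ?_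
  have h1 : ∏ i ∈ m.support, x i ^ m i ∈ ℬ (∑ i ∈ m.support, m i • 1) :=
    SetLike.prod_pow_mem_graded ℬ (fun _ => 1) x m fun i _ => hx i
  have h2 : ∑ i ∈ m.support, m i • 1 = d := by
    have h3 := hF (mem_support_iff.1 hm)
    rw [← h3]
    simp [Finsupp.weight_apply, Finsupp.sum]
  rw [h2] at h1
  have h4 := SetLike.GradedMul.mul_mem (h0 (coeff m F)) h1
  rwa [zero_add] at h4

open MvPolynomial in
theorem aeval_homogeneousComponent {R : Type*} [CommRing R] {ℬ : ℕ → AddSubgroup R} [GradedRing ℬ]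
    {κ : Type*} [Field κ] [Algebra κ R] (h0 : ∀ a : κ, algebraMap κ R a ∈ ℬ 0) {σ : Type*}
    {x : σ → R} (hx : ∀ i, x i ∈ ℬ 1) (p : MvPolynomial σ κ) (i : ℕ) :
    aeval x (homogeneousComponent i p) = decompose ℬ (aeval x p) i := by
  have hmem : ∀ j, aeval x (homogeneousComponent j p) ∈ ℬ j := fun j =>
    aeval_mem_grade h0 hx (homogeneousComponent_isHomogeneous j p)
  conv_rhs => rw [← sum_homogeneousComponent p, map_sum, decompose_sum,
    DFinsupp.finsetSum_apply, AddSubmonoidClass.coe_finsetSum]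
  rw [Finset.sum_eq_single i]
  · rw [decompose_of_mem_same ℬ (hmem i)]
  · intro j _ hj
    exact decompose_of_mem_ne ℬ (hmem j) hj
  · intro hi
    rw [homogeneousComponent_eq_zero _ _ (by simpa using hi), map_zero, decompose_zero,
      DirectSum.zero_apply, AddSubgroup.coe_zero]

end GradedFirst

/-! ### The third splitting theorem -/

section Third

open MvPolynomial DirectSum

/-- If a linear map sends the six-dimensional space of ternary quadratic forms onto a line, then the
forms in its kernel have a basis of five elements. -/
theorem exists_quadrics {κ : Type*} [Field κ] {M : Type*} [AddCommGroup M] [Module κ M]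
    (g : MvPolynomial (Fin 3) κ →ₗ[κ] M) {w : M}
    (hw : ∀ F : MvPolynomial (Fin 3) κ, F.IsHomogeneous 2 → ∃ c : κ, g F = c • w)
    (hne : ∃ F : MvPolynomial (Fin 3) κ, F.IsHomogeneous 2 ∧ g F ≠ 0) :
    ∃ Q : Fin 5 → MvPolynomial (Fin 3) κ, (∀ i, (Q i).IsHomogeneous 2) ∧ LinearIndependent κ Q ∧
      (∀ i, g (Q i) = 0) ∧
      ∀ F : MvPolynomial (Fin 3) κ, F.IsHomogeneous 2 → g F = 0 →
        F ∈ Submodule.span κ (Set.range Q) := by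
  classical
  set A : Finset (Fin 3 →₀ ℕ) := Finset.finsuppAntidiag Finset.univ 2 with hA
  have hmemA : ∀ e, e ∈ A ↔ e.degree = 2 := by
    intro e
    rw [hA, Finset.mem_finsuppAntidiag, Finsupp.degree_eq_sum]
    simp
  have hcard : Fintype.card A = 6 := by
    rw [Fintype.card_coe, hA, Finset.card_finsuppAntidiag_nat_eq_choose]
    rfl
  let L : (A → κ) →ₗ[κ] MvPolynomial (Fin 3) κ :=
    Fintype.linearCombination κ fun e : A => monomial (e : Fin 3 →₀ ℕ) (1 : κ)
  have hL : ∀ a, L a = ∑ e : A, monomial (e : Fin 3 →₀ ℕ) (a e) := by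
    intro a
    rw [Fintype.linearCombination_apply]
    refine Finset.sum_congr rfl fun e _ => ?_
    rw [smul_monomial, smul_eq_mul, mul_one]
  have hcoeff : ∀ a (e : A), coeff (e : Fin 3 →₀ ℕ) (L a) = a e := by
    intro a e
    rw [hL, coeff_sum, Finset.sum_eq_single e]
    · rw [coeff_monomial, if_pos rfl]
    · intro f _ hf
      rw [coeff_monomial, if_neg fun h => hf (Subtype.ext h)]
    · exact fun h => absurd (Finset.mem_univ e) h
  have hinj : Function.Injective L := fun a b hab => funext fun e => by
    rw [← hcoeff a, hab, hcoeff]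
  have hhom : ∀ a, (L a).IsHomogeneous 2 := fun a => by
    rw [hL]
    exact IsHomogeneous.sum _ _ _ fun e _ => isHomogeneous_monomial _ ((hmemA e).1 e.2)
  have hsurj : ∀ F : MvPolynomial (Fin 3) κ, F.IsHomogeneous 2 → ∃ a, L a = F := by
    intro F hF
    refine ⟨fun e => coeff e F, ?_⟩
    ext m
    by_cases hm : m ∈ A
    · exact hcoeff _ ⟨m, hm⟩
    · rw [(hhom _).coeff_eq_zero (mt (hmemA m).2 hm), hF.coeff_eq_zero (mt (hmemA m).2 hm)]
  let ψ : (A → κ) →ₗ[κ] M := g ∘ₗ L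
  have hrange : Module.finrank κ (LinearMap.range ψ) = 1 := by
    obtain ⟨F, hF, hgF⟩ := hne
    obtain ⟨a, rfl⟩ := hsurj F hF
    refine finrank_eq_one (⟨ψ a, a, rfl⟩ : LinearMap.range ψ)
      (fun h => hgF (congrArg Subtype.val h)) ?_
    rintro ⟨_, b, rfl⟩
    obtain ⟨c, hc⟩ := hw _ (hhom a)
    obtain ⟨d, hd⟩ := hw _ (hhom b)
    have hc0 : c ≠ 0 := by
      rintro rfl
      exact hgF (by rw [hc, zero_smul])
    refine ⟨d / c, Subtype.ext ?_⟩
    change (d / c) • g (L a) = g (L b)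
    rw [hc, hd, smul_smul, div_mul_cancel₀ _ hc0]
  have hker : Module.finrank κ (LinearMap.ker ψ) = 5 := by
    have h1 := LinearMap.finrank_range_add_finrank_ker ψ
    rw [hrange, Module.finrank_fintype_fun_eq_card, hcard] at h1
    omega
  let b := Module.finBasisOfFinrankEq κ (LinearMap.ker ψ) hker
  refine ⟨fun i => L (b i), fun i => hhom _, ?_, fun i => (b i).2, fun F hF hgF => ?_⟩
  · exact (b.linearIndependent.map' (LinearMap.ker ψ).subtype (Submodule.ker_subtype _)).map' L
      (LinearMap.ker_eq_bot.2 hinj)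
  · obtain ⟨a, rfl⟩ := hsurj F hF
    have h1 : (⟨a, hgF⟩ : LinearMap.ker ψ) ∈ Submodule.span κ (Set.range b) := by
      rw [b.span_eq]
      exact Submodule.mem_top
    have h2 := Submodule.mem_map_of_mem (f := L ∘ₗ (LinearMap.ker ψ).subtype) h1
    rw [Submodule.map_span, ← Set.range_comp] at h2
    exact h2

theorem sub_rename_aeval_mem_span {κ : Type*} [Field κ] {σ τ : Type*}
    (p : MvPolynomial (σ ⊕ τ) κ) :
    p - rename Sum.inl (aeval (Sum.elim X 0 : σ ⊕ τ → MvPolynomial σ κ) p) ∈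
      Ideal.span (Set.range fun j : τ => (X (Sum.inr j) : MvPolynomial (σ ⊕ τ) κ)) := by
  have h := aeval_sumElim_sub_mem_span (κ := κ)
    (fun i : σ => (X (Sum.inl i) : MvPolynomial (σ ⊕ τ) κ)) (fun j : τ => X (Sum.inr j)) p
  have h1 : (Sum.elim (fun i => X (Sum.inl i)) fun j => X (Sum.inr j) :
      σ ⊕ τ → MvPolynomial (σ ⊕ τ) κ) = X := by
    ext1 (i | j) <;> rfl
  rw [h1, aeval_X_left_apply] at h
  rwa [rename_eq_aeval]

variable {S : Type u} [CommRing S] [IsLocalRing S] {𝒜 : ℕ → AddSubgroup S} [GradedRing 𝒜]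
  {κ : Type u} [Field κ] [Algebra κ S]

/-- The third splitting theorem applies if `J` is homogeneous and `S / (0 :_S J)` is Gorenstein with
Hilbert function `(1, 3, 1)`. The quadratic forms `Q` in three variables whose values lie in
`0 :_S J` form a space of dimension five, and together with linear elements their values generate
`0 :_S J`, as `𝔫 ^ 3 ⊆ 𝔫 (0 :_S J)`. -/
theorem thirdSplittingApplies_of_one_three_one (hS : IsArtinianGorensteinLocal S)
    (h𝒜 : IsStandardGradedOverField 𝒜) (hκ : IsCoefficientField κ S)
    (h0 : ∀ a : κ, algebraMap κ S a ∈ 𝒜 0) {J : Ideal S}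
    (hJ : J.IsHomogeneous 𝒜) (hK : annIdeal J ≤ maximalIdeal S)
    (hk : minGeneratorsMaxMod (annIdeal J) = 3) (hdim : Module.finrank κ (S ⧸ annIdeal J) = 5)
    (hnd : ∀ l ∈ maximalIdeal S, (∀ x ∈ maximalIdeal S, l * x ∈ annIdeal J) →
      l ∈ annIdeal J ⊔ maximalIdeal S ^ 2)
    (hv : ((5 : ℕ) : ℕ∞) ≤ vInv S) : ThirdSplittingApplies J := by
  have := hS.isArtinianRing
  have hfin := finite_of_coefficientField hκ
  set K := annIdeal J with hKdef
  obtain ⟨u₀, hu₀⟩ := exists_isMinimalModulo hk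
  obtain ⟨u, hu, hu1⟩ : ∃ u : Fin 3 → S, IsMinimalModulo K u ∧ ∀ i, u i ∈ 𝒜 1 :=
    ⟨_, h𝒜.isMinimalModulo_decompose hk hu₀, fun i => SetLike.coe_mem _⟩
  obtain ⟨s, z, hz1, hz⟩ := hu.exists_isAdaptedSystem (Z := (K : Set S) ∩ 𝒜 1)
    Set.inter_subset_left (fun x hx => hK hx.1)
    (h𝒜.le_span_inter (isHomogeneous_annIdeal hJ) hK)
  have h3 := pow_three_le_of_finrank_eq hκ hK hu hdim
  have h3' := pow_three_le_maximalIdeal_mul hκ hK hu (by norm_num) hdim hnd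
  obtain ⟨φ, w, -, hφw, hφ, hφ'⟩ := exists_functional_of_finrank_eq hκ hK hu hdim
  have hK3 : K ⊔ maximalIdeal S ^ 3 = K := sup_eq_left.2 h3
  have hu2 : ∀ F : MvPolynomial (Fin 3) κ, F.IsHomogeneous 2 → aeval u F ∈ maximalIdeal S ^ 2 :=
    fun F hF => h𝒜.grade_le_pow (aeval_mem_grade h0 hu1 hF)
  let g : MvPolynomial (Fin 3) κ →ₗ[κ] S ⧸ K :=
    ((Ideal.Quotient.mkₐ κ K).comp (aeval u)).toLinearMap
  have hg : ∀ F, g F = 0 ↔ aeval u F ∈ K := fun F => Ideal.Quotient.eq_zero_iff_mem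
  obtain ⟨Q, hQ, hQind, hQ0, hQspan⟩ := exists_quadrics g (w := Ideal.Quotient.mk K w)
    (by
      intro F hF
      refine ⟨φ (aeval u F), ?_⟩
      rw [Algebra.smul_def]
      change Ideal.Quotient.mk K _ = Ideal.Quotient.mk K (algebraMap κ S (φ (aeval u F)) * w)
      rw [Ideal.Quotient.eq, ← hK3]
      exact hφ' _ (hu2 F hF))
    (by
      by_contra! h
      have h2 : maximalIdeal S ^ 2 ≤ K := by
        intro x hx
        obtain ⟨F, hF, hxF⟩ := hz.exists_form hκ hx
        have h4 := add_mem (sup_le hz.span_le h3 hxF) ((hg F).1 (h F hF))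
        rwa [sub_add_cancel] at h4
      have hD2 := finrank_quotient_sup_sq hκ hK hu
      rw [sup_eq_left.2 h2, hdim] at hD2
      omega)
  have hQK : ∀ i, aeval u (Q i) ∈ K := fun i => (hg _).1 (hQ0 i)
  have hgrade : ∀ i, Sum.elim u z i ∈ 𝒜 1 := by
    rintro (i | j)
    · exact hu1 i
    · exact (hz1 j).2
  let π : MvPolynomial (Fin 3 ⊕ Fin s) κ →ₐ[κ] S := aeval (Sum.elim u z)
  have hπ : Function.Surjective π.toRingHom := aeval_surjective hκ hz.span_eq
  have hπQ : ∀ F, π (rename Sum.inl F) = aeval u F := by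
    intro F
    rw [aeval_rename, Sum.elim_comp_inl]
  have hB : (idealB' s Q ⊔ idealB'' κ s).map π.toRingHom = K := by
    rw [Ideal.map_sup, idealB', idealB'', Ideal.map_span, Ideal.map_span, ← Set.range_comp,
      ← Set.range_comp]
    have h1 : π.toRingHom ∘ (fun i => rename Sum.inl (Q i)) = fun i => aeval u (Q i) :=
      funext fun i => hπQ (Q i)
    have h2 : π.toRingHom ∘
        (fun j : Fin s => (X (Sum.inr j) : MvPolynomial (Fin 3 ⊕ Fin s) κ)) = z :=
      funext fun j => aeval_X (R := κ) (Sum.elim u z) (Sum.inr j)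
    rw [h1, h2]
    refine le_antisymm (sup_le ?_ hz.span_le) ?_
    · rw [Ideal.span_le]
      rintro _ ⟨i, rfl⟩
      exact hQK i
    · apply le_of_le_sup_maximalIdeal_mul
      intro x hx
      obtain ⟨F, hF, hFK, hxF⟩ := hz.exists_quadratic_form hκ hK hu h3 hx
      have h4 : Submodule.span κ (Set.range Q) ≤ ((Ideal.span (Set.range fun i =>
          aeval u (Q i))).restrictScalars κ).comap (aeval u).toLinearMap := by
        rw [Submodule.span_le]
        rintro _ ⟨i, rfl⟩
        exact Ideal.subset_span (Set.mem_range_self i)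
      have h6 : Ideal.span (Set.range z) ⊔ maximalIdeal S ^ 3 ≤
          (Ideal.span (Set.range fun i => aeval u (Q i)) ⊔ Ideal.span (Set.range z)) ⊔
            maximalIdeal S * K := sup_le_sup le_sup_right h3'
      have h5 : aeval u F ∈ Ideal.span (Set.range fun i => aeval u (Q i)) :=
        h4 (hQspan F hF ((hg F).2 hFK))
      have h7 := add_mem (h6 hxF) (Ideal.mem_sup_left (Ideal.mem_sup_left h5))
      rwa [sub_add_cancel] at h7
  refine ⟨κ, inferInstance, s, Q, RingHom.ker π.toRingHom, π.toRingHom, hπ, rfl,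
    ⟨hQ, hQind, ?_, ?_, ?_, ?_⟩, comap_eq_colon hS hπ hB⟩
  · intro p hp i
    have hp' : aeval (Sum.elim u z) p = 0 := hp
    change aeval (Sum.elim u z) (homogeneousComponent i p) = 0
    rw [aeval_homogeneousComponent h0 hgrade, hp', decompose_zero, DirectSum.zero_apply,
      AddSubgroup.coe_zero]
  · intro p hp
    exact ker_aeval_le_pow hz.span_eq (by simpa using hz.card) hv hp
  · exact hS.of_ringEquiv (RingHom.quotientKerEquivOfSurjective hπ).symm
  · intro l hl hlB
    -- By nondegeneracy, the part of `l` in the first three variables vanishes.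
    have hln : π l ∈ maximalIdeal S := by
      have h1 := h𝒜.grade_le_pow (aeval_mem_grade h0 hgrade hl)
      rwa [pow_one] at h1
    have hlK : ∀ x ∈ maximalIdeal S, π l * x ∈ K := by
      intro x hx
      rw [← hz.span_eq] at hx
      induction hx using Submodule.span_induction with
      | mem x hx =>
        obtain ⟨i, rfl⟩ := hx
        have h1 := Ideal.mem_map_of_mem π.toRingHom
          (hlB (X i) (Ideal.subset_span (Set.mem_range_self i)))
        rw [hB] at h1
        have h2 : π (X i * l) = Sum.elim u z i * π l := by rw [map_mul, aeval_X]
        rw [mul_comm, ← h2]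
        exact h1
      | zero => rw [mul_zero]; exact zero_mem _
      | add x y _ _ hx hy => rw [mul_add]; exact add_mem hx hy
      | smul a x _ hx =>
        rw [smul_eq_mul, mul_left_comm]
        exact Ideal.mul_mem_left _ _ hx
    have h1 := hnd _ hln hlK
    have h2 : (aeval (Sum.elim X 0 : Fin 3 ⊕ Fin s → MvPolynomial (Fin 3) κ)
        l).IsHomogeneous 1 := by
      refine IsHomogeneous.aeval hl _ (n := 1) ?_
      rintro (i | j)
      · exact isHomogeneous_X κ i
      · exact isHomogeneous_zero _ _ _
    have h4 : π l - aeval u (aeval (Sum.elim X 0 : Fin 3 ⊕ Fin s → MvPolynomial (Fin 3) κ) l) ∈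
        Ideal.span (Set.range z) := aeval_sumElim_sub_mem_span u z l
    have h1' : π l ∈ Ideal.span (Set.range z) ⊔ maximalIdeal S ^ 2 :=
      (sup_le (hz.le_span hK hu) le_sup_right : K ⊔ maximalIdeal S ^ 2 ≤ _) h1
    have h4' := sub_mem h1' (Ideal.mem_sup_left h4)
    rw [sub_sub_cancel] at h4'
    have h5 := hz.eq_zero_of_isHomogeneous hκ hv (by norm_num) h2 h4'
    have h6 := sub_rename_aeval_mem_span l
    rw [h5, map_zero, sub_zero] at h6
    exact Ideal.mem_sup_right h6

end Third

/-! ### The splitting theorems for small colength -/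

section Main

theorem exists_algebra_isCoefficientField {S : Type u} [CommRing S] [IsLocalRing S]
    [IsArtinianRing S] (h : IsEquicharacteristic S) :
    ∃ (κ : Type u) (_ : Field κ) (_ : Algebra κ S), IsCoefficientField κ S := by
  obtain ⟨σ, hσ⟩ := exists_coefficientField S h
  refine ⟨ResidueField S, inferInstance, σ.toAlgebra, fun s => ⟨residue S s, ?_⟩⟩
  rw [← residue_eq_zero_iff, map_sub]
  change residue S s - residue S (σ (residue S s)) = 0
  rw [hσ, sub_self]

theorem annIdeal_le_maximalIdeal {S : Type u} [CommRing S] [IsLocalRing S] {J : Ideal S}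
    (hJ : J ≠ ⊥) : annIdeal J ≤ maximalIdeal S := by
  refine le_maximalIdeal fun h => hJ (eq_bot_iff.2 fun y hy => ?_)
  have h1 := (annIdeal_def J 1).1 (h ▸ Submodule.mem_top) y hy
  rwa [one_mul] at h1

variable {S : Type u} [CommRing S] [IsLocalRing S]

theorem firstSplittingApplies_of_minGenerators_eq_zero (hS : IsArtinianGorensteinLocal S)
    (he : 2 ≤ embeddingDim S) {J : Ideal S} (hK : annIdeal J ≤ maximalIdeal S)
    (hk : minGeneratorsMaxMod (annIdeal J) = 0) : FirstSplittingApplies J := by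
  have := hS.isArtinianRing
  obtain ⟨u, hu⟩ := exists_isMinimalModulo hk
  refine firstSplittingApplies_of_annIdeal_eq hS he (le_antisymm hK ?_)
  have h1 := hu.le_span
  rwa [Set.range_eq_empty, Ideal.span_empty, bot_sup_eq] at h1

theorem firstSplittingApplies_of_one_two_one (hS : IsArtinianGorensteinLocal S) {κ : Type*}
    [Field κ] [Algebra κ S] (hκ : IsCoefficientField κ S) {J : Ideal S}
    (hK : annIdeal J ≤ maximalIdeal S) (hk : minGeneratorsMaxMod (annIdeal J) = 2)
    (hdim : Module.finrank κ (S ⧸ annIdeal J) = 4)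
    (h3 : ¬ maximalIdeal S ^ 3 ≤ maximalIdeal S * annIdeal J) (hv : ((3 : ℕ) : ℕ∞) ≤ vInv S) :
    FirstSplittingApplies J := by
  have := hS.isArtinianRing
  have := finite_of_coefficientField hκ
  obtain ⟨u, hu⟩ := exists_isMinimalModulo hk
  refine (firstSplittingApplies_or_nondegenerate hS hκ hK hu le_rfl hv).resolve_right fun h => h3 ?_
  exact pow_three_le_maximalIdeal_mul hκ hK hu le_rfl hdim h

variable {𝒜 : ℕ → AddSubgroup S} [GradedRing 𝒜]

/-- The Hilbert function of `S / (0 :_S J)` is `(1, 2, 2)` or `(1, 2, 1, 1)`. -/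
theorem firstSplittingApplies_of_two_of_finrank_eq_five (hS : IsArtinianGorensteinLocal S)
    (h𝒜 : IsStandardGradedOverField 𝒜) {κ : Type*} [Field κ] [Algebra κ S]
    (hκ : IsCoefficientField κ S) {J : Ideal S} (hJ : J.IsHomogeneous 𝒜)
    (hK : annIdeal J ≤ maximalIdeal S) (hk : minGeneratorsMaxMod (annIdeal J) = 2)
    (hdim : Module.finrank κ (S ⧸ annIdeal J) = 5) (hv : ((4 : ℕ) : ℕ∞) ≤ vInv S) :
    FirstSplittingApplies J := by
  have := hS.isArtinianRing
  have := finite_of_coefficientField hκ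
  obtain ⟨u, hu⟩ := exists_isMinimalModulo hk
  have hD2 := finrank_quotient_sup_sq hκ hK hu
  by_cases h3 : maximalIdeal S ^ 3 ≤ annIdeal J
  · exact firstSplittingApplies_of_one_two_two hS hκ hK hu h3 hdim.ge hv
  · have h2 : ¬ maximalIdeal S ^ 2 ≤ annIdeal J := fun h =>
      h3 ((Ideal.pow_le_pow_right (by norm_num)).trans h)
    have hD3 := (pow_le_or_finrank_lt (κ := κ) (annIdeal J) 2).resolve_left h2
    have hD4 := (pow_le_or_finrank_lt (κ := κ) (annIdeal J) 3).resolve_left h3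
    have hD5 := finrank_quotient_mono (κ := κ)
      (le_sup_left : annIdeal J ≤ annIdeal J ⊔ maximalIdeal S ^ (3 + 1))
    refine firstSplittingApplies_of_one_two_one_one hS h𝒜 hκ hJ hK hu h3 ?_
      (le_trans (by norm_cast) hv)
    rw [show 2 + 1 = 3 from rfl] at hD3
    omega

/-- If no socle element makes the first splitting theorem apply, then `𝔫 ^ 3 ⊆ 𝔫 (0 :_S J)`, and so
`0 :_S J` is generated in degrees at most two. -/
theorem firstSplittingApplies_of_three_le_maxGenDeg (hS : IsArtinianGorensteinLocal S)
    (h𝒜 : IsStandardGradedOverField 𝒜) {κ : Type*} [Field κ] [Algebra κ S]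
    (hκ : IsCoefficientField κ S) {J : Ideal S} (hJ : J.IsHomogeneous 𝒜)
    (hK : annIdeal J ≤ maximalIdeal S) (hk : minGeneratorsMaxMod (annIdeal J) = 3)
    (hdim : Module.finrank κ (S ⧸ annIdeal J) = 5) (hdeg : 3 ≤ maxGenDeg 𝒜 (annIdeal J))
    (hv : ((3 : ℕ) : ℕ∞) ≤ vInv S) : FirstSplittingApplies J := by
  have := hS.isArtinianRing
  have := finite_of_coefficientField hκ
  obtain ⟨u, hu⟩ := exists_isMinimalModulo hk
  refine (firstSplittingApplies_or_nondegenerate hS hκ hK hu (by norm_num) hv).resolve_right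
    fun h => ?_
  have h1 := hdeg.trans (h𝒜.maxGenDeg_le_two (isHomogeneous_annIdeal hJ)
    (pow_three_le_maximalIdeal_mul hκ hK hu (by norm_num) hdim h))
  exact absurd h1 (by decide)

theorem firstSplittingApplies_of_two_le_socleDim (hS : IsArtinianGorensteinLocal S)
    {κ : Type*} [Field κ] [Algebra κ S] (hκ : IsCoefficientField κ S) {J : Ideal S}
    (hK : annIdeal J ≤ maximalIdeal S) (hk : minGeneratorsMaxMod (annIdeal J) = 3)
    (hdim : Module.finrank κ (S ⧸ annIdeal J) = 5) (hsoc : 2 ≤ socleDim (annIdeal J))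
    (hv : ((3 : ℕ) : ℕ∞) ≤ vInv S) : FirstSplittingApplies J := by
  have := hS.isArtinianRing
  have := finite_of_coefficientField hκ
  obtain ⟨u, hu⟩ := exists_isMinimalModulo hk
  refine (firstSplittingApplies_or_nondegenerate hS hκ hK hu (by norm_num) hv).resolve_right
    fun h => ?_
  have h1 := socleDim_le_one hκ hK hu (by norm_num) hdim h
  omega

theorem thirdSplittingApplies_of_socleDim_le_one (hS : IsArtinianGorensteinLocal S)
    (h𝒜 : IsStandardGradedOverField 𝒜) {J : Ideal S} (hJ : J.IsHomogeneous 𝒜)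
    (hK : annIdeal J ≤ maximalIdeal S) (hk : minGeneratorsMaxMod (annIdeal J) = 3)
    (hc : colength J = 5) (hsoc : socleDim (annIdeal J) ≤ 1) (hv : ((5 : ℕ) : ℕ∞) ≤ vInv S) :
    ThirdSplittingApplies J := by
  have := hS.isArtinianRing
  obtain ⟨κ, _, _, hκ, h0⟩ := h𝒜.exists_coefficientField
  have := finite_of_coefficientField hκ
  have hdim : Module.finrank κ (S ⧸ annIdeal J) = 5 := by
    rw [colength_eq_finrank hS hκ] at hc
    exact_mod_cast hc
  obtain ⟨u, hu⟩ := exists_isMinimalModulo hk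
  exact thirdSplittingApplies_of_one_three_one hS h𝒜 hκ h0 hJ hK hk hdim
    (fun l _ hl => mem_sup_sq_of_socleDim_le_one hκ hK hu hdim hsoc hl) hv

end Main

theorem mainTheorem2 :
    ∃ N : ℕ, ∀ (S : Type u) [CommRing S] [IsLocalRing S] (_ : IsArtinianGorensteinLocal S)
      (_ : IsEquicharacteristic S) (_ : 2 ≤ embeddingDim S) (J : Ideal S) (_ : J ≠ ⊥) (_ : J ≠ ⊤)
      (_ : (1 ≤ colength J ∧ colength J ≤ 4) ∨
        (colength J = 5 ∧ ∃ (𝒜 : ℕ → AddSubgroup S) (_ : GradedRing 𝒜),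
          IsStandardGradedOverField 𝒜)),
      -- one of the splitting theorems applies if `v(S)` is large
      ((colength J ≤ 4 ∨ ∃ (𝒜 : ℕ → AddSubgroup S) (_ : GradedRing 𝒜),
          IsStandardGradedOverField 𝒜 ∧ J.IsHomogeneous 𝒜) →
        (N : ℕ∞) ≤ vInv S →
        FirstSplittingApplies J ∨ SecondSplittingApplies J ∨ ThirdSplittingApplies J) ∧
      -- (a)
      (minGeneratorsMaxMod (annIdeal J) = 0 → FirstSplittingApplies J) ∧
      -- (b)
      (minGeneratorsMaxMod (annIdeal J) = 1 → 2 * colength J ≤ vInv S →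
        SecondSplittingApplies J) ∧
      -- (c)
      (2 ≤ minGeneratorsMaxMod (annIdeal J) →
        (minGeneratorsMaxMod (annIdeal J) : ℕ∞) + 1 = colength J → 3 ≤ vInv S →
        FirstSplittingApplies J) ∧
      -- (d)
      (minGeneratorsMaxMod (annIdeal J) = 2 → colength J = 4 →
        maximalIdeal S ^ 3 ≤ maximalIdeal S * annIdeal J → 5 ≤ vInv S →
        SecondSplittingApplies J) ∧
      -- (e)
      (minGeneratorsMaxMod (annIdeal J) = 2 → colength J = 4 →
        ¬ maximalIdeal S ^ 3 ≤ maximalIdeal S * annIdeal J → 4 ≤ vInv S →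
        FirstSplittingApplies J) ∧
      -- the graded assertions
      (∀ (𝒜 : ℕ → AddSubgroup S) [GradedRing 𝒜], IsStandardGradedOverField 𝒜 →
        J.IsHomogeneous 𝒜 → colength J = 5 →
        -- (f)
        (minGeneratorsMaxMod (annIdeal J) = 2 → 4 ≤ vInv S → FirstSplittingApplies J) ∧
        -- (g)
        (minGeneratorsMaxMod (annIdeal J) = 3 → 3 ≤ maxGenDeg 𝒜 (annIdeal J) → 3 ≤ vInv S →
          FirstSplittingApplies J) ∧
        -- (h)
        (minGeneratorsMaxMod (annIdeal J) = 3 → 2 ≤ socleDim (annIdeal J) → 3 ≤ vInv S →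
          FirstSplittingApplies J) ∧
        -- (i)
        (minGeneratorsMaxMod (annIdeal J) = 3 → maxGenDeg 𝒜 (annIdeal J) ≤ 2 →
          socleDim (annIdeal J) = 1 → 5 ≤ vInv S → ThirdSplittingApplies J)) := by
  -- The largest lower bound for `v(S)` in the cases below is `2 * 5`, for one generator.
  refine ⟨10, ?_⟩
  intro S _ _ hS hequi he J hJ _ hcases
  have := hS.isArtinianRing
  obtain ⟨κ, _, _, hκ⟩ := exists_algebra_isCoefficientField hequi
  have hfin := finite_of_coefficientField hκ
  have hK := annIdeal_le_maximalIdeal hJ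
  have hc := colength_eq_finrank hS hκ J
  set c := Module.finrank κ (S ⧸ annIdeal J) with hcdef
  have hc5 : c ≤ 5 := by
    rcases hcases with h | h
    · have h1 := h.2
      rw [hc] at h1
      have h2 : c ≤ 4 := by exact_mod_cast h1
      omega
    · have h1 := h.1
      rw [hc] at h1
      have h2 : c = 5 := by exact_mod_cast h1
      omega
  have hk : ∃ k, minGeneratorsMaxMod (annIdeal J) = k ∧ k + 1 ≤ c := by
    obtain ⟨u, hu⟩ := exists_isMinimalModulo (K := annIdeal J) rfl
    refine ⟨_, rfl, ?_⟩
    rw [← finrank_quotient_sup_sq hκ hK hu]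
    exact finrank_quotient_mono le_sup_left
  have hv : ∀ {m n : ℕ}, m ≤ n → (n : ℕ∞) ≤ vInv S → (m : ℕ∞) ≤ vInv S := fun hmn h =>
    le_trans (by exact_mod_cast hmn) h
  have ha := firstSplittingApplies_of_minGenerators_eq_zero hS he hK
  have hb : minGeneratorsMaxMod (annIdeal J) = 1 → ((2 * c : ℕ) : ℕ∞) ≤ vInv S →
      SecondSplittingApplies J := by
    intro hk hv
    obtain ⟨u, hu⟩ := exists_isMinimalModulo hk
    exact secondSplittingApplies_of_one hS he hκ hK hu hv
  have hc' : 2 ≤ minGeneratorsMaxMod (annIdeal J) → minGeneratorsMaxMod (annIdeal J) + 1 = c →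
      ((3 : ℕ) : ℕ∞) ≤ vInv S → FirstSplittingApplies J := by
    intro hk hkc hv
    obtain ⟨u, hu⟩ := exists_isMinimalModulo (K := annIdeal J) rfl
    exact firstSplittingApplies_of_finrank_eq hS hκ hK hu hk hkc.symm hv
  have hd := fun hk hc h3 hv => secondSplittingApplies_of_one_two_one hS hκ (J := J) hK hk hc h3 hv
  have he' := fun hk hc h3 hv => firstSplittingApplies_of_one_two_one hS hκ (J := J) hK hk hc h3 hv
  refine ⟨?_, ha, ?_, ?_, ?_, ?_, ?_⟩
  · intro hgr hv10
    obtain ⟨k, hk, hkc⟩ := hk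
    by_cases hk0 : k = 0
    · exact Or.inl (ha (hk.trans hk0))
    by_cases hk1 : k = 1
    · exact Or.inr (Or.inl (hb (hk.trans hk1) (hv (by omega) hv10)))
    by_cases hkc' : k + 1 = c
    · exact Or.inl (hc' (by omega) (by omega) (hv (by norm_num) hv10))
    by_cases hc4 : c = 4
    · have hk2 : minGeneratorsMaxMod (annIdeal J) = 2 := by omega
      by_cases h3 : maximalIdeal S ^ 3 ≤ maximalIdeal S * annIdeal J
      · exact Or.inr (Or.inl (hd hk2 hc4 h3 (hv (by norm_num) hv10)))
      · exact Or.inl (he' hk2 hc4 h3 (hv (by norm_num) hv10))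
    have hceq : c = 5 := by omega
    rcases hgr with h | ⟨𝒜, _, h𝒜, hJ𝒜⟩
    · rw [hc, hceq] at h
      norm_cast at h
    by_cases hk2 : k = 2
    · exact Or.inl (firstSplittingApplies_of_two_of_finrank_eq_five hS h𝒜 hκ hJ𝒜 hK (hk.trans hk2)
        hceq (hv (by norm_num) hv10))
    have hk3 : minGeneratorsMaxMod (annIdeal J) = 3 := by omega
    by_cases hsoc : 2 ≤ socleDim (annIdeal J)
    · exact Or.inl (firstSplittingApplies_of_two_le_socleDim hS hκ hK hk3 hceq hsoc
        (hv (by norm_num) hv10))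
    · exact Or.inr (Or.inr (thirdSplittingApplies_of_socleDim_le_one hS h𝒜 hJ𝒜 hK hk3
        (by rw [hc, hceq]; rfl) (by omega) (hv (by norm_num) hv10)))
  · intro hk hv
    rw [hc] at hv
    exact hb hk (by exact_mod_cast hv)
  · intro hk hkc hv
    rw [hc] at hkc
    exact hc' hk (by exact_mod_cast hkc) hv
  · intro hk hc4 h3 hv
    rw [hc] at hc4
    exact hd hk (by exact_mod_cast hc4) h3 hv
  · intro hk hc4 h3 hv4
    rw [hc] at hc4
    exact he' hk (by exact_mod_cast hc4) h3 (hv (by norm_num) hv4)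
  · intro 𝒜 _ h𝒜 hJ𝒜 hc5
    have hceq : c = 5 := by
      rw [hc] at hc5
      exact_mod_cast hc5
    exact ⟨fun hk hv => firstSplittingApplies_of_two_of_finrank_eq_five hS h𝒜 hκ hJ𝒜 hK hk hceq hv,
      fun hk hdeg hv =>
        firstSplittingApplies_of_three_le_maxGenDeg hS h𝒜 hκ hJ𝒜 hK hk hceq hdeg hv,
      fun hk hsoc hv => firstSplittingApplies_of_two_le_socleDim hS hκ hK hk hceq hsoc hv,
      fun hk _ hsoc hv =>
        thirdSplittingApplies_of_socleDim_le_one hS h𝒜 hJ𝒜 hK hk hc5 hsoc.le hv⟩
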